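/- **Proposition (maximal variation).** Let $Y$ be an irreducible quasi-projective complex algebraic variety with a fixed embedding $Y\hookrightarrow\mathbb{P}^N$, let $V$ be an irreducible quasi-projective complex variety of dimension $\ell\ge 1$, and let $\mathcal{X}\subset V\times Y$ be a locally closed subscheme, with projection $\pi:\mathcal{X}\to V$, such that for every $\lambda\in V(\mathbb{C})$ the fiber $X_\lambda=\pi^{-1}(\lambda)\subset Y$ has dimension $r$. Assume that the generic fiber of $\mathcal{X}\to V$ is geometrically irreducible, and that the family is *maximally varying*: the map from $\{\lambda\in V(\mathbb{C}) : X_\lambda \text{ irreducible}\}$ to the Chow variety of $r$-dimensional cycles, sending $\lambda$ to the cycle $[\overline{X_\lambda}]$ of the closure of $X_\lambda$ in $\mathbb{P}^N$, has finite fibers. Let $\mathcal{X}_V^\ell$ be the $\ell$-th fiber power of $\mathcal{X}$ over $V$ and let $\rho_\ell:\mathcal{X}_V^\ell\to Y^\ell$ be the map $(\lambda,x_1,\dots,x_\ell)\mapsto(x_1,\dots,x_\ell)$. Then $\rho_\ell$ is generically finite, in the following sense: there is an open $W\subset Y^\ell$ such that $\rho_\ell^{-1}(y)$ is finite for every $y\in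 W$ and the complement of $\rho_\ell^{-1}(W)$ in $\mathcal{X}_V^\ell$ has dimension smaller than $\dim\mathcal{X}_V^\ell$. In particular $$\dim\rho_\ell(\mathcal{X}_V^\ell)=\dim\mathcal{X}_V^\ell=\ell(r+1).$$ -/

import Mathlib

open CategoryTheory CategoryTheory.Limits AlgebraicGeometry

noncomputable section

namespace MaxVarying

attribute [local instance] MvPolynomial.gradedAlgebra

/-- The base `Spec ℂ`. -/
abbrev SpecC : Scheme.{0} := Spec (CommRingCat.of ℂ)

/-- Complex projective space of dimension `N`, the `Proj` of the standard graded ring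
`ℂ[x₀, …, x_N]`. -/
def ProjSpace (N : ℕ) : Scheme.{0} :=
  Proj (MvPolynomial.homogeneousSubmodule (Fin (N + 1)) ℂ)

/-- The structure morphism of complex projective space: `Proj A → Spec A₀ → Spec ℂ`. -/
def ProjSpace.toSpecC (N : ℕ) : ProjSpace N ⟶ SpecC :=
  Proj.toSpecZero (MvPolynomial.homogeneousSubmodule (Fin (N + 1)) ℂ) ≫
    Spec.map (CommRingCat.ofHom
      (algebraMap ℂ (MvPolynomial.homogeneousSubmodule (Fin (N + 1)) ℂ 0)))

/-- `j` is a projective embedding of the `ℂ`-scheme `Y`: an immersion over `ℂ` (that is, a closed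
immersion into an open subscheme) into a projective space. -/
structure IsProjectiveEmbedding {Y : Scheme.{0}} (sY : Y ⟶ SpecC) {N : ℕ}
    (j : Y ⟶ ProjSpace N) : Prop where
  isImmersion : IsImmersion j
  comp_eq : j ≫ ProjSpace.toSpecC N = sY

/-- A quasi-projective complex scheme: one that has a projective embedding. -/
def IsQuasiProjective {Y : Scheme.{0}} (sY : Y ⟶ SpecC) : Prop :=
  ∃ (N : ℕ) (j : Y ⟶ ProjSpace N), IsProjectiveEmbedding sY j

section Family

/-! A family of subschemes of `Y` parametrized by `V` is given by a locally closed subscheme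
`i : X ⟶ V × Y`. -/

variable {V Y X : Scheme.{0}} {sV : V ⟶ SpecC} {sY : Y ⟶ SpecC}

/-- The projection `π : X ⟶ V` of the family to its base. -/
def toBase (i : X ⟶ pullback sV sY) : X ⟶ V := i ≫ pullback.fst sV sY

/-- The projection `X ⟶ Y`, whose restriction to a fiber is the inclusion of that fiber in `Y`. -/
def toAmbient (i : X ⟶ pullback sV sY) : X ⟶ Y := i ≫ pullback.snd sV sY

lemma toBase_comp (i : X ⟶ pullback sV sY) : toBase i ≫ sV = toAmbient i ≫ sY := by
  simp [toBase, toAmbient, pullback.condition]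

/-- The subset `X_v` of `Y`, for `v` a point of the base. -/
def member (i : X ⟶ pullback sV sY) (v : V) : Set Y :=
  toAmbient i '' (toBase i ⁻¹' {v})

/-- The complex points of the base (its closed points) whose fiber is irreducible. -/
def IrreducibleLocus (i : X ⟶ pullback sV sY) : Set V :=
  {v | IsClosed {v} ∧ IsIrreducible (toBase i ⁻¹' {v})}

lemma isIrreducible_image_member (i : X ⟶ pullback sV sY) {N : ℕ} (j : Y ⟶ ProjSpace N)
    {v : V} (hv : v ∈ IrreducibleLocus i) : IsIrreducible (j '' member i v) :=
  (hv.2.image _ (toAmbient i).continuous.continuousOn).image _ j.continuous.continuousOn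

open Classical in
/-- The map to the Chow variety, on points. With respect to the projective embedding
`j : Y ⟶ ℙ^N`, it sends `v` with irreducible fiber to the cycle `[Z]` on `ℙ^N`, where `Z` is the
closure of `X_v` in `ℙ^N`; as usual for Mathlib's cycles, the prime cycle `[Z]` is the function
with value `1` at the generic point of `Z` and `0` elsewhere.

The complex points of the Chow variety of cycles of `Y` are by definition effective cycles in
projective space, and the members of one family have bounded degree. -/
def chowMap (i : X ⟶ pullback sV sY) {N : ℕ} (j : Y ⟶ ProjSpace N)
    (v : IrreducibleLocus i) : AlgebraicCycle (ProjSpace N) ℕ :=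
  Function.locallyFinsuppWithin.single (isIrreducible_image_member i j v.2).genericPoint 1

/-- The family is maximally varying: its map to the Chow variety has finite fibers. -/
def IsMaximallyVarying (i : X ⟶ pullback sV sY) {N : ℕ} (j : Y ⟶ ProjSpace N) : Prop :=
  ∀ c : AlgebraicCycle (ProjSpace N) ℕ, (chowMap i j ⁻¹' {c}).Finite

end Family

/-- The `m`-th fiber power of `X` over `S`. -/
abbrev fiberPower {X S : Scheme.{0}} (f : X ⟶ S) (m : ℕ) : Scheme.{0} :=
  widePullback S (fun _ : Fin m => X) (fun _ => f)

/-- The morphism `ρ_m : X_V^m ⟶ Y^m`, `(v, x₁, …, x_m) ↦ (x₁, …, x_m)`. -/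
def rho {V Y X : Scheme.{0}} {sV : V ⟶ SpecC} {sY : Y ⟶ SpecC} (i : X ⟶ pullback sV sY)
    (m : ℕ) : fiberPower (toBase i) m ⟶ fiberPower sY m :=
  WidePullback.lift (WidePullback.base (fun _ : Fin m => toBase i) ≫ sV)
    (fun k => WidePullback.π (fun _ : Fin m => toBase i) k ≫ toAmbient i)
    (fun k => by
      rw [Category.assoc, ← toBase_comp, ← Category.assoc, WidePullback.π_arrow])

/-- A morphism `f : Z ⟶ T` (of schemes of finite type over a field) is generically finite: it has
finite fibers over an open `W ⊆ T` such that the complement of `f⁻¹(W)` has smaller dimension than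
`Z`. If `Z` is irreducible, the last condition says that `f⁻¹(W)` is non-empty, that is, that `W`
contains the generic point of the image of `f`. -/
def IsGenericallyFinite {Z T : Scheme.{0}} (f : Z ⟶ T) : Prop :=
  ∃ W : T.Opens,
    topologicalKrullDim ↥((f ⁻¹' (W : Set T))ᶜ) < topologicalKrullDim Z ∧
      ∀ y ∈ W, (f ⁻¹' {y}).Finite

end MaxVarying

end

/-! Dimensions are counted by transcendence degrees of residue fields over `ℂ`. Let `ξ` be the
generic point of the generic fiber; its degree is `ℓ + r`. Points of the fiber power have degree at
most `ℓ(r+1)`, and some point attains this bound. Such a point `z` lies over the generic point of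
`V`, and all its components are `ξ`. Inside the residue field of `z`, let `B` be the residue field
of the generic point of `V`, `K k` that of the `k`-th component, and `Y k` that of the image of this
component in `Y`. Since `X` is immersed in `V × Y`, the set `B ∪ Y k` has the same rank as `K k`.
What has to be shown is that the union of the `Y k` has rank `ℓ(r+1)`: then `ρ` preserves the degree
of `z`.

The sets `Y k` are adjoined one at a time (`le_rk_biUnion`). A step that raises the rank by at least
`r + 1` is good. If a step raises it by at most `r`, then `B` turns out to be algebraic over the
points adjoined before. In that case `m + 1` of the `Y k` together have rank `ℓ + (m+1)r`, which is
at least `(m+1)(r+1)`.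

This implication is `rk_union_le_of_finite`. If the parameter `λ` were not algebraic over the
earlier points, then for a general value of these points infinitely many `λ` would be compatible
with it. For each of them the whole member `X_λ` lies in the locus of possible values of the next
point. That locus has dimension at most `r`, so the members, of dimension `r`, are among its
finitely many components, and infinitely many `λ` share one cycle, against maximal variation. That
the whole member lies in the locus uses geometric irreducibility: a proper closed subset of the
generic member has too small a dimension (`isNilpotent_of_rk_le`).

General members have to be irreducible with a generic point close to `ξ`. This follows from a
Noether normalization over an open subset of the base, a primitive element and the Bertini–Noether
theorem (`exists_forall_exists_least_prime`).

Finally, points of maximal degree whose images have the same degree are isolated in their fibers.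
The points lying over the closure of the image of the locus where `ρ` is not quasi-finite have
smaller degree, so this set has smaller dimension (`isGenericallyFinite_of_tr`). -/

noncomputable section

namespace MaxVarying

/-! ### Transcendence degree, and rank in the matroid of algebraic independence. -/

/-- The transcendence degree, as an extended natural number. -/
def tr (k A : Type*) [CommRing k] [CommRing A] [Algebra k A] : ℕ∞ :=
  Cardinal.toENat (Algebra.trdeg k A)

/-- The rank of a subset of a domain in the matroid of algebraic independence. -/
def rk (k : Type*) {Ω : Type*} [Field k] [CommRing Ω] [IsDomain Ω] [Algebra k Ω] (S : Set Ω) : ℕ∞ :=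
  (AlgebraicIndependent.matroid k Ω).eRk S

section

variable {k : Type*} [Field k]
variable {A : Type*} [CommRing A] [Algebra k A]
variable {Ω : Type*} [CommRing Ω] [IsDomain Ω] [Algebra k Ω]

lemma rk_mono {S T : Set Ω} (h : S ⊆ T) : rk k S ≤ rk k T :=
  (AlgebraicIndependent.matroid k Ω).eRk_mono h

lemma rk_submod (S T : Set Ω) : rk k (S ∩ T) + rk k (S ∪ T) ≤ rk k S + rk k T :=
  (AlgebraicIndependent.matroid k Ω).eRk_submod S T

lemma rk_le_encard (S : Set Ω) : rk k S ≤ S.encard :=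
  (AlgebraicIndependent.matroid k Ω).eRk_le_encard S

lemma rk_union_le (S T : Set Ω) : rk k (S ∪ T) ≤ rk k S + rk k T :=
  (AlgebraicIndependent.matroid k Ω).eRk_union_le_eRk_add_eRk S T

/-- The closure operator of the matroid is relative algebraic closure, and closure does not change
the rank. -/
lemma rk_eq_of_isAlgebraic {S T : Set Ω} (h : S ⊆ T)
    (halg : ∀ t ∈ T, IsAlgebraic (Algebra.adjoin k S) t) : rk k T = rk k S := by
  refine le_antisymm ?_ (rk_mono h)
  rw [rk, rk, ← (AlgebraicIndependent.matroid k Ω).eRk_closure_eq S]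
  refine (AlgebraicIndependent.matroid k Ω).eRk_mono fun t ht ↦ ?_
  rw [AlgebraicIndependent.matroid_closure_eq]
  exact halg t ht

lemma rk_adjoin (S : Set Ω) : rk k (Algebra.adjoin k S : Set Ω) = rk k S :=
  rk_eq_of_isAlgebraic Algebra.subset_adjoin fun t ht ↦
    isAlgebraic_algebraMap (⟨t, ht⟩ : Algebra.adjoin k S)

/-- Submodularity for `S ∪ U` and `T`, whose intersection contains `S`; finiteness of the rank of
`S` allows it to be cancelled. -/
lemma rk_union_eq_of_rk_eq {S T U : Set Ω} (hST : S ⊆ T) (h : rk k T = rk k S)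
    (hfin : rk k S ≠ ⊤) : rk k (T ∪ U) = rk k (S ∪ U) := by
  refine le_antisymm ?_ (rk_mono (Set.union_subset_union_left _ hST))
  have h1 := rk_submod (k := k) (S ∪ U) T
  have h2 : rk k S ≤ rk k ((S ∪ U) ∩ T) := rk_mono (Set.subset_inter Set.subset_union_left hST)
  have h3 : S ∪ U ∪ T = T ∪ U := by
    rw [Set.union_right_comm, Set.union_eq_self_of_subset_left hST]
  rw [h3, h] at h1
  have h4 : rk k S + rk k (T ∪ U) ≤ rk k S + rk k (S ∪ U) := by
    rw [add_comm (rk k S) (rk k (S ∪ U))]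
    exact (add_le_add_left h2 _).trans h1
  exact (ENat.add_le_add_iff_left hfin).mp h4

lemma rk_univ : rk k (Set.univ : Set Ω) = tr k Ω := by
  rw [rk, tr, ← AlgebraicIndependent.matroid_cRank_eq, Matroid.toENat_cRank_eq, Matroid.eRank_def]
  rfl

variable {B : Type*} [CommRing B] [Algebra k B]

lemma tr_le_of_injective (f : A →ₐ[k] B) (hf : Function.Injective f) : tr k A ≤ tr k B := by
  have := lift_trdeg_le_of_injective f hf
  simpa [tr] using Cardinal.toENat.monotone' this

lemma tr_le_of_surjective (f : A →ₐ[k] B) (hf : Function.Surjective f) : tr k B ≤ tr k A := by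
  have := lift_trdeg_le_of_surjective f hf
  simpa [tr] using Cardinal.toENat.monotone' this

lemma tr_eq_of_algEquiv (e : A ≃ₐ[k] B) : tr k A = tr k B :=
  le_antisymm (tr_le_of_injective e.toAlgHom e.injective)
    (tr_le_of_injective e.symm.toAlgHom e.symm.injective)

/-- An injective homomorphism carries a basis to a basis: it preserves independence, and algebraic
equations are transported along it. -/
lemma rk_image [IsDomain A] (f : A →ₐ[k] Ω) (hf : Function.Injective f) (S : Set A) :
    rk k (f '' S) = rk k S := by
  obtain ⟨I, hI⟩ := (AlgebraicIndependent.matroid k A).exists_isBasis S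
  have hI' := AlgebraicIndependent.matroid_isBasis_iff.mp hI
  have : (AlgebraicIndependent.matroid k Ω).IsBasis (f '' I) (f '' S) := by
    refine AlgebraicIndependent.matroid_isBasis_iff.mpr ⟨?_, Set.image_mono hI'.2.1, ?_⟩
    · have := hI'.1.map' hf
      exact (AlgebraicIndependent.to_subtype_range this).comp (fun x : f '' I ↦
        ⟨x.1, by obtain ⟨_, y, hy, rfl⟩ := x; exact ⟨⟨y, hy⟩, rfl⟩⟩) (fun x y h ↦ by
          simpa [Subtype.ext_iff] using h)
    · rintro _ ⟨a, ha, rfl⟩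
      obtain ⟨p, hp, hpa⟩ := hI'.2.2 a ha
      let g : Algebra.adjoin k I →ₐ[k] Algebra.adjoin k (f '' I) :=
        (f.comp (Algebra.adjoin k I).val).codRestrict _ (fun x ↦ by
          rw [← AlgHom.map_adjoin]
          exact ⟨x.1, x.2, rfl⟩)
      have hg : Function.Injective g := fun x y h ↦ Subtype.ext (hf (congrArg Subtype.val h))
      refine ⟨p.map g.toRingHom, ?_, ?_⟩
      · rwa [Ne, Polynomial.map_eq_zero_iff hg]
      · have h1 := congrArg f hpa
        rw [map_zero] at h1
        rw [← h1, Polynomial.aeval_def, Polynomial.aeval_def, Polynomial.eval₂_map]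
        exact (Polynomial.hom_eval₂ p (algebraMap (Algebra.adjoin k I) A) f.toRingHom a).symm
  rw [rk, rk, ← this.encard_eq_eRk, ← hI.encard_eq_eRk, hf.encard_image]

lemma rk_range [IsDomain A] (f : A →ₐ[k] Ω) (hf : Function.Injective f) :
    rk k (Set.range f) = tr k A := by
  rw [← Set.image_univ, rk_image f hf, rk_univ]

lemma rk_subalgebra (S : Subalgebra k Ω) : rk k (S : Set Ω) = tr k S := by
  rw [← rk_range S.val Subtype.val_injective]
  simp

lemma tr_ne_top_of_finiteType [Algebra.FiniteType k A] : tr k A ≠ ⊤ := by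
  rw [tr, Ne, Cardinal.toENat_eq_top, not_le]
  exact trdeg_lt_aleph0_of_finiteType

lemma rk_range_le_tr (f : A →ₐ[k] Ω) : rk k (Set.range f) ≤ tr k A := by
  have h : Set.range f = (f.range : Set Ω) := rfl
  rw [h, rk_subalgebra]
  exact tr_le_of_surjective f.rangeRestrict f.rangeRestrict_surjective

/-- Each `t` is a root of a linear polynomial `f a * X - f b`, so it is algebraic over the image. -/
lemma tr_eq_of_isAlgebraic [IsDomain A] (f : A →ₐ[k] Ω) (hf : Function.Injective f)
    (h : ∀ t : Ω, ∃ a : A, a ≠ 0 ∧ f a * t ∈ f.range) : tr k Ω = tr k A := by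
  rw [← rk_univ, ← rk_range f hf]
  refine rk_eq_of_isAlgebraic (Set.subset_univ _) fun t _ ↦ ?_
  obtain ⟨a, ha, b, hb⟩ := h t
  have hr : Algebra.adjoin k (Set.range f) = f.range := by
    rw [show Set.range f = (f.range : Set Ω) from rfl, Algebra.adjoin_eq]
  rw [hr]
  refine ⟨Polynomial.C (⟨f a, a, rfl⟩ : f.range) * Polynomial.X -
    Polynomial.C (⟨f b, b, rfl⟩ : f.range), ?_, ?_⟩
  · intro h0
    have := congrArg (Polynomial.coeff · 1) h0
    simp [Polynomial.coeff_C] at this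
    exact ha (hf (by simpa using congrArg Subtype.val this))
  · simp only [map_sub, map_mul, Polynomial.aeval_C, Polynomial.aeval_X]
    change f a * t - f b = 0
    rw [← hb]; exact sub_self _

lemma tr_fractionRing [IsDomain A] {F : Type*} [Field F] [Algebra k F] [Algebra A F]
    [IsScalarTower k A F] [IsFractionRing A F] : tr k F = tr k A := by
  refine tr_eq_of_isAlgebraic (IsScalarTower.toAlgHom k A F) (IsFractionRing.injective A F)
    fun t ↦ ?_
  obtain ⟨⟨a, s⟩, h⟩ := IsLocalization.surj (nonZeroDivisors A) t
  exact ⟨s, nonZeroDivisors.coe_ne_zero s, a, by simp [← h, mul_comm]⟩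

/-- A proper specialization lowers the transcendence degree. -/
lemma tr_add_one_le_of_surjective [IsDomain A] (f : A →ₐ[k] Ω) (hf : Function.Surjective f)
    (hker : ¬ Function.Injective f) : tr k Ω + 1 ≤ tr k A := by
  obtain ⟨s, hs⟩ := exists_isTranscendenceBasis k Ω
  choose g hg using hf
  -- Lifts of a transcendence basis of the target stay independent, and `f` is injective on the
  -- algebra they generate.
  have hx : AlgebraicIndependent k (fun i : s ↦ g i.1) := by
    refine AlgebraicIndependent.of_comp f ?_
    convert hs.1 using 1
    ext i
    exact hg _
  have hinj : Set.InjOn f (Algebra.adjoin k (Set.range fun i : s ↦ g i.1)) := by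
    intro a ha b hb hab
    rw [SetLike.mem_coe, Algebra.adjoin_range_eq_range_aeval] at ha hb
    obtain ⟨p, rfl⟩ := ha
    obtain ⟨q, rfl⟩ := hb
    have h1 : ∀ p : MvPolynomial s k, f (MvPolynomial.aeval (fun i : s ↦ g i.1) p) =
        MvPolynomial.aeval (fun i : s ↦ i.1) p := fun p ↦ by
      rw [← AlgHom.comp_apply, MvPolynomial.comp_aeval]
      simp only [hg]
    change f (MvPolynomial.aeval (fun i : s ↦ g i.1) p) =
      f (MvPolynomial.aeval (fun i : s ↦ g i.1) q) at hab
    rw [h1, h1] at hab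
    have := hs.1 hab
    rw [this]
  obtain ⟨a, ha, ha0⟩ : ∃ a : A, f a = 0 ∧ a ≠ 0 := by
    by_contra! h
    exact hker ((injective_iff_map_eq_zero f).mpr h)
  have hns : a ∉ Set.range fun i : s ↦ g i.1 := fun h ↦ ha0
    (hinj (Algebra.subset_adjoin h) (zero_mem _) (by simpa using ha))
  have hind : (AlgebraicIndependent.matroid k A).Indep
      (insert a (Set.range fun i : s ↦ g i.1)) := by
    refine AlgebraicIndependent.matroid_indep_iff.mpr ?_
    rw [AlgebraicIndepOn.insert_iff hns]
    -- An equation of `a` over the lifts can be taken with nonzero constant term. As `f a = 0`,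
    -- applying `f` leaves only the image of that term, which contradicts the injectivity.
    refine ⟨hx.to_subtype_range, fun halg ↦ ?_⟩
    rw [Set.image_id] at halg
    obtain ⟨p, hp0, hp⟩ := IsAlgebraic.exists_nonzero_coeff_and_aeval_eq_zero
      (show IsAlgebraic _ a from halg) (mem_nonZeroDivisors_of_ne_zero ha0)
    have h2 := congrArg f hp
    apply hp0
    have h3 : f (p.coeff 0 : A) = 0 := by
      have h4 : (Polynomial.aeval a p : A) = a * (Polynomial.aeval a p.divX) + p.coeff 0 := by
        have h5 := congrArg (Polynomial.aeval a) p.X_mul_divX_add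
        rw [map_add, map_mul, Polynomial.aeval_X, Polynomial.aeval_C] at h5
        exact h5.symm
      rw [h4] at h2
      simpa [ha] using h2
    exact Subtype.ext (hinj (p.coeff 0).2 (zero_mem _) (by simpa using h3))
  rw [← rk_univ, ← rk_univ]
  have h5 : rk k (Set.univ : Set Ω) = s.encard := by
    rw [rk]
    have hs' := AlgebraicIndependent.matroid_isBase_iff.mpr hs
    rw [hs'.encard_eq_eRank, Matroid.eRank_def]
    rfl
  have h6 : (Set.range fun i : s ↦ g i.1).encard = s.encard := by
    rw [← Set.image_univ, Function.Injective.encard_image]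
    · simp
    · exact hx.injective
  rw [h5, ← h6, ← Set.encard_insert_of_notMem hns, ← hind.eRk_eq_encard]
  exact rk_mono (Set.subset_univ _)

end

/-! ### Noether normalization over an open subset of the base. -/

/-- `x` is a Noether normalization of the `B`-algebra `A` over the complement of `b = 0`. -/
structure IsGenericNoether {B A : Type*} [CommRing B] [CommRing A] [Algebra B A] (b : B) {d : ℕ}
    (x : Fin d → A) : Prop where
  ne_zero : b ≠ 0
  algebraicIndependent : AlgebraicIndependent B x
  exists_isIntegral : ∀ a : A, ∃ n : ℕ,
    (MvPolynomial.aeval x : MvPolynomial (Fin d) B →ₐ[B] A).toRingHom.IsIntegralElem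
      (algebraMap B A b ^ n * a)

/-- The elements `a` with this property form a subalgebra: exponents of `b` add up in sums and
products. -/
lemma isIntegralElem_pow_mul_of_gens {B A P : Type*} [CommRing B] [CommRing A] [Algebra B A]
    [CommRing P] [Algebra B P] (g : P →ₐ[B] A) (b : B) (S : Set A) (hS : Algebra.adjoin B S = ⊤)
    (h : ∀ s ∈ S, ∃ n : ℕ, g.toRingHom.IsIntegralElem (algebraMap B A b ^ n * s)) (a : A) :
    ∃ n : ℕ, g.toRingHom.IsIntegralElem (algebraMap B A b ^ n * a) := by
  have hB : ∀ c : B, g.toRingHom.IsIntegralElem (algebraMap B A c) := fun c ↦ by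
    have := g.toRingHom.isIntegralElem_map (x := algebraMap B P c)
    simpa using this
  have hbn : ∀ n : ℕ, g.toRingHom.IsIntegralElem (algebraMap B A b ^ n) := fun n ↦ by
    rw [← map_pow]; exact hB _
  have ha : a ∈ Algebra.adjoin B S := hS ▸ Algebra.mem_top
  induction ha using Algebra.adjoin_induction with
  | mem s hs => exact h s hs
  | algebraMap c => exact ⟨0, by simpa using hB c⟩
  | add u v _ _ hu hv =>
    obtain ⟨n, hn⟩ := hu
    obtain ⟨m, hm⟩ := hv
    refine ⟨n + m, ?_⟩
    have := RingHom.IsIntegralElem.add _ (RingHom.IsIntegralElem.mul _ (hbn m) hn)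
      (RingHom.IsIntegralElem.mul _ (hbn n) hm)
    convert this using 1
    ring
  | mul u v _ _ hu hv =>
    obtain ⟨n, hn⟩ := hu
    obtain ⟨m, hm⟩ := hv
    refine ⟨n + m, ?_⟩
    have := RingHom.IsIntegralElem.mul _ hn hm
    convert this using 1
    ring

/-- Noether normalization over the fraction field of `B`, with denominators cleared: those of the
coordinates, so that they lie in `A`, and those of the integral equations of finitely many
generators, which give `b`. -/
theorem exists_isGenericNoether {B A : Type*} [CommRing B] [IsDomain B] [CommRing A] [IsDomain A]
    [Algebra B A] (hinj : Function.Injective (algebraMap B A)) [Algebra.FiniteType B A] :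
    ∃ (b : B) (d : ℕ) (x : Fin d → A), IsGenericNoether b x := by
  classical
  let K := FractionRing B
  let L := FractionRing A
  have hBL : Function.Injective (algebraMap B L) := by
    rw [IsScalarTower.algebraMap_eq B A L]
    exact (IsFractionRing.injective A L).comp hinj
  let : FaithfulSMul B L := (faithfulSMul_iff_algebraMap_injective B L).mpr hBL
  let : Algebra K L := FractionRing.liftAlgebra B L
  have : IsScalarTower B K L := FractionRing.isScalarTower_liftAlgebra B L
  obtain ⟨S, hS⟩ := (inferInstance : Algebra.FiniteType B A).out
  let AK : Subalgebra K L := Algebra.adjoin K (algebraMap A L '' S)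
  have hmem : ∀ a : A, algebraMap A L a ∈ AK := fun a ↦ by
    have ha : a ∈ Algebra.adjoin B (S : Set A) := hS ▸ Algebra.mem_top
    induction ha using Algebra.adjoin_induction with
    | mem s hs => exact Algebra.subset_adjoin ⟨s, hs, rfl⟩
    | algebraMap c =>
      rw [← IsScalarTower.algebraMap_apply, IsScalarTower.algebraMap_apply B K L]
      exact AK.algebraMap_mem _
    | add u v _ _ hu hv => rw [map_add]; exact add_mem hu hv
    | mul u v _ _ hu hv => rw [map_mul]; exact mul_mem hu hv
  -- Elements of `AK` are fractions with numerator in `A` and denominator in `B`.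
  have hden : ∀ z ∈ AK, ∃ c : B, c ≠ 0 ∧ ∃ a : A, algebraMap B L c * z = algebraMap A L a := by
    intro z hz
    induction hz using Algebra.adjoin_induction with
    | mem s hs =>
      obtain ⟨s, -, rfl⟩ := hs
      exact ⟨1, one_ne_zero, s, by simp⟩
    | algebraMap c =>
      obtain ⟨⟨u, s⟩, h⟩ := IsLocalization.surj (nonZeroDivisors B) c
      refine ⟨s, nonZeroDivisors.coe_ne_zero s, algebraMap B A u, ?_⟩
      rw [← IsScalarTower.algebraMap_apply, IsScalarTower.algebraMap_apply B K L,
        IsScalarTower.algebraMap_apply B K L, ← map_mul, mul_comm, h]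
    | add u v _ _ hu hv =>
      obtain ⟨c, hc, a, h⟩ := hu
      obtain ⟨c', hc', a', h'⟩ := hv
      refine ⟨c * c', mul_ne_zero hc hc', algebraMap B A c' * a + algebraMap B A c * a', ?_⟩
      rw [map_add, map_mul, map_mul, map_mul, ← h, ← h', ← IsScalarTower.algebraMap_apply,
        ← IsScalarTower.algebraMap_apply]
      ring
    | mul u v _ _ hu hv =>
      obtain ⟨c, hc, a, h⟩ := hu
      obtain ⟨c', hc', a', h'⟩ := hv
      refine ⟨c * c', mul_ne_zero hc hc', a * a', ?_⟩
      rw [map_mul, map_mul, ← h, ← h']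
      ring
  have : Algebra.FiniteType K AK :=
    (Subalgebra.fg_iff_finiteType AK).mp ⟨S.image (algebraMap A L), by simp [AK]⟩
  obtain ⟨d, g, hg, hgi⟩ := exists_integral_inj_algHom_of_fg K AK
  choose c hc x hx using fun i : Fin d ↦ hden (g (MvPolynomial.X i)) (g (MvPolynomial.X i)).2
  have hcK : ∀ i, algebraMap B K (c i) ≠ 0 := fun i ↦ by
    simpa using hc i
  -- Scaling the variables by the `c i` is an automorphism over `K`, so the coordinates may be taken
  -- in `A`.
  let σ : MvPolynomial (Fin d) K →ₐ[K] MvPolynomial (Fin d) K :=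
    MvPolynomial.aeval fun i ↦ MvPolynomial.C (algebraMap B K (c i)) * MvPolynomial.X i
  let τ : MvPolynomial (Fin d) K →ₐ[K] MvPolynomial (Fin d) K :=
    MvPolynomial.aeval fun i ↦ MvPolynomial.C (algebraMap B K (c i))⁻¹ * MvPolynomial.X i
  have hCK : ∀ (f : MvPolynomial (Fin d) K →ₐ[K] MvPolynomial (Fin d) K) (u : K),
      f (MvPolynomial.C u) = MvPolynomial.C u := fun f u ↦ f.commutes u
  have hστ : σ.comp τ = AlgHom.id K _ := by
    ext1 i
    simp only [σ, τ, AlgHom.comp_apply, MvPolynomial.aeval_X, map_mul, hCK, AlgHom.id_apply]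
    rw [← mul_assoc, ← MvPolynomial.C_mul, inv_mul_cancel₀ (hcK i), MvPolynomial.C_1, one_mul]
  have hτσ : τ.comp σ = AlgHom.id K _ := by
    ext1 i
    simp only [σ, τ, AlgHom.comp_apply, MvPolynomial.aeval_X, map_mul, hCK, AlgHom.id_apply]
    rw [← mul_assoc, ← MvPolynomial.C_mul, mul_inv_cancel₀ (hcK i), MvPolynomial.C_1, one_mul]
  let e : MvPolynomial (Fin d) K ≃ₐ[K] MvPolynomial (Fin d) K := AlgEquiv.ofAlgHom σ τ hστ hτσ
  let g' : MvPolynomial (Fin d) K →ₐ[K] AK := g.comp e.toAlgHom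
  have hg' : Function.Injective g' := hg.comp e.injective
  have hgi' : g'.toRingHom.IsIntegral := by
    refine RingHom.IsIntegral.trans _ _ ?_ hgi
    exact RingHom.isIntegral_of_surjective _ e.surjective
  have hg'X : ∀ i, (g' (MvPolynomial.X i) : L) = algebraMap A L (x i) := fun i ↦ by
    rw [← hx i]
    have : g' (MvPolynomial.X i) = algebraMap K AK (algebraMap B K (c i)) * g (MvPolynomial.X i) := by
      change g (σ (MvPolynomial.X i)) = _
      simp only [σ, MvPolynomial.aeval_X, map_mul]
      congr 1
      exact g.commutes _
    rw [this, IsScalarTower.algebraMap_apply B K L]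
    rfl
  let P := MvPolynomial (Fin d) B
  let ev : P →ₐ[B] A := MvPolynomial.aeval x
  have hevC : ∀ r : B, ev (MvPolynomial.C r) = algebraMap B A r := fun r ↦ ev.commutes r
  have hevX : ∀ i, ev (MvPolynomial.X i) = x i := fun i ↦ MvPolynomial.aeval_X x i
  let inc : A →+* AK := (algebraMap A L).codRestrict AK hmem
  have hinc : Function.Injective inc := fun u v h ↦
    IsFractionRing.injective A L (congrArg Subtype.val h)
  have hcomm : ∀ p : P, inc (ev p) = g' (MvPolynomial.map (algebraMap B K) p) := by
    intro p
    have : (inc.comp ev.toRingHom) = g'.toRingHom.comp (MvPolynomial.map (algebraMap B K)) := by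
      refine MvPolynomial.ringHom_ext (fun r ↦ ?_) (fun i ↦ ?_)
      · apply Subtype.ext
        have h1 : g' (MvPolynomial.C (algebraMap B K r)) = algebraMap K AK (algebraMap B K r) :=
          g'.commutes _
        simp only [RingHom.comp_apply, AlgHom.toRingHom_eq_coe, RingHom.coe_coe, hevC,
          MvPolynomial.map_C, h1]
        change algebraMap A L (algebraMap B A r) = algebraMap K L (algebraMap B K r)
        rw [← IsScalarTower.algebraMap_apply, ← IsScalarTower.algebraMap_apply]
      · apply Subtype.ext
        simp only [RingHom.comp_apply, AlgHom.toRingHom_eq_coe, RingHom.coe_coe, hevX,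
          MvPolynomial.map_X, hg'X]
        rfl
    exact congrArg (fun f : P →+* AK ↦ f p) this
  have hev : Function.Injective ev := by
    intro p q h
    have h1 := congrArg inc h
    rw [hcomm, hcomm] at h1
    exact MvPolynomial.map_injective _ (IsFractionRing.injective B K) (hg' h1)
  have key : ∀ a : A, ∃ c : B, c ≠ 0 ∧ ev.toRingHom.IsIntegralElem (algebraMap B A c * a) := by
    intro a
    let := g'.toRingHom.toAlgebra
    let : Algebra P AK := (g'.toRingHom.comp (MvPolynomial.map (algebraMap B K))).toAlgebra
    let : Algebra P (MvPolynomial (Fin d) K) := MvPolynomial.algebraMvPolynomial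
    have : IsScalarTower P (MvPolynomial (Fin d) K) AK := IsScalarTower.of_algebraMap_eq' rfl
    -- `K[x]` is the localization of `B[x]` at the nonzero constants, so one constant clears an
    -- integral equation.
    obtain ⟨⟨m, hm⟩, h⟩ := IsIntegral.exists_multiple_integral_of_isLocalization
      (R := P) (Rₘ := MvPolynomial (Fin d) K)
      ((nonZeroDivisors B).map (MvPolynomial.C (σ := Fin d))) (inc a) (hgi' (inc a))
    obtain ⟨c, hc, rfl⟩ := hm
    refine ⟨c, nonZeroDivisors.ne_zero hc, ?_⟩
    obtain ⟨q, hq, hq0⟩ := h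
    refine ⟨q, hq, hinc ?_⟩
    rw [map_zero, Polynomial.hom_eval₂, ← hq0]
    have e1 : inc.comp ev.toRingHom = algebraMap P AK := RingHom.ext fun p ↦ hcomm p
    rw [e1]
    congr 1
    rw [map_mul, Submonoid.smul_def, Algebra.smul_def, ← e1]
    simp [hevC]
  choose c' hc' hc'i using key
  refine ⟨∏ s ∈ S, c' s, d, x, Finset.prod_ne_zero_iff.mpr fun s _ ↦ hc' s, hev, ?_⟩
  refine isIntegralElem_pow_mul_of_gens ev _ S hS fun s hs ↦ ⟨1, ?_⟩
  have hB : ev.toRingHom.IsIntegralElem (algebraMap B A (∏ t ∈ S.erase s, c' t)) := by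
    have := ev.toRingHom.isIntegralElem_map (x := algebraMap B P (∏ t ∈ S.erase s, c' t))
    simpa using this
  have := RingHom.IsIntegralElem.mul _ hB (hc'i s)
  rwa [← mul_assoc, ← map_mul, mul_comm (∏ t ∈ S.erase s, c' t), Finset.mul_prod_erase _ _ hs,
    ← pow_one (algebraMap B A _)] at this

/-! ### Lying over and going down after inverting one element. -/

section GenericallyIntegral

variable {P A : Type*} [CommRing P] [CommRing A] [Algebra P A]

/-- Lying over for an extension that is integral up to powers of `β`. -/
lemma exists_prime_comap_integralClosure_eq {β : A} (hβ : IsIntegral P β)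
    (h : ∀ a : A, ∃ n : ℕ, IsIntegral P (β ^ n * a)) (Q : Ideal (integralClosure P A)) [Q.IsPrime]
    (hQ : (⟨β, hβ⟩ : integralClosure P A) ∉ Q) :
    ∃ Q' : Ideal A, Q'.IsPrime ∧ Q'.comap (algebraMap (integralClosure P A) A) = Q := by
  let C := integralClosure P A
  let β' : C := ⟨β, hβ⟩
  -- `A` and the integral closure agree after inverting `β`, so up to powers of `β` the extended
  -- ideal comes from `Q`.
  have hmap : ∀ a ∈ Q.map (algebraMap C A), ∃ n : ℕ, ∃ c ∈ Q, β ^ n * a = algebraMap C A c := by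
    intro a ha
    induction ha using Submodule.span_induction with
    | mem a ha =>
      obtain ⟨c, hc, rfl⟩ := ha
      exact ⟨0, c, hc, by simp⟩
    | zero => exact ⟨0, 0, Q.zero_mem, by simp⟩
    | add u v _ _ hu hv =>
      obtain ⟨n, c, hc, h1⟩ := hu
      obtain ⟨m, d, hd, h2⟩ := hv
      refine ⟨n + m, β' ^ m * c + β' ^ n * d,
        Q.add_mem (Q.mul_mem_left _ hc) (Q.mul_mem_left _ hd), ?_⟩
      rw [map_add, map_mul, map_mul, ← h1, ← h2, map_pow, map_pow]
      change _ = β ^ m * (β ^ n * u) + β ^ n * (β ^ m * v)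
      ring
    | smul r v _ hv =>
      obtain ⟨m, d, hd, h2⟩ := hv
      obtain ⟨n, hn⟩ := h r
      refine ⟨n + m, ⟨β ^ n * r, hn⟩ * d, Q.mul_mem_left _ hd, ?_⟩
      rw [map_mul, ← h2, smul_eq_mul]
      change _ = (β ^ n * r) * (β ^ m * v)
      ring
  have hdisj : Disjoint (Q.map (algebraMap C A) : Set A)
      (Q.primeCompl.map (algebraMap C A) : Submonoid A) := by
    rw [Set.disjoint_left]
    rintro _ ha ⟨c, hc, rfl⟩
    obtain ⟨n, d, hd, h1⟩ := hmap _ ha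
    have h2 : β' ^ n * c = d := Subtype.ext h1
    rw [← h2] at hd
    rcases (inferInstance : Q.IsPrime).mem_or_mem hd with h3 | h3
    · exact hQ ((inferInstance : Q.IsPrime).mem_of_pow_mem _ h3)
    · exact hc h3
  obtain ⟨Q', hp, hle, hd⟩ := Ideal.exists_le_prime_disjoint _ _ hdisj
  refine ⟨Q', hp, le_antisymm (fun c hc ↦ ?_) (Ideal.map_le_iff_le_comap.mp hle)⟩
  by_contra hcQ
  exact Set.disjoint_left.mp hd hc ⟨c, hcQ, rfl⟩

/-- Lying over holds for the integral closure, and its primes that avoid `β` lift to `A`. -/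
lemma exists_prime_comap_eq {β : A} (hβ : IsIntegral P β)
    (h : ∀ a : A, ∃ n : ℕ, IsIntegral P (β ^ n * a)) (p : Ideal P) [p.IsPrime]
    (hker : RingHom.ker (algebraMap P A) ≤ p) {b : P} (hb : algebraMap P A b = β) (hbp : b ∉ p) :
    ∃ Q : Ideal A, Q.IsPrime ∧ Q.comap (algebraMap P A) = p := by
  let C := integralClosure P A
  have hker' : RingHom.ker (algebraMap P C) ≤ p := fun a ha ↦ hker (by
    rw [RingHom.mem_ker, IsScalarTower.algebraMap_apply P C A, RingHom.mem_ker.mp ha, map_zero])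
  obtain ⟨Q, -, hQ, hQp⟩ := Ideal.exists_ideal_over_prime_of_isIntegral (S := C) p ⊥ hker'
  have hbC : algebraMap P C b = ⟨β, hβ⟩ := Subtype.ext hb
  obtain ⟨Q', hQ', hc⟩ := exists_prime_comap_integralClosure_eq hβ h Q (fun hm ↦ by
    rw [← hbC] at hm
    exact hbp (hQp ▸ hm))
  exact ⟨Q', hQ', by rw [IsScalarTower.algebraMap_eq P C A, ← Ideal.comap_comap, hc, hQp]⟩

/-- Going down for an extension that is integral up to powers of `β`. -/
lemma exists_prime_le_comap_eq [IsDomain A] [IsDomain P] [IsIntegrallyClosed P]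
    (hinj : Function.Injective (algebraMap P A)) {β : A} (hβ : IsIntegral P β)
    (h : ∀ a : A, ∃ n : ℕ, IsIntegral P (β ^ n * a)) (Q : Ideal A) [Q.IsPrime] (hβQ : β ∉ Q)
    (p : Ideal P) [p.IsPrime] (hp : p ≤ Q.comap (algebraMap P A)) :
    ∃ Q' ≤ Q, Q'.IsPrime ∧ Q'.comap (algebraMap P A) = p := by
  let C := integralClosure P A
  have : FaithfulSMul P C := (faithfulSMul_iff_algebraMap_injective P C).mpr fun u v huv ↦ by
    apply hinj
    rw [IsScalarTower.algebraMap_apply P C A, huv, ← IsScalarTower.algebraMap_apply P C A]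
  let QC := Q.comap (algebraMap C A)
  have hQC : QC.comap (algebraMap P C) = Q.comap (algebraMap P A) := by
    rw [IsScalarTower.algebraMap_eq P C A, ← Ideal.comap_comap]
  have : QC.LiesOver (Q.comap (algebraMap P A)) := ⟨hQC.symm⟩
  -- Going down in the integral closure, an integral extension of an integrally closed domain.
  obtain ⟨Q1, hle, hQ1, hover⟩ := Ideal.exists_ideal_le_liesOver_of_le QC hp
  obtain ⟨Q', hQ', hc⟩ := exists_prime_comap_integralClosure_eq hβ h Q1 (fun hm ↦ hβQ (hle hm))
  refine ⟨Q', fun a ha ↦ ?_, hQ', ?_⟩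
  · obtain ⟨n, hn⟩ := h a
    have h1 : (⟨β ^ n * a, hn⟩ : C) ∈ Q1 := by
      rw [← hc]
      exact Q'.mul_mem_left _ ha
    rcases (inferInstance : Q.IsPrime).mem_or_mem (hle h1 : β ^ n * a ∈ Q) with h3 | h3
    · exact absurd ((inferInstance : Q.IsPrime).mem_of_pow_mem _ h3) hβQ
    · exact h3
  · rw [IsScalarTower.algebraMap_eq P C A, ← Ideal.comap_comap, hc]
    exact hover.over.symm

end GenericallyIntegral

/-- Incomparability in an integral extension; only the smaller ideal has to be prime. -/
lemma eq_of_le_of_comap_eq {R S : Type*} [CommRing R] [CommRing S] {f : R →+* S}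
    (hf : f.IsIntegral) {I J : Ideal S} [I.IsPrime] (hIJ : I ≤ J) (h : I.comap f = J.comap f) :
    I = J := by
  let _ := f.toAlgebra
  have : Algebra.IsIntegral R S := ⟨hf⟩
  by_contra hne
  exact (Ideal.IsIntegral.comap_lt_comap (R := R) (lt_of_le_of_ne hIJ hne)).ne h

lemma tr_mvPolynomial {k : Type*} [Field k] {D : Type*} [CommRing D] [IsDomain D] [Algebra k D]
    {d : ℕ} : tr k (MvPolynomial (Fin d) D) = tr k D + d := by
  rw [tr, ← trdeg_add_eq k D (A := MvPolynomial (Fin d) D), map_add, ← tr, MvPolynomial.trdeg_of_isDomain]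
  simp

/-! ### Extension of ideals to polynomial rings. -/

/-- The extension of the ideal `q` to a polynomial ring. -/
def polyIdeal {B : Type*} [CommRing B] (q : Ideal B) (d : ℕ) : Ideal (MvPolynomial (Fin d) B) :=
  RingHom.ker (MvPolynomial.map (σ := Fin d) (Ideal.Quotient.mk q))

section

variable {B : Type*} [CommRing B] (q : Ideal B) (d : ℕ)

instance [q.IsPrime] : (polyIdeal q d).IsPrime := RingHom.ker_isPrime _

lemma mem_polyIdeal {p : MvPolynomial (Fin d) B} : p ∈ polyIdeal q d ↔ ∀ m, p.coeff m ∈ q := by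
  rw [polyIdeal, RingHom.mem_ker, MvPolynomial.ext_iff]
  simp [MvPolynomial.coeff_map, Ideal.Quotient.eq_zero_iff_mem]

lemma comap_C_polyIdeal : (polyIdeal q d).comap MvPolynomial.C = q := by
  ext b
  rw [Ideal.mem_comap, mem_polyIdeal]
  constructor
  · intro h
    simpa using h 0
  · intro h m
    rw [MvPolynomial.coeff_C]
    split_ifs
    exacts [h, q.zero_mem]

lemma polyIdeal_le {J : Ideal (MvPolynomial (Fin d) B)} (h : q ≤ J.comap MvPolynomial.C) :
    polyIdeal q d ≤ J := fun p hp ↦ by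
  rw [mem_polyIdeal] at hp
  rw [p.as_sum]
  refine J.sum_mem fun m _ ↦ ?_
  rw [← mul_one (p.coeff m), ← MvPolynomial.C_mul_monomial]
  exact J.mul_mem_right _ (h (hp m))

end

/-! ### Fibers of an algebra with a generic Noether normalization. -/

namespace IsGenericNoether

variable {B A : Type*} [CommRing B] [CommRing A] [Algebra B A] {b : B} {d : ℕ} {x : Fin d → A}

/-- Lying over, applied to the generic point of the affine space over `q`. -/
lemma exists_prime (h : IsGenericNoether b x) (q : Ideal B) [q.IsPrime] (hq : b ∉ q) :
    ∃ Q : Ideal A, Q.IsPrime ∧ Q.comap (MvPolynomial.aeval x : _ →ₐ[B] A) = polyIdeal q d := by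
  let _ := (MvPolynomial.aeval x : MvPolynomial (Fin d) B →ₐ[B] A).toRingHom.toAlgebra
  have hb : algebraMap (MvPolynomial (Fin d) B) A (MvPolynomial.C b) = algebraMap B A b :=
    (MvPolynomial.aeval x : MvPolynomial (Fin d) B →ₐ[B] A).commutes b
  refine exists_prime_comap_eq (P := MvPolynomial (Fin d) B) (β := algebraMap B A b)
    (hb ▸ isIntegral_algebraMap) h.exists_isIntegral (polyIdeal q d) (fun p hp ↦ ?_) hb (fun hm ↦ ?_)
  · have : p = 0 := h.algebraicIndependent (by
      rw [map_zero]
      exact RingHom.mem_ker.mp hp)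
    rw [this]
    exact zero_mem _
  · rw [← comap_C_polyIdeal q d] at hq
    exact hq hm

lemma comap_algebraMap_eq {Q : Ideal A} {q : Ideal B}
    (hQ : Q.comap (MvPolynomial.aeval x : _ →ₐ[B] A) = polyIdeal q d) :
    Q.comap (algebraMap B A) = q := by
  rw [← comap_C_polyIdeal q d, ← hQ]
  ext c
  simp [Ideal.mem_comap]

section FieldBase

variable {k : Type*} [Field k] [Algebra k B] [Algebra k A] [IsScalarTower k B A]

/-- Away from `b = 0`, every element of `A ⧸ Q` is algebraic over the images of `B` and of the `d`
coordinates. -/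
lemma tr_quotient_le (h : IsGenericNoether b x) (Q : Ideal A) [Q.IsPrime]
    (hb : algebraMap B A b ∉ Q) :
    tr k (A ⧸ Q) ≤ tr k (B ⧸ Q.comap (algebraMap B A)) + d := by
  let π : A →ₐ[k] A ⧸ Q := Ideal.Quotient.mkₐ k Q
  let φ : B →ₐ[k] A ⧸ Q := π.comp (IsScalarTower.toAlgHom k B A)
  let ψ : B ⧸ Q.comap (algebraMap B A) →ₐ[k] A ⧸ Q :=
    Ideal.quotientMapₐ Q (IsScalarTower.toAlgHom k B A) le_rfl
  have hr : Set.range ψ = Set.range φ := by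
    have : φ = ψ.comp (Ideal.Quotient.mkₐ k _) := rfl
    rw [this, AlgHom.coe_comp, Set.range_comp,
      (Ideal.Quotient.mkₐ_surjective k _).range_eq, Set.image_univ]
  let T : Set (A ⧸ Q) := Set.range φ ∪ Set.range (π ∘ x)
  have h1 : rk k T ≤ tr k (B ⧸ Q.comap (algebraMap B A)) + d := by
    refine (rk_union_le _ _).trans (add_le_add (hr ▸ rk_range_le_tr ψ) ?_)
    refine (rk_le_encard _).trans ?_
    rw [← Set.image_univ]
    refine (Set.encard_image_le _ _).trans ?_
    simp
  rw [← rk_univ, rk_eq_of_isAlgebraic (Set.subset_univ T)]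
  · exact h1
  intro t _
  obtain ⟨a, rfl⟩ := Ideal.Quotient.mkₐ_surjective k Q t
  obtain ⟨n, p, hp, hpa⟩ := h.exists_isIntegral a
  let R := Algebra.adjoin k T
  have hφ : ∀ c, φ c ∈ R := fun c ↦ Algebra.subset_adjoin (.inl ⟨c, rfl⟩)
  let g : MvPolynomial (Fin d) B →+* A ⧸ Q :=
    π.toRingHom.comp (MvPolynomial.aeval x : MvPolynomial (Fin d) B →ₐ[B] A).toRingHom
  have hgR : ∀ p, g p ∈ R := fun p ↦ by
    induction p using MvPolynomial.induction_on with
    | C c =>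
      have : g (MvPolynomial.C c) = φ c := by
        simp [g, φ]
      rw [this]
      exact hφ c
    | add p q hp hq => rw [map_add]; exact add_mem hp hq
    | mul_X p i hp =>
      rw [map_mul]
      refine mul_mem hp (Algebra.subset_adjoin (.inr ⟨i, ?_⟩))
      simp [g]
  let g' : MvPolynomial (Fin d) B →+* R := g.codRestrict R hgR
  have hint : IsIntegral R (π (algebraMap B A b ^ n * a)) := by
    refine ⟨p.map g', hp.map _, ?_⟩
    rw [Polynomial.eval₂_map]
    have h2 := congrArg π hpa
    rw [map_zero] at h2
    rw [← h2]
    exact (Polynomial.hom_eval₂ p _ π.toRingHom _).symm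
  have hbn : π (algebraMap B A b ^ n) ≠ 0 := by
    intro h0
    exact hb ((inferInstance : Q.IsPrime).mem_of_pow_mem n (Ideal.Quotient.eq_zero_iff_mem.mp h0))
  rw [map_mul] at hint
  have : IsDomain R := inferInstance
  have hmem : π (algebraMap B A b ^ n) ∈ R := by
    have : π (algebraMap B A b ^ n) = φ (b ^ n) := by simp [φ]
    rw [this]
    exact hφ _
  refine IsAlgebraic.of_mul (y := π (algebraMap B A b ^ n)) ?_ ?_ hint.isAlgebraic
  · exact mem_nonZeroDivisors_of_ne_zero hbn
  · exact isAlgebraic_algebraMap (⟨_, hmem⟩ : R)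

/-- The coordinates stay independent modulo `Q`: the polynomial ring over `B ⧸ q` embeds in `A ⧸ Q`.
-/
lemma tr_le_tr_quotient {Q : Ideal A} [Q.IsPrime] {q : Ideal B} [q.IsPrime]
    (hQ : Q.comap (MvPolynomial.aeval x : _ →ₐ[B] A) = polyIdeal q d) :
    tr k (B ⧸ q) + d ≤ tr k (A ⧸ Q) := by
  have h1 : tr k (MvPolynomial (Fin d) (B ⧸ q)) = tr k (B ⧸ q) + d := tr_mvPolynomial
  rw [← h1]
  let ev : MvPolynomial (Fin d) B →ₐ[k] A :=
    (MvPolynomial.aeval x : _ →ₐ[B] A).restrictScalars k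
  let m : MvPolynomial (Fin d) B →ₐ[k] MvPolynomial (Fin d) (B ⧸ q) :=
    MvPolynomial.mapAlgHom (Ideal.Quotient.mkₐ k q)
  have hm : Function.Surjective m := MvPolynomial.map_surjective _ Ideal.Quotient.mk_surjective
  have hker : RingHom.ker m = RingHom.ker ((Ideal.Quotient.mkₐ k Q).comp ev) := by
    have h2 : RingHom.ker m = polyIdeal q d := rfl
    rw [h2, ← hQ]
    ext p
    exact (Ideal.Quotient.eq_zero_iff_mem (I := Q)).symm
  refine tr_le_of_injective (Ideal.Quotient.liftₐ (RingHom.ker m)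
    ((Ideal.Quotient.mkₐ k Q).comp ev) (fun a ha ↦ (hker ▸ ha :)) |>.comp
    (Ideal.quotientKerAlgEquivOfSurjective hm).symm.toAlgHom) ?_
  rw [AlgHom.coe_comp]
  exact Function.Injective.comp (RingHom.lift_injective_of_ker_le_ideal _ _ hker.ge)
    (Ideal.quotientKerAlgEquivOfSurjective hm).symm.injective

lemma exists_tr_le (h : IsGenericNoether b x) (q : Ideal B) [q.IsPrime] (hq : b ∉ q) :
    ∃ Q : Ideal A, Q.IsPrime ∧ Q.comap (algebraMap B A) = q ∧ tr k (B ⧸ q) + d ≤ tr k (A ⧸ Q) := by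
  obtain ⟨Q, hQ, hc⟩ := h.exists_prime q hq
  exact ⟨Q, hQ, comap_algebraMap_eq hc, tr_le_tr_quotient hc⟩

/-- The upper bound at the zero ideal, and the lower bound at a prime over zero, whose quotient
cannot exceed `A`. -/
lemma tr_eq [IsDomain A] (h : IsGenericNoether b x) (hinj : Function.Injective (algebraMap B A)) :
    tr k A = tr k B + d := by
  have : IsDomain B := hinj.isDomain
  have hbot : (⊥ : Ideal A).comap (algebraMap B A) = ⊥ := by
    rw [← RingHom.ker_eq_comap_bot, (RingHom.injective_iff_ker_eq_bot _).mp hinj]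
  have hA : tr k (A ⧸ (⊥ : Ideal A)) = tr k A := tr_eq_of_algEquiv (AlgEquiv.quotientBot k A)
  have hB : tr k (B ⧸ (⊥ : Ideal B)) = tr k B := tr_eq_of_algEquiv (AlgEquiv.quotientBot k B)
  apply le_antisymm
  · have := h.tr_quotient_le (k := k) ⊥ (by
      rw [Ideal.mem_bot, map_eq_zero_iff _ hinj]; exact h.ne_zero)
    rwa [hbot, hA, hB] at this
  · obtain ⟨Q, hQ, -, hle⟩ := h.exists_tr_le (k := k) (⊥ : Ideal B) (by simpa using h.ne_zero)
    rw [hB] at hle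
    exact hle.trans (tr_le_of_surjective (Ideal.Quotient.mkₐ k Q) Ideal.Quotient.mk_surjective)

end FieldBase

/-- Purity: minimal primes over a general closed point of the base lie over the generic point of
the corresponding affine space. -/
lemma comap_eq_polyIdeal {k : Type*} [Field k] [Algebra k B] [IsDomain A] [IsDomain B] [Algebra.FiniteType k B]
    (h : IsGenericNoether b x) {q : Ideal B}
    [q.IsMaximal] (hb : b ∉ q) (Q : Ideal A) [Q.IsPrime] (hqQ : q ≤ Q.comap (algebraMap B A))
    (hmin : ∀ Q' ≤ Q, Q'.IsPrime → q ≤ Q'.comap (algebraMap B A) → Q' = Q) :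
    Q.comap (MvPolynomial.aeval x : _ →ₐ[B] A) = polyIdeal q d := by
  -- `B` need not be integrally closed, so going down is applied over `R₀`, a polynomial ring over a
  -- Noether normalization of `B`.
  obtain ⟨m, g, hg, hgi⟩ := exists_integral_inj_algHom_of_fg k B
  let R₀ := MvPolynomial (Fin d) (MvPolynomial (Fin m) k)
  let P := MvPolynomial (Fin d) B
  let ev : P →+* A := (MvPolynomial.aeval x : _ →ₐ[B] A).toRingHom
  let γ : R₀ →+* P := MvPolynomial.map g.toRingHom
  have hγ : γ.IsIntegral := by
    intro p
    induction p using MvPolynomial.induction_on with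
    | C c =>
      obtain ⟨p, hp, h0⟩ := hgi c
      refine ⟨p.map MvPolynomial.C, hp.map _, ?_⟩
      rw [Polynomial.eval₂_map]
      have h1 := congrArg (MvPolynomial.C (σ := Fin d)) h0
      rw [map_zero, Polynomial.hom_eval₂] at h1
      rw [← h1]
      congr 1
      exact RingHom.ext fun u ↦ MvPolynomial.map_C _ _
    | add p q hp hq => exact hp.add _ hq
    | mul_X p i hp =>
      refine hp.mul _ ?_
      have := γ.isIntegralElem_map (x := MvPolynomial.X i)
      rwa [show γ (MvPolynomial.X i) = MvPolynomial.X i from MvPolynomial.map_X _ _] at this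
  have hγinj : Function.Injective γ := MvPolynomial.map_injective _ hg
  let _ : Algebra R₀ A := (ev.comp γ).toAlgebra
  have hinj : Function.Injective (algebraMap R₀ A) :=
    Function.Injective.comp (g := ev) (show Function.Injective ev from h.algebraicIndependent) hγinj
  have hint : ∀ a, ev.IsIntegralElem a → IsIntegral R₀ a := by
    intro a ha
    let _ : Algebra R₀ P := γ.toAlgebra
    let _ : Algebra P A := ev.toAlgebra
    have : IsScalarTower R₀ P A := IsScalarTower.of_algebraMap_eq' rfl
    have : Algebra.IsIntegral R₀ P := ⟨hγ⟩
    exact isIntegral_trans (R := R₀) (A := P) a ha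
  have hbint : IsIntegral R₀ (algebraMap B A b) := hint _ (by
    have := ev.isIntegralElem_map (x := MvPolynomial.C b)
    rwa [show ev (MvPolynomial.C b) = algebraMap B A b from MvPolynomial.aeval_C _ _] at this)
  have hbQ : algebraMap B A b ∉ Q := fun hm ↦ hb (by
    have : Q.comap (algebraMap B A) ≠ ⊤ := Ideal.comap_ne_top _ (Ideal.IsPrime.ne_top inferInstance)
    rw [Ideal.IsMaximal.eq_of_le inferInstance this hqQ]
    exact hm)
  have hle : polyIdeal q d ≤ Q.comap ev := polyIdeal_le q d fun c hc ↦ by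
    simpa [Ideal.mem_comap, ev] using hqQ hc
  obtain ⟨Q', hQ'le, hQ', hQ'c⟩ := exists_prime_le_comap_eq hinj hbint
    (fun a ↦ (h.exists_isIntegral a).imp fun n hn ↦ hint _ hn) Q hbQ ((polyIdeal q d).comap γ)
    (by
      change _ ≤ Q.comap (ev.comp γ)
      rw [← Ideal.comap_comap]
      exact Ideal.comap_mono hle)
  -- `Q'` still lies over `q`: its contraction to `B` is contained in `q` and has the same
  -- contraction to the normalization, so incomparability applies.
  have hqQ' : q ≤ Q'.comap (algebraMap B A) := by
    have hprime : (Q'.comap (algebraMap B A)).IsPrime := inferInstance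
    have hQq : Q'.comap (algebraMap B A) ≤ q := by
      have : Q.comap (algebraMap B A) ≠ ⊤ :=
        Ideal.comap_ne_top _ (Ideal.IsPrime.ne_top inferInstance)
      rw [Ideal.IsMaximal.eq_of_le inferInstance this hqQ]
      exact Ideal.comap_mono hQ'le
    refine (eq_of_le_of_comap_eq (f := g.toRingHom) hgi hQq ?_).ge
    have e1 : ((Q'.comap (algebraMap B A)).comap g.toRingHom) =
        (Q'.comap (algebraMap R₀ A)).comap MvPolynomial.C := by
      rw [Ideal.comap_comap, Ideal.comap_comap]
      congr 1
      change _ = (ev.comp γ).comp MvPolynomial.C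
      refine RingHom.ext fun u ↦ ?_
      rw [RingHom.comp_apply, RingHom.comp_apply, RingHom.comp_apply,
        show γ (MvPolynomial.C u) = MvPolynomial.C (g u) from MvPolynomial.map_C _ _]
      exact (MvPolynomial.aeval_C _ _).symm
    rw [e1, hQ'c, Ideal.comap_comap]
    have e2 : γ.comp MvPolynomial.C = (MvPolynomial.C (σ := Fin d)).comp g.toRingHom := by
      exact RingHom.ext fun u ↦ MvPolynomial.map_C _ _
    rw [e2, ← Ideal.comap_comap, comap_C_polyIdeal]
  -- Minimality gives `Q' = Q`; incomparability of `B[x]` over `R₀` concludes.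
  rw [hmin Q' hQ'le hQ' hqQ'] at hQ'c
  refine (eq_of_le_of_comap_eq hγ hle ?_).symm
  rw [Ideal.comap_comap]
  exact hQ'c.symm

/-- The ideal `(s)` contains the image of a nonzero polynomial over `B`, and `c` is one of its
nonzero coefficients: if `s ∈ Q`, this polynomial lies in the extension of `q`, so `c ∈ q`. -/
lemma exists_coeff_of_ne_zero [IsDomain A] (h : IsGenericNoether b x)
    (hinj : Function.Injective (algebraMap B A)) {s : A} (hs : s ≠ 0) :
    ∃ c : B, c ≠ 0 ∧ ∀ (q : Ideal B) (Q : Ideal A), c ∉ q →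
      Q.comap (MvPolynomial.aeval x : _ →ₐ[B] A) = polyIdeal q d → s ∉ Q := by
  let P := MvPolynomial (Fin d) B
  have : IsDomain B := hinj.isDomain
  let _ : Algebra P A := (MvPolynomial.aeval x : _ →ₐ[B] A).toRingHom.toAlgebra
  obtain ⟨n, hn⟩ := h.exists_isIntegral s
  have hne : algebraMap B A b ^ n * s ≠ 0 :=
    mul_ne_zero (pow_ne_zero _ ((map_ne_zero_iff _ hinj).mpr h.ne_zero)) hs
  have := Ideal.comap_ne_bot_of_integral_mem (R := P) (I := Ideal.span {s}) hne
    (Ideal.mul_mem_left _ _ (Ideal.mem_span_singleton_self s)) hn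
  obtain ⟨p, hp, hp0⟩ := Submodule.exists_mem_ne_zero_of_ne_bot this
  obtain ⟨m, hm⟩ := MvPolynomial.ne_zero_iff.mp hp0
  refine ⟨p.coeff m, hm, fun q Q hc hQ hsQ ↦ hc ?_⟩
  have h1 : p ∈ polyIdeal q d := by
    rw [← hQ]
    exact (Ideal.span_singleton_le_iff_mem Q).mpr hsQ hp
  exact (mem_polyIdeal q d).mp h1 m

end IsGenericNoether

/-! ### General fibers, and specialization to closed fibers. -/

/-- A minimal prime over the extension of `q`, below a given prime. -/
lemma exists_minimal_prime_le {B A : Type*} [CommRing B] [CommRing A] [Algebra B A] (q : Ideal B)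
    (Q₂ : Ideal A) [Q₂.IsPrime] (h : q ≤ Q₂.comap (algebraMap B A)) :
    ∃ Q ≤ Q₂, Q.IsPrime ∧ q ≤ Q.comap (algebraMap B A) ∧
      ∀ Q' ≤ Q, Q'.IsPrime → q ≤ Q'.comap (algebraMap B A) → Q' = Q := by
  obtain ⟨Q, hQ, hle⟩ := Ideal.exists_minimalPrimes_le (I := q.map (algebraMap B A)) (J := Q₂)
    (Ideal.map_le_iff_le_comap.mpr h)
  refine ⟨Q, hle, hQ.1.1, Ideal.map_le_iff_le_comap.mp hQ.1.2, fun Q' hQ' hp hq ↦ ?_⟩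
  exact le_antisymm hQ' (hQ.2 ⟨hp, Ideal.map_le_iff_le_comap.mpr hq⟩ hQ')

/-- A general fiber has no component contained in the locus `s = 0`. -/
theorem exists_forall_exists_notMem {k B A : Type*} [Field k] [CommRing B] [IsDomain B] [CommRing A]
    [IsDomain A] [Algebra B A] [Algebra k B] [Algebra k A] [IsScalarTower k B A]
    [Algebra.FiniteType k B] [Algebra.FiniteType B A]
    (hinj : Function.Injective (algebraMap B A)) {s : A} (hs : s ≠ 0) :
    ∃ b : B, b ≠ 0 ∧ ∀ q : Ideal B, q.IsMaximal → b ∉ q → ∀ Q₂ : Ideal A, Q₂.IsPrime →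
      q ≤ Q₂.comap (algebraMap B A) → ∃ Q ≤ Q₂, Q.IsPrime ∧ q ≤ Q.comap (algebraMap B A) ∧
        s ∉ Q := by
  obtain ⟨b, d, x, h⟩ := exists_isGenericNoether (B := B) (A := A) hinj
  obtain ⟨c, hc, hcs⟩ := h.exists_coeff_of_ne_zero hinj hs
  refine ⟨b * c, mul_ne_zero h.ne_zero hc, fun q hq hbc Q₂ hQ₂ hle ↦ ?_⟩
  obtain ⟨Q, hQle, hQ, hqQ, hmin⟩ := exists_minimal_prime_le q Q₂ hle
  refine ⟨Q, hQle, hQ, hqQ, hcs q Q (fun hm ↦ hbc (q.mul_mem_left _ hm)) ?_⟩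
  exact h.comap_eq_polyIdeal (k := k) (fun hm ↦ hbc (q.mul_mem_right _ hm)) Q hqQ hmin

/-- A point of a fiber specializes to a point of a closed fiber, such that the relative
transcendence degree does not drop. -/
theorem exists_maximal_tr_le {k B A : Type*} [Field k] [CommRing B] [CommRing A]
    [Algebra B A] [Algebra k B] [Algebra k A] [IsScalarTower k B A]
    [Algebra.FiniteType k B] [Algebra.FiniteType B A] (Q : Ideal A) [Q.IsPrime] :
    ∃ (m : Ideal B) (Q' : Ideal A), m.IsMaximal ∧ Q'.IsPrime ∧ Q'.comap (algebraMap B A) = m ∧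
      tr k (A ⧸ Q) ≤ tr k (A ⧸ Q') + tr k (B ⧸ Q.comap (algebraMap B A)) := by
  let p := Q.comap (algebraMap B A)
  have hinj : Function.Injective (algebraMap (B ⧸ p) (A ⧸ Q)) := Ideal.quotientMap_injective
  have : Algebra.FiniteType (B ⧸ p) (A ⧸ Q) :=
    Algebra.FiniteType.of_restrictScalars_finiteType B _ _
  have : IsScalarTower k (B ⧸ p) (A ⧸ Q) := by
    refine IsScalarTower.of_algebraMap_eq fun c ↦ ?_
    change Ideal.Quotient.mk Q (algebraMap k A c) = Ideal.Quotient.mk Q (algebraMap B A (algebraMap k B c))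
    rw [← IsScalarTower.algebraMap_apply]
  obtain ⟨b, d, x, h⟩ := exists_isGenericNoether (B := B ⧸ p) (A := A ⧸ Q) hinj
  -- The Jacobson property provides a closed point of `Spec (B ⧸ p)` outside `b = 0`.
  have : IsJacobsonRing (B ⧸ p) := isJacobsonRing_of_finiteType (A := k)
  have hJ : b ∉ (⊥ : Ideal (B ⧸ p)).jacobson := by
    rw [IsJacobsonRing.out inferInstance (Ideal.IsPrime.isRadical inferInstance)]
    simpa using h.ne_zero
  obtain ⟨m, ⟨-, hm⟩, hbm⟩ : ∃ m ∈ {J : Ideal (B ⧸ p) | ⊥ ≤ J ∧ J.IsMaximal}, b ∉ m := by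
    rw [Ideal.jacobson, Ideal.mem_sInf] at hJ
    push Not at hJ
    exact hJ
  obtain ⟨Q₁, hQ₁, hc, hle⟩ := h.exists_tr_le (k := k) m hbm
  have hAQ := h.tr_eq (k := k) hinj
  have hsurj : Function.Surjective (Ideal.Quotient.mk p) := Ideal.Quotient.mk_surjective
  refine ⟨m.comap (Ideal.Quotient.mk p), Q₁.comap (Ideal.Quotient.mk Q),
    Ideal.comap_isMaximal_of_surjective _ hsurj, inferInstance, ?_, ?_⟩
  · rw [← hc, Ideal.comap_comap, Ideal.comap_comap]
    rfl
  · rw [hAQ, add_comm]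
    refine add_le_add_left ((le_add_self.trans hle).trans ?_) _
    exact tr_le_of_surjective (Ideal.quotientMapₐ Q₁ (Ideal.Quotient.mkₐ k Q) le_rfl)
      (Ideal.quotientMap_surjective (H := le_rfl) Ideal.Quotient.mk_surjective)

/-! ### The Bertini–Noether theorem. -/

section BertiniNoether

open MvPolynomial

universe u

/-- This form only involves factors of bounded degree, so that reducibility becomes the solvability
of polynomial equations in their coefficients. -/
lemma irreducible_iff_totalDegree {F τ : Type*} [Field F] {g : MvPolynomial τ F}
    (hg : g.totalDegree ≠ 0) : Irreducible g ↔
      ∀ a b, a * b = g → a.totalDegree < g.totalDegree → ¬ b.totalDegree < g.totalDegree := by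
  have hg0 : g ≠ 0 := fun h ↦ hg (by simp [h])
  have hunit : ∀ a b : MvPolynomial τ F, a * b = g → (IsUnit b ↔ ¬ a.totalDegree < g.totalDegree) := by
    rintro a b rfl
    have ha : a ≠ 0 := left_ne_zero_of_mul hg0
    have hb : b ≠ 0 := right_ne_zero_of_mul hg0
    rw [totalDegree_mul_of_isDomain ha hb, isUnit_iff_totalDegree_of_isReduced]
    constructor
    · rintro ⟨-, h⟩; omega
    · intro h
      have h0 : b.totalDegree = 0 := by omega
      refine ⟨?_, h0⟩
      rw [totalDegree_eq_zero_iff_eq_C] at h0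
      rw [h0] at hb
      rw [isUnit_iff_ne_zero]
      exact fun h ↦ hb (by rw [h, C_0])
  constructor
  · intro h a b hab ha hb
    rcases h.isUnit_or_isUnit hab.symm with h | h
    · exact (hunit b a (by rw [mul_comm, hab])).mp h hb
    · exact (hunit a b hab).mp h ha
  · intro h
    refine ⟨fun hu ↦ hg (isUnit_iff_totalDegree_of_isReduced.mp hu).2, fun {a b} hab ↦ ?_⟩
    by_cases ha : a.totalDegree < g.totalDegree
    · exact .inl ((hunit b a (by rw [mul_comm, ← hab])).mpr (h a b hab.symm ha))
    · exact .inr ((hunit a b hab.symm).mpr ha)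

/-- The Bertini–Noether theorem. -/
theorem exists_forall_irreducible_map {B : Type u} [CommRing B] [IsDomain B] {τ : Type} [Fintype τ]
    (f : MvPolynomial τ B)
    (hf : ∀ (F : Type u) [Field F] (φ : B →+* F), Function.Injective φ → Irreducible (map φ f)) :
    ∃ b : B, b ≠ 0 ∧ ∀ (F : Type u) [Field F] (φ : B →+* F), φ b ≠ 0 → Irreducible (map φ f) := by
  classical
  let n := f.totalDegree
  have hdeg : ∀ {F : Type u} [Field F] (φ : B →+* F), Function.Injective φ →
      (map φ f).totalDegree = n := fun φ hφ ↦ by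
    rw [totalDegree, support_map_of_injective _ hφ, ← totalDegree]
  have hn : n ≠ 0 := fun h ↦ by
    have h1 := hf (FractionRing B) (algebraMap B _) (IsFractionRing.injective B _)
    have h2 := hdeg (algebraMap B (FractionRing B)) (IsFractionRing.injective B _)
    refine h1.not_isUnit (isUnit_iff_totalDegree_of_isReduced.mpr ⟨?_, h2.trans h⟩)
    have h3 := h1.ne_zero
    rw [totalDegree_eq_zero_iff_eq_C.mp (h2.trans h)] at h3
    rw [isUnit_iff_ne_zero]
    exact fun h ↦ h3 (by rw [h, C_0])
  let T : Finset (τ →₀ ℕ) := (Finset.range n).biUnion (Finset.univ.finsuppAntidiag)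
  have hT : ∀ α : τ →₀ ℕ, α ∈ T ↔ (α.sum fun _ e ↦ e) < n := fun α ↦ by
    simp only [T, Finset.mem_biUnion, Finset.mem_range, Finset.mem_finsuppAntidiag]
    rw [Finsupp.sum_fintype _ _ (by simp)]
    constructor
    · rintro ⟨m, hm, h, -⟩
      exact h ▸ hm
    · intro h
      exact ⟨_, h, rfl, Finset.subset_univ _⟩
  -- `G` and `H` are generic polynomials of degree less than `n`, and `I` is generated by the
  -- equations that express `f = G * H`.
  let R := MvPolynomial (T ⊕ T) B
  let G : MvPolynomial τ R := ∑ α : T, monomial α.1 (X (.inl α))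
  let H : MvPolynomial τ R := ∑ α : T, monomial α.1 (X (.inr α))
  let Φ := map C f - G * H
  let I : Ideal R := Ideal.span (Set.range fun m ↦ coeff m Φ)
  have htd : ∀ {F : Type u} [Field F] (c : T → F),
      (∑ α : T, monomial α.1 (c α)).totalDegree < n := by
    intro F _ c
    refine (totalDegree_finsetSum _ _).trans_lt ?_
    rw [Finset.sup_lt_iff (Nat.pos_of_ne_zero hn)]
    intro α _
    exact (totalDegree_monomial_le _ _).trans_lt ((hT _).mp α.2)
  obtain ⟨b, hb, hbI⟩ : ∃ b : B, b ≠ 0 ∧ C b ∈ I := by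
    -- Otherwise some prime containing `I` meets `B` only in zero, and its residue field is an
    -- extension of `B` over which `f` factors.
    by_contra! hcon
    have hdisj : Disjoint (I : Set R) ((nonZeroDivisors B).map (C : B →+* R) : Submonoid R) := by
      rw [Set.disjoint_right]
      rintro _ ⟨b, hb, rfl⟩
      exact hcon b (nonZeroDivisors.ne_zero hb)
    obtain ⟨𝔭, hp, hle, hd⟩ := Ideal.exists_le_prime_disjoint _ _ hdisj
    let F := FractionRing (R ⧸ 𝔭)
    let ε : R →+* F := (algebraMap _ F).comp (Ideal.Quotient.mk 𝔭)
    have hε : ∀ r, ε r = 0 ↔ r ∈ 𝔭 := fun r ↦ by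
      simp only [ε, RingHom.comp_apply]
      rw [map_eq_zero_iff _ (IsFractionRing.injective (R ⧸ 𝔭) F), Ideal.Quotient.eq_zero_iff_mem]
    have hφ : Function.Injective (ε.comp C) := by
      rw [injective_iff_map_eq_zero]
      intro b hb
      by_contra h0
      exact Set.disjoint_left.mp hd ((hε _).mp hb) ⟨b, mem_nonZeroDivisors_of_ne_zero h0, rfl⟩
    have hΦ : map ε Φ = 0 := by
      ext m
      rw [coeff_map, coeff_zero, hε]
      exact hle (Ideal.subset_span ⟨m, rfl⟩)
    have h1 : map ε G * map ε H = map (ε.comp C) f := by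
      rw [map_sub, map_map, map_mul, sub_eq_zero] at hΦ
      exact hΦ.symm
    have h2 := (irreducible_iff_totalDegree (by rw [hdeg _ hφ]; exact hn)).mp (hf F _ hφ) _ _ h1
    rw [hdeg _ hφ] at h2
    simp only [G, H, map_sum, map_monomial] at h2
    exact h2 (htd _) (htd _)
  -- A coefficient of top degree has to stay nonzero, so that `f` keeps its degree under `φ`.
  obtain ⟨m₀, hm₀, hdm₀⟩ : ∃ m ∈ f.support, (m.sum fun _ e ↦ e) = n := by
    have hne : f.support.Nonempty := by
      rw [Finset.nonempty_iff_ne_empty, Ne, support_eq_empty]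
      rintro rfl
      simp [n] at hn
    obtain ⟨m, hm, h⟩ := Finset.exists_mem_eq_sup f.support hne fun s ↦ s.sum fun _ e ↦ e
    exact ⟨m, hm, h.symm⟩
  refine ⟨b * coeff m₀ f, mul_ne_zero hb (mem_support_iff.mp hm₀), fun F _ φ hφ ↦ ?_⟩
  rw [map_mul] at hφ
  have hdφ : (map φ f).totalDegree = n := by
    refine le_antisymm (Finset.sup_mono (support_map_subset _ _)) ?_
    rw [← hdm₀]
    refine le_totalDegree (mem_support_iff.mpr ?_)
    rw [coeff_map]
    exact right_ne_zero_of_mul hφ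
  rw [irreducible_iff_totalDegree (by rw [hdφ]; exact hn), hdφ]
  intro g h hgh hg hh
  -- The coefficients of a factorization over `F` define a homomorphism that kills `I`, hence `b`.
  let ε : R →+* F := eval₂Hom φ (Sum.elim (fun α ↦ coeff α.1 g) (fun α ↦ coeff α.1 h))
  have hsum : ∀ p : MvPolynomial τ F, p.totalDegree < n → ∑ α : T, monomial α.1 (coeff α.1 p) = p := by
    intro p hp
    rw [Finset.sum_coe_sort T (fun α ↦ monomial α (coeff α p))]
    conv_rhs => rw [p.as_sum]
    refine (Finset.sum_subset (fun α hα ↦ ?_) fun α _ hα ↦ ?_).symm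
    · exact (hT _).mpr ((le_totalDegree hα).trans_lt hp)
    · rw [notMem_support_iff.mp hα, monomial_zero]
  have hG : map ε G = g := by
    rw [← hsum g hg]
    simp only [G, map_sum, map_monomial]
    exact Finset.sum_congr rfl fun α _ ↦ congrArg _ (eval₂_X _ _ _)
  have hH : map ε H = h := by
    rw [← hsum h hh]
    simp only [H, map_sum, map_monomial]
    exact Finset.sum_congr rfl fun α _ ↦ congrArg _ (eval₂_X _ _ _)
  have hC : ε.comp C = φ := RingHom.ext fun c ↦ eval₂_C _ _ _
  have hΦ : map ε Φ = 0 := by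
    rw [map_sub, map_map, map_mul, hG, hH, hgh, hC, sub_self]
  have hIε : I ≤ RingHom.ker ε := by
    rw [Ideal.span_le]
    rintro _ ⟨m, rfl⟩
    have := congrArg (coeff m) hΦ
    rwa [coeff_map, coeff_zero] at this
  exact left_ne_zero_of_mul hφ ((congrArg (fun ψ : B →+* F ↦ ψ b) hC).symm.trans (hIε hbI))

/-- The Bertini–Noether theorem for monic polynomials over a polynomial ring. -/
theorem exists_forall_irreducible_map_map {B : Type u} [CommRing B] [IsDomain B] {d : ℕ}
    (f : Polynomial (MvPolynomial (Fin d) B))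
    (hf : ∀ (F : Type u) [Field F] (φ : B →+* F), Function.Injective φ → Irreducible (f.map (map φ))) :
    ∃ b : B, b ≠ 0 ∧
      ∀ (F : Type u) [Field F] (φ : B →+* F), φ b ≠ 0 → Irreducible (f.map (map φ)) := by
  -- A polynomial in one variable over `B[x]` is a polynomial over `B` in one more variable, to
  -- which the preceding theorem applies.
  let f' := (optionEquivLeft B (Fin d)).symm f
  have hf' : ∀ {F : Type u} [Field F] (φ : B →+* F),
      optionEquivLeft F (Fin d) (map φ f') = f.map (map φ) := by
    intro F _ φ
    have : ((optionEquivLeft F (Fin d)).toRingEquiv.toRingHom.comp (map φ)) =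
        (Polynomial.mapRingHom (map φ)).comp
          (optionEquivLeft B (Fin d)).toRingEquiv.toRingHom := by
      refine ringHom_ext (fun r ↦ ?_) (fun i ↦ ?_)
      · simp
      · cases i <;> simp
    have h2 := congrArg (fun ψ : MvPolynomial (Option (Fin d)) B →+* _ ↦ ψ f') this
    have h3 : optionEquivLeft B (Fin d) f' = f := (optionEquivLeft B (Fin d)).apply_symm_apply f
    simpa [h3] using h2
  have hirr : ∀ {F : Type u} [Field F] (φ : B →+* F),
      Irreducible (map φ f') ↔ Irreducible (f.map (map φ)) := fun φ ↦ by
    rw [← hf' φ]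
    exact (MulEquiv.irreducible_iff (optionEquivLeft _ (Fin d)).toMulEquiv).symm
  obtain ⟨b, hb, h⟩ := exists_forall_irreducible_map f' fun F _ φ hφ ↦ (hirr φ).mpr (hf F φ hφ)
  exact ⟨b, hb, fun F _ φ hφ ↦ (hirr φ).mp (h F φ hφ)⟩

end BertiniNoether

/-! ### Primitive elements with a monic equation. -/

section PrimitiveElement

open Polynomial

/-- A primitive element of an algebraic extension of domains of characteristic zero, with its
monic equation. -/
theorem exists_monic_primitive {P A : Type*} [CommRing P] [IsDomain P] [CharZero P] [CommRing A]
    [IsDomain A] [Algebra P A] [Algebra.FiniteType P A] [Algebra.IsAlgebraic P A]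
    (hinj : Function.Injective (algebraMap P A)) :
    ∃ (θ : A) (f : P[X]), f.Monic ∧ aeval θ f = 0 ∧
      (∀ g : P[X], g.degree < f.natDegree → aeval θ g = 0 → g = 0) ∧
      (∃ (u v : P[X]) (δ : P), δ ≠ 0 ∧ u * f + v * derivative f = C δ) ∧
      ∃ δ : P, δ ≠ 0 ∧ ∀ a : A, ∃ (m : ℕ) (g : P[X]), algebraMap P A δ ^ m * a = aeval θ g := by
  classical
  let K := FractionRing P
  let L := FractionRing A
  have hPL : Function.Injective (algebraMap P L) := by
    rw [IsScalarTower.algebraMap_eq P A L]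
    exact (IsFractionRing.injective A L).comp hinj
  let : FaithfulSMul P L := (faithfulSMul_iff_algebraMap_injective P L).mpr hPL
  let : Algebra K L := FractionRing.liftAlgebra P L
  have : IsScalarTower P K L := FractionRing.isScalarTower_liftAlgebra P L
  have : Algebra.EssFiniteType P A := inferInstance
  have : Algebra.EssFiniteType A L := .of_isLocalization _ (nonZeroDivisors A)
  have : Algebra.EssFiniteType P L := .comp P A L
  have : Algebra.EssFiniteType K L := .of_comp P K L
  have : Algebra.IsAlgebraic P L := by
    have : Algebra.IsAlgebraic A L := IsLocalization.isAlgebraic (R := A) (S := L) (nonZeroDivisors A)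
    have : FaithfulSMul P A := (faithfulSMul_iff_algebraMap_injective P A).mpr hinj
    exact Algebra.IsAlgebraic.trans P A L
  have : Algebra.IsAlgebraic K L := Algebra.IsAlgebraic.extendScalars (R := P) (IsFractionRing.injective P K)
  have : Module.Finite K L := Algebra.finite_of_essFiniteType_of_isAlgebraic
  have : CharZero K := charZero_of_injective_algebraMap (IsFractionRing.injective P K)
  obtain ⟨θ₀, hθ₀⟩ := Field.exists_primitive_element K L
  obtain ⟨a₀, s₀, hs₀, rfl⟩ := IsFractionRing.div_surjective (A := A) θ₀
  have hs0 : s₀ ≠ 0 := nonZeroDivisors.ne_zero hs₀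
  -- `a₁` is the primitive element multiplied by `c`, and it lies in `A`.
  obtain ⟨a₁, c, hc, h1⟩ := Algebra.IsAlgebraic.exists_smul_eq_mul P a₀ hs0
  let μ := minpoly K (algebraMap A L a₁)
  obtain ⟨c', hcm', hμ⟩ := IsLocalization.integerNormalization_spec (nonZeroDivisors P) μ
  have hc' : c' ≠ 0 := nonZeroDivisors.ne_zero hcm'
  have hKinj : Function.Injective (algebraMap P K) := IsFractionRing.injective P K
  let g₁ := IsLocalization.integerNormalization (nonZeroDivisors P) μ
  have hμ' : g₁.map (algebraMap P K) = C (algebraMap P K c') * μ := by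
    rw [hμ, ← algebraMap_smul K c' μ, smul_eq_C_mul]
  have hcK : algebraMap P K c' ≠ 0 := by simpa using hc'
  have hint : _root_.IsIntegral K (algebraMap A L a₁) := Algebra.IsIntegral.isIntegral _
  have hg₁deg : g₁.natDegree = μ.natDegree := by
    rw [← natDegree_map_eq_of_injective hKinj, hμ', natDegree_C_mul hcK]
  have hg₁lead : g₁.leadingCoeff = c' := by
    apply hKinj
    rw [← leadingCoeff_map_of_injective hKinj, hμ', leadingCoeff_mul, leadingCoeff_C,
      (minpoly.monic hint).leadingCoeff, mul_one]
  have hg₁0 : aeval a₁ g₁ = 0 := by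
    apply IsFractionRing.injective A L
    rw [map_zero, ← aeval_algebraMap_apply, ← aeval_map_algebraMap K, hμ', map_mul, minpoly.aeval,
      mul_zero]
  -- Multiplication by the leading coefficient `c'` makes the equation monic.
  let θ : A := a₁ * algebraMap P A c'
  let f := g₁.integralNormalization
  have hf : f.Monic := monic_integralNormalization (fun h ↦ hc' (by rw [← hg₁lead, h, leadingCoeff_zero]))
  have hfθ : aeval θ f = 0 := by
    have := integralNormalization_aeval_eq_zero hg₁0 fun x hx ↦ (map_eq_zero_iff _ hinj).mp hx
    rw [hg₁lead] at this
    simpa only [θ, mul_comm] using this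
  have hθL : algebraMap A L θ = algebraMap K L (algebraMap P K (c * c')) *
      (algebraMap A L a₀ / algebraMap A L s₀) := by
    have hs : algebraMap A L s₀ ≠ 0 := by simpa using hs0
    rw [← IsScalarTower.algebraMap_apply, mul_div_assoc', eq_div_iff hs]
    have h2 := congrArg (algebraMap A L) h1
    simp only [θ, Algebra.smul_def, map_mul] at h2 ⊢
    rw [← IsScalarTower.algebraMap_apply] at h2
    rw [← IsScalarTower.algebraMap_apply]
    linear_combination (-algebraMap P L c') * h2
  have htop : ∀ (z : K) (t : L), z ≠ 0 →
      t = algebraMap K L z * (algebraMap A L a₀ / algebraMap A L s₀) →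
      IntermediateField.adjoin K {t} = ⊤ := by
    intro z t hz ht
    rw [eq_top_iff, ← hθ₀, IntermediateField.adjoin_simple_le_iff]
    have h2 : algebraMap A L a₀ / algebraMap A L s₀ = algebraMap K L z⁻¹ * t := by
      rw [ht, ← mul_assoc, ← map_mul, inv_mul_cancel₀ hz, map_one, one_mul]
    rw [h2]
    exact mul_mem (IntermediateField.algebraMap_mem _ _)
      (IntermediateField.mem_adjoin_simple_self K _)
  have htopθ := htop (algebraMap P K (c * c')) (algebraMap A L θ) (by simpa using ⟨hc, hc'⟩) hθL
  have htop₁ : IntermediateField.adjoin K {algebraMap A L a₁} = ⊤ := by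
    refine htop (algebraMap P K c) (algebraMap A L a₁) (by simpa using hc) ?_
    have hs : algebraMap A L s₀ ≠ 0 := by simpa using hs0
    rw [← IsScalarTower.algebraMap_apply, mul_div_assoc', eq_div_iff hs]
    have h2 := congrArg (algebraMap A L) h1
    simp only [Algebra.smul_def, map_mul] at h2
    rw [← IsScalarTower.algebraMap_apply] at h2
    rw [h2, mul_comm]
  have hmin : f.map (algebraMap P K) = minpoly K (algebraMap A L θ) := by
    refine eq_of_monic_of_dvd_of_natDegree_le (minpoly.monic (Algebra.IsIntegral.isIntegral _))
      (hf.map _) (minpoly.dvd _ _ ?_) ?_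
    · rw [aeval_map_algebraMap, aeval_algebraMap_apply, hfθ, map_zero]
    · rw [natDegree_map_eq_of_injective hKinj, natDegree_integralNormalization, hg₁deg,
        (Field.primitive_element_iff_minpoly_natDegree_eq K _).mp htopθ]
      exact ((Field.primitive_element_iff_minpoly_natDegree_eq K _).mp htop₁).le
  have hlow : ∀ g : P[X], g.degree < f.natDegree → aeval θ g = 0 → g = 0 := by
    intro g hg hg0
    apply Polynomial.map_injective _ hKinj
    rw [Polynomial.map_zero]
    by_contra hne
    have h2 := minpoly.degree_le_of_ne_zero K (algebraMap A L θ) hne (by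
      rw [aeval_map_algebraMap, aeval_algebraMap_apply, hg0, map_zero])
    rw [← hmin, hf.degree_map, degree_map_eq_of_injective hKinj, degree_eq_natDegree hf.ne_zero] at h2
    exact h2.not_gt hg
  -- In characteristic zero the minimal polynomial is separable; `δ` is the common denominator of a
  -- Bézout identity.
  have hsep : ∃ (u v : P[X]) (δ : P), δ ≠ 0 ∧ u * f + v * derivative f = C δ := by
    obtain ⟨u, v, h⟩ := (minpoly.irreducible (Algebra.IsIntegral.isIntegral (R := K)
      (algebraMap A L θ))).separable
    obtain ⟨b, hbm, hb⟩ := IsLocalization.integerNormalization_spec (nonZeroDivisors P) u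
    obtain ⟨e, hem, he⟩ := IsLocalization.integerNormalization_spec (nonZeroDivisors P) v
    refine ⟨C e * IsLocalization.integerNormalization (nonZeroDivisors P) u,
      C b * IsLocalization.integerNormalization (nonZeroDivisors P) v, e * b,
      mul_ne_zero (nonZeroDivisors.ne_zero hem) (nonZeroDivisors.ne_zero hbm), ?_⟩
    apply Polynomial.map_injective _ hKinj
    rw [← hmin, derivative_map] at h
    simp only [Polynomial.map_add, Polynomial.map_mul, hb, he, map_C, map_mul]
    have e1 : ∀ (t : P) (w : K[X]), t • w = C (algebraMap P K t) * w := fun t w ↦ by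
      rw [← algebraMap_smul K t w, smul_eq_C_mul]
    rw [e1, e1]
    linear_combination (C (algebraMap P K e) * C (algebraMap P K b)) * h
  have htop' : Algebra.adjoin K {algebraMap A L θ} = ⊤ :=
    Algebra.adjoin_eq_top_of_primitive_element (Algebra.IsAlgebraic.isAlgebraic _) htopθ
  have key : ∀ a : A, ∃ δ : P, δ ≠ 0 ∧ ∃ g : P[X], algebraMap P A δ * a = aeval θ g := by
    intro a
    have ha : algebraMap A L a ∈ Algebra.adjoin K {algebraMap A L θ} := htop' ▸ Algebra.mem_top
    rw [Algebra.adjoin_singleton_eq_range_aeval] at ha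
    obtain ⟨h, hh⟩ := ha
    obtain ⟨b, hbm, hb⟩ := IsLocalization.integerNormalization_spec (nonZeroDivisors P) h
    refine ⟨b, nonZeroDivisors.ne_zero hbm, IsLocalization.integerNormalization (nonZeroDivisors P) h,
      IsFractionRing.injective A L ?_⟩
    rw [map_mul, ← IsScalarTower.algebraMap_apply, ← aeval_algebraMap_apply,
      ← aeval_map_algebraMap K, hb, ← hh]
    simp [Algebra.smul_def, IsScalarTower.algebraMap_apply P K L]
  choose δ hδ g hg using key
  obtain ⟨S, hS⟩ := (inferInstance : Algebra.FiniteType P A).out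
  refine ⟨θ, f, hf, hfθ, hlow, hsep, ∏ s ∈ S, δ s, Finset.prod_ne_zero_iff.mpr fun s _ ↦ hδ s, fun a ↦ ?_⟩
  have ha : a ∈ Algebra.adjoin P (S : Set A) := hS ▸ Algebra.mem_top
  induction ha using Algebra.adjoin_induction with
  | mem s hs =>
    refine ⟨1, C (∏ t ∈ S.erase s, δ t) * g s, ?_⟩
    rw [map_mul, ← hg, pow_one, ← Finset.mul_prod_erase _ _ hs, map_mul, aeval_C]
    ring
  | algebraMap c => exact ⟨0, C c, by simp⟩
  | add u v _ _ hu hv =>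
    obtain ⟨n, p, hp⟩ := hu
    obtain ⟨m, q, hq⟩ := hv
    refine ⟨n + m, C ((∏ s ∈ S, δ s) ^ m) * p + C ((∏ s ∈ S, δ s) ^ n) * q, ?_⟩
    rw [map_add, map_mul, map_mul, ← hp, ← hq, aeval_C, aeval_C, map_pow, map_pow]
    ring
  | mul u v _ _ hu hv =>
    obtain ⟨n, p, hp⟩ := hu
    obtain ⟨m, q, hq⟩ := hv
    refine ⟨n + m, p * q, ?_⟩
    rw [map_mul, ← hp, ← hq]
    ring

end PrimitiveElement

/-! ### Irreducibility of the monic equation after extension of scalars. -/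

section GeometricIrreducibility

open Polynomial TensorProduct

universe u

variable {B A : Type u} [CommRing B] [CommRing A] [Algebra B A] {d : ℕ}

/-- The monomial basis of `R[x₁, …, x_d][T]`. -/
def monomialBasis (R : Type*) [CommRing R] (d : ℕ) :
    Module.Basis ((Fin d →₀ ℕ) × ℕ) R (MvPolynomial (Fin d) R)[X] :=
  (MvPolynomial.basisMonomials (Fin d) R).smulTower (Polynomial.basisMonomials _)

lemma monomialBasis_apply (R : Type*) [CommRing R] (e : (Fin d →₀ ℕ) × ℕ) :
    monomialBasis R d e = monomial e.2 (MvPolynomial.monomial e.1 1) := by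
  simp [monomialBasis, Module.Basis.smulTower_apply, smul_monomial]

/-- The evaluation map `F[x₁, …, x_d][T] → F ⊗ A`. -/
def evalTensor (B : Type*) [CommRing B] [Algebra B A] (x : Fin d → A) (θ : A) (F : Type*) [CommRing F] [Algebra B F] :
    (MvPolynomial (Fin d) F)[X] →ₐ[F] F ⊗[B] A :=
  Polynomial.eval₂AlgHom (MvPolynomial.aeval fun i ↦ (1 : F) ⊗ₜ[B] x i) (1 ⊗ₜ θ)
    fun _ ↦ Commute.all _ _

/-- The evaluation map `B[x₁, …, x_d][T] → A`. -/
def evalBase (B : Type*) [CommRing B] [Algebra B A] (x : Fin d → A) (θ : A) :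
    (MvPolynomial (Fin d) B)[X] →ₐ[B] A :=
  Polynomial.eval₂AlgHom (MvPolynomial.aeval x) θ fun _ ↦ Commute.all _ _

lemma evalTensor_map (x : Fin d → A) (θ : A) (F : Type*) [CommRing F] [Algebra B F]
    (g : (MvPolynomial (Fin d) B)[X]) :
    evalTensor B x θ F (g.map (MvPolynomial.map (algebraMap B F))) = 1 ⊗ₜ[B] evalBase B x θ g := by
  have : ((evalTensor B x θ F).toRingHom.comp (mapRingHom (MvPolynomial.map (algebraMap B F)))) =
      (Algebra.TensorProduct.includeRight : A →ₐ[B] F ⊗[B] A).toRingHom.comp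
        (evalBase B x θ).toRingHom := by
    refine Polynomial.ringHom_ext' ?_ ?_
    · refine MvPolynomial.ringHom_ext (fun r ↦ ?_) fun i ↦ ?_
      · simp [evalTensor, evalBase]
      · simp [evalTensor, evalBase]
    · simp [evalTensor, evalBase]
  exact congrArg (fun ψ : (MvPolynomial (Fin d) B)[X] →+* F ⊗[B] A ↦ ψ g) this

/-- The products of monomials in the `x i` with `θ ^ m`, `m < n`, are independent over `B`, and the
flat base change to `F` preserves independence. -/
lemma eq_zero_of_evalTensor_eq_zero {x : Fin d → A} {θ : A} {n : ℕ}
    (hn : ∀ g : (MvPolynomial (Fin d) B)[X], g.degree < n → evalBase B x θ g = 0 → g = 0)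
    (F : Type u) [CommRing F] [Algebra B F] [Module.Flat B F] (r : (MvPolynomial (Fin d) F)[X])
    (hr : r.degree < n) (hr0 : evalTensor B x θ F r = 0) : r = 0 := by
  let e : (Fin d →₀ ℕ) × Fin n → (Fin d →₀ ℕ) × ℕ := fun p ↦ (p.1, p.2)
  have he : Function.Injective e := by
    rintro ⟨a, i⟩ ⟨b, j⟩ h
    simp only [e, Prod.mk.injEq] at h
    exact Prod.ext h.1 (Fin.ext h.2)
  have h1 : LinearIndependent B (monomialBasis B d ∘ e) :=
    (monomialBasis B d).linearIndependent.comp e he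
  have h2 : LinearIndependent B (evalBase B x θ ∘ (monomialBasis B d ∘ e)) := by
    refine h1.map_injOn (evalBase B x θ).toLinearMap ?_
    have hle : Submodule.span B (Set.range (monomialBasis B d ∘ e)) ≤
        (degreeLT (MvPolynomial (Fin d) B) n).restrictScalars B := by
      rw [Submodule.span_le]
      rintro _ ⟨p, rfl⟩
      rw [SetLike.mem_coe, Submodule.restrictScalars_mem, mem_degreeLT, Function.comp_apply,
        monomialBasis_apply]
      exact (degree_monomial_le _ _).trans_lt (by exact_mod_cast p.2.2)
    rw [← LinearMap.disjoint_ker_iff_injOn, Submodule.disjoint_def]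
    intro g hg hg0
    exact hn g (mem_degreeLT.mp (hle hg)) hg0
  have h3 := Module.Flat.linearIndependent_one_tmul (S := F) h2
  have h4 : ∀ p, evalTensor B x θ F (monomialBasis F d (e p)) =
      1 ⊗ₜ[B] (evalBase B x θ ∘ (monomialBasis B d ∘ e)) p := by
    intro p
    rw [Function.comp_apply, Function.comp_apply, ← evalTensor_map, monomialBasis_apply,
      monomialBasis_apply]
    simp
  have hsupp : (((monomialBasis F d).repr r).support : Set _) ⊆ Set.range e := by
    intro p hp
    have hp1 : p.2 < n := by
      by_contra hle
      rw [not_lt] at hle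
      rw [Finset.mem_coe, Finsupp.mem_support_iff] at hp
      apply hp
      rw [monomialBasis, Module.Basis.smulTower_repr]
      have : r.coeff p.2 = 0 := coeff_eq_zero_of_degree_lt
        (hr.trans_le (by exact_mod_cast hle))
      change (MvPolynomial.basisMonomials (Fin d) F).repr (r.coeff p.2) p.1 = 0
      rw [this, map_zero, Finsupp.zero_apply]
    exact ⟨(p.1, ⟨p.2, hp1⟩), rfl⟩
  let l := ((monomialBasis F d).repr r).comapDomain e he.injOn
  have hl : l.mapDomain e = (monomialBasis F d).repr r := Finsupp.mapDomain_comapDomain e he _ hsupp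
  have hl0 : l = 0 := by
    refine linearIndependent_iff.mp h3 l ?_
    have h5 := (monomialBasis F d).linearCombination_repr r
    rw [← hl, Finsupp.linearCombination_mapDomain] at h5
    rw [← hr0, ← h5]
    change _ = (evalTensor B x θ F).toLinearMap _
    rw [Finsupp.apply_linearCombination]
    congr 2
    funext p
    exact (h4 p).symm
  rw [hl0, Finsupp.mapDomain_zero] at hl
  exact (monomialBasis F d).repr.map_eq_zero_iff.mp hl.symm

/-- A monic equation of a primitive element stays irreducible after extension of scalars, if
the extension of scalars of the algebra has an irreducible spectrum. -/
theorem irreducible_map_of_separable {x : Fin d → A} {θ : A} [Nontrivial A]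
    {f : (MvPolynomial (Fin d) B)[X]} (hf : f.Monic) (hfθ : evalBase B x θ f = 0)
    (hn : ∀ g : (MvPolynomial (Fin d) B)[X], g.degree < f.natDegree → evalBase B x θ g = 0 → g = 0)
    {u v : (MvPolynomial (Fin d) B)[X]} {δ : MvPolynomial (Fin d) B} (hδ : δ ≠ 0)
    (huv : u * f + v * derivative f = C δ) (F : Type u) [Field F] [Algebra B F] [Module.Flat B F]
    (hinj : Function.Injective (algebraMap B F))
    (hF : ∀ s t : F ⊗[B] A, s * t = 0 → IsNilpotent s ∨ IsNilpotent t) :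
    Irreducible (f.map (MvPolynomial.map (algebraMap B F))) := by
  let φ : MvPolynomial (Fin d) B →+* MvPolynomial (Fin d) F := MvPolynomial.map (algebraMap B F)
  have hφ : Function.Injective φ := MvPolynomial.map_injective _ hinj
  let Ψ := evalTensor B x θ F
  have hfF : (f.map φ).Monic := hf.map φ
  have hΨf : Ψ (f.map φ) = 0 := by
    change evalTensor B x θ F _ = 0
    rw [evalTensor_map, hfθ, tmul_zero]
  -- The remainder of a division by the monic `f` has low degree, so it vanishes if it is in the
  -- kernel.
  have hker : ∀ g, Ψ g = 0 → f.map φ ∣ g := fun g hg ↦ by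
    rw [← modByMonic_eq_zero_iff_dvd hfF]
    refine eq_zero_of_evalTensor_eq_zero hn F _ ?_ ?_
    · refine (degree_modByMonic_lt _ hfF).trans_le ?_
      rw [hf.degree_map]
      exact degree_le_natDegree
    · change Ψ _ = 0
      rw [modByMonic_eq_sub_mul_div, map_sub, map_mul, hΨf, hg, zero_mul, sub_zero]
  -- If `Ψ g` is nilpotent, then `h` divides a power of `g`. Modulo `h`, the identity `huv` reads `δ
  -- = g * (v * h')`, so `h` divides a power of the constant `δ` and has degree zero.
  have key : ∀ g h : (MvPolynomial (Fin d) F)[X], h.Monic → g * h = f.map φ →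
      IsNilpotent (Ψ g) → h.natDegree = 0 := by
    rintro g h hh hgh ⟨k, hk⟩
    have h1 : h ∣ g ^ k := (Dvd.intro_left g hgh).trans (hker _ (by rw [map_pow, hk]))
    have h2 := congrArg (Polynomial.map φ) huv
    rw [Polynomial.map_add, Polynomial.map_mul, Polynomial.map_mul, ← derivative_map, ← hgh,
      derivative_mul, map_C] at h2
    have h3 : h ∣ C (φ δ) - g * (v.map φ * derivative h) :=
      ⟨u.map φ * g + v.map φ * derivative g, by rw [← h2]; ring⟩
    have h4 : h ∣ C (φ δ) ^ k := by
      have h5 := h3.trans (sub_dvd_pow_sub_pow _ _ k)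
      rw [mul_pow] at h5
      exact (dvd_sub_left (h1.mul_right _)).mp h5
    rw [← C_pow] at h4
    have h5 : C (φ δ ^ k) ≠ 0 := by
      rw [Ne, C_eq_zero]
      exact pow_ne_zero _ ((map_ne_zero_iff _ hφ).mpr hδ)
    have := natDegree_le_of_dvd h4 h5
    rwa [natDegree_C, Nat.le_zero] at this
  rw [hfF.irreducible_iff_natDegree]
  refine ⟨fun h1 ↦ ?_, fun g h hg hh hgh ↦ ?_⟩
  · have : f = 1 := Polynomial.map_injective _ hφ (by rw [h1, Polynomial.map_one])
    rw [this, map_one] at hfθ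
    exact one_ne_zero hfθ
  · have h1 : Ψ g * Ψ h = 0 := by rw [← map_mul, hgh, hΨf]
    rcases hF _ _ h1 with h2 | h2
    · exact .inr (key g h hh hgh h2)
    · exact .inl (key h g hg (by rw [mul_comm, hgh]) h2)

end GeometricIrreducibility

/-! ### Irreducibility of general closed fibers. -/

section

open Polynomial TensorProduct

universe u

section

variable {B A : Type*} [CommRing B] [CommRing A] [Algebra B A] {d : ℕ} {x : Fin d → A} {q : Ideal B}
  [q.IsPrime] {Q : Ideal A} [Q.IsPrime]

/-- The map from the polynomial ring over `B` to the field of rational functions over `B ⧸ q`. -/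
def toRatFunc (q : Ideal B) [q.IsPrime] (d : ℕ) :
    MvPolynomial (Fin d) B →+* FractionRing (MvPolynomial (Fin d) (B ⧸ q)) :=
  (algebraMap _ _).comp (MvPolynomial.map (Ideal.Quotient.mk q))

lemma evalBase_C (x : Fin d → A) (θ : A) (p : MvPolynomial (Fin d) B) :
    evalBase B x θ (C p) = MvPolynomial.aeval x p := by
  simp [evalBase]

/-- By `hQ` the polynomial ring over `B ⧸ q` embeds in `A ⧸ Q`; this is the induced map of fraction
fields. -/
lemma exists_ratFunc_hom
    (hQ : Q.comap (MvPolynomial.aeval x : _ →ₐ[B] A) = polyIdeal q d) :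
    ∃ ι : FractionRing (MvPolynomial (Fin d) (B ⧸ q)) →+* FractionRing (A ⧸ Q),
      ∀ p, ι (toRatFunc q d p) =
        algebraMap (A ⧸ Q) _ (Ideal.Quotient.mk Q (MvPolynomial.aeval x p)) := by
  let ev : MvPolynomial (Fin d) B →ₐ[B] A := MvPolynomial.aeval x
  let m : MvPolynomial (Fin d) B →+* MvPolynomial (Fin d) (B ⧸ q) :=
    MvPolynomial.map (Ideal.Quotient.mk q)
  have hm : Function.Surjective m := MvPolynomial.map_surjective _ Ideal.Quotient.mk_surjective
  have hker : RingHom.ker m = RingHom.ker ((Ideal.Quotient.mk Q).comp ev.toRingHom) := by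
    have h2 : RingHom.ker m = polyIdeal q d := rfl
    rw [h2, ← hQ]
    ext p
    exact (Ideal.Quotient.eq_zero_iff_mem (I := Q)).symm
  let ι₀ : MvPolynomial (Fin d) (B ⧸ q) →+* A ⧸ Q :=
    RingHom.liftOfSurjective m hm ⟨(Ideal.Quotient.mk Q).comp ev.toRingHom, hker.le⟩
  have hι₀ : ∀ p, ι₀ (m p) = Ideal.Quotient.mk Q (ev p) := fun p ↦
    RingHom.liftOfRightInverse_comp_apply m _ _ ⟨(Ideal.Quotient.mk Q).comp ev.toRingHom, hker.le⟩ p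
  have hinj : Function.Injective ((algebraMap (A ⧸ Q) (FractionRing (A ⧸ Q))).comp ι₀) := by
    have hι₀inj : Function.Injective ι₀ := ?_
    · exact (IsFractionRing.injective (A ⧸ Q) (FractionRing (A ⧸ Q))).comp hι₀inj
    rw [injective_iff_map_eq_zero]
    intro p hp
    obtain ⟨p, rfl⟩ := hm p
    rw [hι₀] at hp
    exact hker.ge hp
  refine ⟨IsFractionRing.lift hinj, fun p ↦ ?_⟩
  rw [toRatFunc, RingHom.comp_apply, IsFractionRing.lift_algebraMap, RingHom.comp_apply]
  exact congrArg _ (hι₀ p)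

/-- The divisibility does not involve `Q`. Hence, up to denominators, only one prime can lie over
the generic point of the affine space over `q`. -/
lemma evalBase_mem_iff
    (hQ : Q.comap (MvPolynomial.aeval x : _ →ₐ[B] A) = polyIdeal q d) {θ : A}
    {f : (MvPolynomial (Fin d) B)[X]} (hf : f.Monic) (hfθ : evalBase B x θ f = 0)
    (hirr : Irreducible (f.map (toRatFunc q d))) (g : (MvPolynomial (Fin d) B)[X]) :
    evalBase B x θ g ∈ Q ↔ f.map (toRatFunc q d) ∣ g.map (toRatFunc q d) := by
  constructor
  · intro hg
    by_contra hdvd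
    -- A Bézout identity, evaluated at `θ` in the fraction field of `A ⧸ Q`, would give `0 = 1`.
    obtain ⟨u, v, huv⟩ := hirr.coprime_iff_not_dvd.mpr hdvd
    obtain ⟨ι, hι⟩ := exists_ratFunc_hom hQ
    let t := algebraMap (A ⧸ Q) (FractionRing (A ⧸ Q)) (Ideal.Quotient.mk Q θ)
    have h1 : ∀ p : (MvPolynomial (Fin d) B)[X], eval₂ ι t (p.map (toRatFunc q d)) =
        algebraMap (A ⧸ Q) _ (Ideal.Quotient.mk Q (evalBase B x θ p)) := by
      intro p
      rw [eval₂_map]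
      have : (eval₂RingHom (ι.comp (toRatFunc q d)) t) = ((algebraMap (A ⧸ Q) _).comp
          (Ideal.Quotient.mk Q)).comp (evalBase B x θ).toRingHom := by
        refine Polynomial.ringHom_ext (fun c ↦ ?_) ?_
        · rw [coe_eval₂RingHom, eval₂_C, RingHom.comp_apply, hι]
          simp only [RingHom.comp_apply, AlgHom.toRingHom_eq_coe, RingHom.coe_coe, evalBase_C]
        · simp [evalBase, t]
      exact congrArg (fun ψ : (MvPolynomial (Fin d) B)[X] →+* _ ↦ ψ p) this
    have h2 := congrArg (eval₂ ι t) huv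
    rw [eval₂_add, eval₂_mul, eval₂_mul, h1, h1, hfθ, Ideal.Quotient.eq_zero_iff_mem.mpr hg] at h2
    simp at h2
  · intro hdvd
    let m : MvPolynomial (Fin d) B →+* MvPolynomial (Fin d) (B ⧸ q) :=
      MvPolynomial.map (Ideal.Quotient.mk q)
    have hm : Function.Surjective m := MvPolynomial.map_surjective _ Ideal.Quotient.mk_surjective
    rw [toRatFunc, ← Polynomial.map_map, ← Polynomial.map_map,
      map_dvd_map _ (IsFractionRing.injective _ _) (hf.map _)] at hdvd
    obtain ⟨c, hc⟩ := hdvd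
    obtain ⟨c, rfl⟩ := map_surjective m hm c
    have h1 : ∀ p : (MvPolynomial (Fin d) B)[X], p.map m = 0 → evalBase B x θ p ∈ Q := by
      intro p hp
      rw [p.as_sum_range_C_mul_X_pow, map_sum]
      refine Q.sum_mem fun i _ ↦ ?_
      rw [map_mul, evalBase_C]
      refine Q.mul_mem_right _ ?_
      have : p.coeff i ∈ polyIdeal q d := by
        have := congrArg (fun r ↦ r.coeff i) hp
        rwa [coeff_map, coeff_zero] at this
      rw [← hQ] at this
      exact this
    have h2 := h1 (g - f * c) (by rw [Polynomial.map_sub, Polynomial.map_mul, hc, sub_self])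
    rwa [map_sub, map_mul, hfθ, zero_mul, sub_zero] at h2

end

/-- `F` is free over the fraction field of `B`, which is a localization of `B`. -/
lemma flat_of_injective {B F : Type*} [CommRing B] [IsDomain B] [Field F] [Algebra B F]
    (h : Function.Injective (algebraMap B F)) : Module.Flat B F := by
  let : FaithfulSMul B F := (faithfulSMul_iff_algebraMap_injective B F).mpr h
  let : Algebra (FractionRing B) F := FractionRing.liftAlgebra B F
  have : IsScalarTower B (FractionRing B) F := FractionRing.isScalarTower_liftAlgebra B F
  have : Module.Flat B (FractionRing B) := IsLocalization.flat _ (nonZeroDivisors B)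
  exact Module.Flat.trans B (FractionRing B) F

/-- If the generic fiber of an algebra is geometrically irreducible, then so are general closed
fibers, and their generic points lie in the locus `s ≠ 0`. -/
theorem exists_forall_exists_least_prime {k : Type*} {B A : Type u} [Field k] [CommRing B]
    [IsDomain B] [CharZero B] [CommRing A] [IsDomain A] [Algebra B A] [Algebra k B]
    [Algebra.FiniteType k B] [Algebra.FiniteType B A]
    (hinj : Function.Injective (algebraMap B A))
    (hF : ∀ (F : Type u) [Field F] [Algebra B F], Function.Injective (algebraMap B F) →
      ∀ s t : F ⊗[B] A, s * t = 0 → IsNilpotent s ∨ IsNilpotent t) {s : A} (hs : s ≠ 0) :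
    ∃ b : B, b ≠ 0 ∧ ∀ q : Ideal B, q.IsMaximal → b ∉ q → ∃ Q : Ideal A, Q.IsPrime ∧
      Q.comap (algebraMap B A) = q ∧ s ∉ Q ∧
      ∀ Q' : Ideal A, Q'.IsPrime → q ≤ Q'.comap (algebraMap B A) → Q ≤ Q' := by
  obtain ⟨b, d, x, h⟩ := exists_isGenericNoether (B := B) (A := A) hinj
  obtain ⟨c, hc, hcs⟩ := h.exists_coeff_of_ne_zero hinj hs
  let P := MvPolynomial (Fin d) B
  have : CharZero P := charZero_of_injective_algebraMap (MvPolynomial.C_injective (Fin d) B)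
  let ev : P →ₐ[B] A := MvPolynomial.aeval x
  let _ : Algebra P A := ev.toRingHom.toAlgebra
  have hPA : Function.Injective (algebraMap P A) := h.algebraicIndependent
  have : IsScalarTower B P A := IsScalarTower.of_algebraMap_eq fun r ↦ (ev.commutes r).symm
  have : Algebra.FiniteType P A := Algebra.FiniteType.of_restrictScalars_finiteType B P A
  have : Algebra.IsAlgebraic P A := ⟨fun a ↦ by
    obtain ⟨n, hn⟩ := h.exists_isIntegral a
    have hb0 : algebraMap B A b ^ n ≠ 0 := pow_ne_zero _ ((map_ne_zero_iff _ hinj).mpr h.ne_zero)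
    refine IsAlgebraic.of_mul (y := algebraMap B A b ^ n) (mem_nonZeroDivisors_of_ne_zero hb0) ?_
      (IsIntegral.isAlgebraic (show IsIntegral P _ from hn))
    rw [IsScalarTower.algebraMap_apply B P A, ← map_pow]
    exact isAlgebraic_algebraMap _⟩
  obtain ⟨θ, f, hf, hfθ, hlow, ⟨u, v, δ', hδ', huv⟩, δ, hδ, hδA⟩ := exists_monic_primitive hPA
  have hev : ∀ g : P[X], evalBase B x θ g = aeval θ g := fun g ↦ by
    simp only [evalBase, eval₂AlgHom_apply]
    rfl
  obtain ⟨b', hb', hirr⟩ := exists_forall_irreducible_map_map f fun F _ φ hφ ↦ by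
    let _ := φ.toAlgebra
    have := flat_of_injective (B := B) (F := F) hφ
    exact irreducible_map_of_separable hf (by rw [hev, hfθ]) (fun g hg hg0 ↦ hlow g hg (by rwa [← hev]))
      hδ' huv F hφ (hF F hφ)
  -- This coefficient keeps `δ` outside the extension of `q`, so that powers of `δ` can be cancelled
  -- there.
  obtain ⟨m, hm⟩ := MvPolynomial.ne_zero_iff.mp hδ
  refine ⟨b * c * b' * δ.coeff m, mul_ne_zero (mul_ne_zero (mul_ne_zero h.ne_zero hc) hb') hm,
    fun q hq hbq ↦ ?_⟩
  have hbq1 : b ∉ q := fun hmem ↦ hbq (by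
    rw [mul_assoc, mul_assoc]; exact q.mul_mem_right _ hmem)
  have hbq2 : c ∉ q := fun hmem ↦ hbq (by
    rw [mul_comm b c, mul_assoc, mul_assoc]; exact q.mul_mem_right _ hmem)
  have hbq3 : b' ∉ q := fun hmem ↦ hbq (by
    exact q.mul_mem_right _ (q.mul_mem_left _ hmem))
  have hbq4 : δ.coeff m ∉ q := fun hmem ↦ hbq (q.mul_mem_left _ hmem)
  obtain ⟨Q, hQ, hQc⟩ := h.exists_prime q hbq1
  refine ⟨Q, hQ, IsGenericNoether.comap_algebraMap_eq hQc, hcs q Q hbq2 hQc, fun Q' hQ' hle ↦ ?_⟩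
  obtain ⟨Q'', hle'', hQ'', hqQ'', hmin⟩ := exists_minimal_prime_le q Q' hle
  have hQ''c := h.comap_eq_polyIdeal (k := k) hbq1 Q'' hqQ'' hmin
  have hirrE : Irreducible (f.map (toRatFunc q d)) := by
    let _ : Field (B ⧸ q) := Ideal.Quotient.field q
    have h1 := hirr (B ⧸ q) (Ideal.Quotient.mk q) (fun h0 ↦ hbq3 (Ideal.Quotient.eq_zero_iff_mem.mp h0))
    rw [toRatFunc, ← Polynomial.map_map]
    exact ((hf.map _).irreducible_iff_irreducible_map_fraction_map).mp h1
  have hfθ' : evalBase B x θ f = 0 := by rw [hev, hfθ]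
  have hδmem : ∀ (J : Ideal A), J.comap (MvPolynomial.aeval x : _ →ₐ[B] A) = polyIdeal q d →
      algebraMap P A δ ∉ J := by
    intro J hJ hmem
    have h1 : δ ∈ polyIdeal q d := by
      rw [← hJ]
      exact hmem
    exact hbq4 ((mem_polyIdeal q d).mp h1 m)
  -- After multiplication by a power of `δ`, membership in `Q` and in the minimal prime `Q''` is
  -- tested by the same divisibility.
  refine le_trans (fun a ha ↦ ?_) hle''
  obtain ⟨n, g, hg⟩ := hδA a
  have h1 : evalBase B x θ g ∈ Q := by
    rw [hev, ← hg]
    exact Q.mul_mem_left _ ha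
  rw [evalBase_mem_iff hQc hf hfθ' hirrE, ← evalBase_mem_iff hQ''c hf hfθ' hirrE, hev, ← hg] at h1
  exact (hQ''.mem_or_mem h1).resolve_left fun h2 ↦ hδmem Q'' hQ''c (hQ''.mem_of_pow_mem _ h2)

/-- If all points over the generic point lie in the zero locus of a finitely generated ideal, then so
do all points over a non-empty open subset. -/
lemma exists_forall_le_of_fg {B A : Type*} [CommRing B] [IsDomain B] [CommRing A] [Algebra B A]
    {I : Ideal A} (hI : I.FG)
    (h : ∀ Q : Ideal A, Q.IsPrime → Q.comap (algebraMap B A) = ⊥ → I ≤ Q) :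
    ∃ b : B, b ≠ 0 ∧ ∀ Q : Ideal A, Q.IsPrime → algebraMap B A b ∉ Q → I ≤ Q := by
  classical
  have key : ∀ a ∈ I, ∃ b : B, b ≠ 0 ∧ ∃ n, algebraMap B A b * a ^ n = 0 := by
    intro a ha
    by_contra! hcon
    -- A prime that avoids the nonzero elements of `B` and the powers of `a` would lie over zero
    -- without containing `a`.
    have hdisj : Disjoint ((⊥ : Ideal A) : Set A)
        ((nonZeroDivisors B).map (algebraMap B A) ⊔ Submonoid.powers a : Submonoid A) := by
      rw [Set.disjoint_left]
      rintro t ht ht'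
      obtain rfl : t = 0 := ht
      obtain ⟨_, ⟨b, hb, rfl⟩, _, ⟨n, rfl⟩, h0⟩ := Submonoid.mem_sup.mp ht'
      exact hcon b (nonZeroDivisors.ne_zero hb) n h0
    obtain ⟨Q, hQ, -, hd⟩ := Ideal.exists_le_prime_disjoint _ _ hdisj
    refine Set.disjoint_left.mp hd (h Q hQ ?_ ha)
      (le_sup_right (a := (nonZeroDivisors B).map (algebraMap B A)) (Submonoid.mem_powers a))
    rw [eq_bot_iff]
    intro b hb
    by_contra hb0
    exact Set.disjoint_left.mp hd hb
      (le_sup_left (b := Submonoid.powers a) ⟨b, mem_nonZeroDivisors_of_ne_zero hb0, rfl⟩)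
  obtain ⟨S, rfl⟩ := hI
  choose! β hβ n hn using key
  let b := ∏ a ∈ S, β a
  have hb : b ≠ 0 := Finset.prod_ne_zero_iff.mpr fun a ha ↦ hβ a (Ideal.subset_span ha)
  have hS : ∀ Q : Ideal A, Q.IsPrime → algebraMap B A b ∉ Q → Ideal.span (S : Set A) ≤ Q := by
    intro Q hQ hbQ
    rw [Ideal.span_le]
    intro a ha
    have h1 : algebraMap B A (β a) * a ^ n a ∈ Q := by
      rw [hn a (Ideal.subset_span ha)]
      exact Q.zero_mem
    rcases hQ.mem_or_mem h1 with h2 | h2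
    · refine absurd ?_ hbQ
      rw [show b = β a * ∏ t ∈ S.erase a, β t from (Finset.mul_prod_erase S β ha).symm, map_mul]
      exact Q.mul_mem_right _ h2
    · exact hQ.mem_of_pow_mem _ h2
  exact ⟨b, hb, hS⟩

end

/-! ### Closed points of algebras of finite type. -/

section ClosedPoints

variable {k E D : Type*} [Field k] [CommRing E] [Algebra k E] [CommRing D] [Algebra k D]

lemma exists_isMaximal_notMem [IsDomain E] [Algebra.FiniteType k E] {b : E} (hb : b ≠ 0) :
    ∃ m : Ideal E, m.IsMaximal ∧ b ∉ m := by
  have : IsJacobsonRing E := isJacobsonRing_of_finiteType (A := k)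
  have hJ : b ∉ (⊥ : Ideal E).jacobson := by
    rw [IsJacobsonRing.out inferInstance (Ideal.IsPrime.isRadical inferInstance)]
    simpa using hb
  rw [Ideal.jacobson, Ideal.mem_sInf] at hJ
  push Not at hJ
  obtain ⟨m, ⟨-, hm⟩, hbm⟩ := hJ
  exact ⟨m, hm, hbm⟩

lemma isAlgebraic_quotient [Algebra.FiniteType k E] (m : Ideal E) [m.IsMaximal] :
    Algebra.IsAlgebraic k (E ⧸ m) := by
  let _ : Field (E ⧸ m) := Ideal.Quotient.field m
  have : Module.Finite k (E ⧸ m) := finite_of_finite_type_of_isJacobsonRing k (E ⧸ m)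
  exact Algebra.IsAlgebraic.of_finite k _

lemma tr_eq_zero_of_isAlgebraic [IsDomain E] [Algebra.IsAlgebraic k E] : tr k E = 0 := by
  rw [tr, trdeg_eq_zero]
  simp

lemma exists_algHom_ker_eq [IsAlgClosed k] [Algebra.FiniteType k E] (m : Ideal E) [m.IsMaximal] :
    ∃ ev : E →ₐ[k] k, RingHom.ker ev = m := by
  let _ : Field (E ⧸ m) := Ideal.Quotient.field m
  have : Algebra.IsAlgebraic k (E ⧸ m) := isAlgebraic_quotient m
  have hb : Function.Bijective (Algebra.ofId k (E ⧸ m)) :=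
    IsAlgClosed.algebraMap_bijective_of_isIntegral
  let e := AlgEquiv.ofBijective (Algebra.ofId k (E ⧸ m)) hb
  refine ⟨(e.symm : (E ⧸ m) →ₐ[k] k).comp (Ideal.Quotient.mkₐ k m), ?_⟩
  ext x
  exact (map_eq_zero_iff e.symm e.symm.injective).trans Ideal.Quotient.eq_zero_iff_mem

/-- A `k`-valued point is determined by its kernel, which contains every `x - ev x`. -/
lemma algHom_eq_of_ker_le {ev ev' : D →ₐ[k] k} (h : RingHom.ker ev ≤ RingHom.ker ev') : ev = ev' := by
  ext x
  have h1 : x - algebraMap k D (ev x) ∈ RingHom.ker ev := by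
    rw [RingHom.mem_ker, map_sub, AlgHom.commutes]
    simp
  have h2 := h h1
  rw [RingHom.mem_ker, map_sub, AlgHom.commutes, sub_eq_zero] at h2
  exact h2.symm

/-- General closed fibers of a dominant morphism with positive-dimensional generic fiber are
infinite. -/
lemma exists_forall_infinite [IsDomain D] [IsDomain E] [Algebra D E] [IsScalarTower k D E]
    [Algebra.FiniteType k D] [Algebra.FiniteType k E]
    (hinj : Function.Injective (algebraMap D E)) (htr : tr k D < tr k E) {e : E} (he : e ≠ 0) :
    ∃ c : D, c ≠ 0 ∧ ∀ t : Ideal D, t.IsMaximal → c ∉ t →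
      {z : Ideal E | z.IsMaximal ∧ z.comap (algebraMap D E) = t ∧ e ∉ z}.Infinite := by
  classical
  have : Algebra.FiniteType D E := .of_restrictScalars_finiteType k D E
  obtain ⟨b, d, x, h⟩ := exists_isGenericNoether (B := D) (A := E) hinj
  obtain ⟨c, hc, hcs⟩ := h.exists_coeff_of_ne_zero hinj he
  have hd : d ≠ 0 := by
    rintro rfl
    rw [h.tr_eq (k := k) hinj] at htr
    simp at htr
  refine ⟨b * c, mul_ne_zero h.ne_zero hc, fun t ht hbc hfin ↦ ?_⟩
  obtain ⟨Q, hQ, hQc⟩ := h.exists_prime t (fun hm ↦ hbc (t.mul_mem_right _ hm))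
  have heQ := hcs t Q (fun hm ↦ hbc (t.mul_mem_left _ hm)) hQc
  have hle := IsGenericNoether.tr_le_tr_quotient (k := k) hQc
  have hQt := IsGenericNoether.comap_algebraMap_eq hQc
  -- `Q` has positive dimension, so it is not maximal, and every closed point of its closure
  -- satisfies an equation `y` outside `Q`.
  have hne : ∀ z : Ideal E, z.IsMaximal → Q ≤ z → ∃ y ∈ z, y ∉ Q := by
    intro z hz hQz
    by_contra! hcon
    obtain rfl : Q = z := le_antisymm hQz hcon
    have := isAlgebraic_quotient (k := k) Q
    rw [tr_eq_zero_of_isAlgebraic (E := E ⧸ Q), nonpos_iff_eq_zero, add_eq_zero] at hle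
    exact hd (by exact_mod_cast hle.2)
  choose! y hy hyQ using hne
  let Z := hfin.toFinset.filter fun z ↦ Q ≤ z
  -- A closed point of the closure of `Q` where this product does not vanish is missing from the
  -- supposedly finite list.
  have hprod : e * ∏ z ∈ Z, y z ∉ Q := by
    refine fun hm ↦ (hQ.mem_or_mem hm).elim heQ fun hm ↦ ?_
    obtain ⟨z, hz, hzQ⟩ := hQ.prod_mem_iff.mp hm
    simp only [Z, Finset.mem_filter, Set.Finite.mem_toFinset] at hz
    exact hyQ z hz.1.1 hz.2 hzQ
  obtain ⟨m, hm, hbm⟩ := exists_isMaximal_notMem (k := k) (E := E ⧸ Q)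
    (b := Ideal.Quotient.mk Q (e * ∏ z ∈ Z, y z)) (fun h0 ↦ hprod (Ideal.Quotient.eq_zero_iff_mem.mp h0))
  let z := m.comap (Ideal.Quotient.mk Q)
  have hz : z.IsMaximal := Ideal.comap_isMaximal_of_surjective _ Ideal.Quotient.mk_surjective
  have hQz : Q ≤ z := fun a ha ↦ by
    rw [Ideal.mem_comap, Ideal.Quotient.eq_zero_iff_mem.mpr ha]
    exact m.zero_mem
  have hmem : e * ∏ z ∈ Z, y z ∉ z := hbm
  have hzt : z.comap (algebraMap D E) = t := by
    refine (ht.eq_of_le (Ideal.comap_ne_top _ hz.ne_top) ?_).symm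
    rw [← hQt]
    exact Ideal.comap_mono hQz
  have hzZ : z ∈ Z := by
    simp only [Z, Finset.mem_filter, Set.Finite.mem_toFinset]
    exact ⟨⟨hz, hzt, fun he ↦ hmem (z.mul_mem_right _ he)⟩, hQz⟩
  exact hmem (z.mul_mem_left _ (hz.isPrime.prod_mem_iff.mpr ⟨z, hzZ, hy z hz hQz⟩))

end ClosedPoints

/-! ### The key step: members of the family through given points. -/

section

open TensorProduct

universe u

lemma rk_sup {k Ω : Type*} [Field k] [CommRing Ω] [IsDomain Ω] [Algebra k Ω] (D S : Subalgebra k Ω) :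
    rk k ((D ⊔ S : Subalgebra k Ω) : Set Ω) = rk k ((D : Set Ω) ∪ S) := by
  rw [Algebra.sup_def, rk_adjoin]

/-- A map from a geometrically irreducible algebra over a field with an image of maximal dimension
has a nil kernel. -/
lemma isNilpotent_of_rk_le {k B A F Ω : Type u} [Field k] [CommRing B] [IsDomain B] [CommRing A]
    [IsDomain A] [Algebra B A] [Algebra k B] [Algebra k A] [IsScalarTower k B A]
    [Algebra.FiniteType k B] [Field F] [Algebra k F] [Algebra B F]
    [IsScalarTower k B F] (hBF : Function.Injective (algebraMap B F))
    (hF : ∀ s t : F ⊗[B] A, s * t = 0 → IsNilpotent s ∨ IsNilpotent t) {r : ℕ}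
    (hA : tr k A ≤ tr k B + r) (hFtop : tr k F ≠ ⊤) [CommRing Ω] [IsDomain Ω] [Algebra k Ω]
    (ω : F ⊗[B] A →ₐ[k] Ω) (hω : tr k F + r ≤ rk k (Set.range ω)) {w : F ⊗[B] A} (hw : ω w = 0) :
    IsNilpotent w := by
  let N := nilradical (F ⊗[B] A)
  have hN : N.IsPrime := by
    refine Ideal.isPrime_iff.mpr ⟨fun h ↦ ?_, fun {s t} hst ↦ ?_⟩
    · have h1 : (1 : F ⊗[B] A) ∈ N := h ▸ Submodule.mem_top
      obtain ⟨n, hn⟩ := mem_nilradical.mp h1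
      have h2 := congrArg ω hn
      rw [one_pow, map_one, map_zero] at h2
      exact one_ne_zero h2
    · obtain ⟨n, hn⟩ := mem_nilradical.mp hst
      rw [mul_pow] at hn
      refine (hF _ _ hn).imp (fun h ↦ ?_) fun h ↦ ?_ <;>
      · exact mem_nilradical.mpr (IsNilpotent.of_pow h)
  have hNω : N ≤ RingHom.ker ω := fun s hs ↦ by
    obtain ⟨n, hn⟩ := mem_nilradical.mp hs
    have h2 := congrArg ω hn
    rw [map_pow, map_zero] at h2
    exact eq_zero_of_pow_eq_zero h2
  by_contra hw0
  have hωP : (RingHom.ker ω).IsPrime := RingHom.ker_isPrime ω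
  -- A kernel larger than the nilradical lowers the transcendence degree.
  have hlt : tr k ((F ⊗[B] A) ⧸ RingHom.ker ω) + 1 ≤ tr k ((F ⊗[B] A) ⧸ N) := by
    refine tr_add_one_le_of_surjective (Ideal.Quotient.factorₐ k hNω)
      (Ideal.Quotient.factor_surjective hNω) fun hinj ↦ hw0 ?_
    have h1 : Ideal.Quotient.mk N w = 0 := hinj (by
      rw [map_zero]
      exact Ideal.Quotient.eq_zero_iff_mem.mpr (RingHom.mem_ker.mpr hw))
    exact mem_nilradical.mp (Ideal.Quotient.eq_zero_iff_mem.mp h1)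
  have h1 : rk k (Set.range ω) ≤ tr k ((F ⊗[B] A) ⧸ RingHom.ker ω) := by
    have h2 := rk_range_le_tr (Ideal.kerLiftAlg ω)
    refine le_trans (rk_mono ?_) h2
    rintro _ ⟨s, rfl⟩
    exact ⟨Ideal.Quotient.mk _ s, rfl⟩
  let ι : F →ₐ[k] (F ⊗[B] A) ⧸ N :=
    (Ideal.Quotient.mkₐ k N).comp (Algebra.TensorProduct.includeLeft : F →ₐ[k] F ⊗[B] A)
  let j : A →ₐ[k] (F ⊗[B] A) ⧸ N :=
    (Ideal.Quotient.mkₐ k N).comp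
      ((Algebra.TensorProduct.includeRight : A →ₐ[B] F ⊗[B] A).restrictScalars k)
  let β : B →ₐ[k] (F ⊗[B] A) ⧸ N := ι.comp (IsScalarTower.toAlgHom k B F)
  have hβj : β = j.comp (IsScalarTower.toAlgHom k B A) := by
    ext s
    change Ideal.Quotient.mk N (algebraMap B F s ⊗ₜ 1) = Ideal.Quotient.mk N (1 ⊗ₜ algebraMap B A s)
    rw [Algebra.algebraMap_eq_smul_one, Algebra.algebraMap_eq_smul_one, TensorProduct.smul_tmul]
  have hβ : Function.Injective β := ι.toRingHom.injective.comp hBF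
  have huniv : rk k (Set.univ : Set ((F ⊗[B] A) ⧸ N)) = rk k (Set.range ι ∪ Set.range j) := by
    rw [← rk_adjoin (Set.range ι ∪ Set.range j)]
    congr 1
    refine (Set.eq_univ_of_forall fun s ↦ ?_).symm
    obtain ⟨s, rfl⟩ := Ideal.Quotient.mk_surjective s
    induction s using TensorProduct.induction_on with
    | zero => rw [map_zero]; exact zero_mem _
    | add s t hs ht => rw [map_add]; exact add_mem hs ht
    | tmul f a =>
      have : Ideal.Quotient.mk N (f ⊗ₜ a) = ι f * j a := by
        change _ = Ideal.Quotient.mk N (f ⊗ₜ 1) * Ideal.Quotient.mk N (1 ⊗ₜ a)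
        rw [← map_mul, Algebra.TensorProduct.tmul_mul_tmul, mul_one, one_mul]
      rw [this]
      exact mul_mem (Algebra.subset_adjoin (.inl ⟨f, rfl⟩)) (Algebra.subset_adjoin (.inr ⟨a, rfl⟩))
  -- Submodularity for the images of `F` and `A`, which share the image of `B`, bounds the degree of
  -- the reduced ring by `tr k F + r`.
  have h2 : tr k B + rk k (Set.range ι ∪ Set.range j) ≤ tr k F + (tr k B + r) := by
    rw [← rk_range β hβ]
    refine le_trans (add_le_add_left (rk_mono ?_) _) ((rk_submod (k := k) (Set.range ι) (Set.range j)).trans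
      (add_le_add (rk_range_le_tr ι) ((rk_range_le_tr j).trans ?_)))
    · rintro _ ⟨s, rfl⟩
      exact ⟨⟨algebraMap B F s, rfl⟩, ⟨algebraMap B A s, by rw [hβj]; rfl⟩⟩
    · rwa [rk_range β hβ]
  rw [← huniv, rk_univ] at h2
  have hBtop : tr k B ≠ ⊤ := tr_ne_top_of_finiteType
  have h3 := (add_le_add_left (hω.trans h1) 1).trans hlt
  have h4 := (add_le_add_right h3 (tr k B)).trans h2
  generalize tr k F = f at *
  generalize tr k B = b at *
  lift f to ℕ using hFtop
  lift b to ℕ using hBtop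
  norm_cast at h4
  omega

/-- The extension to `Frac E ⊗ A` of a homomorphism from `E ⊗ A` to a field. -/
lemma exists_fractionRing_tensor_hom {B E A M : Type*} [CommRing B] [CommRing E] [IsDomain E]
    [CommRing A] [Field M] [Algebra B E] [Algebra B A] [Algebra B M] (f : E →ₐ[B] M)
    (hf : Function.Injective f) (j : A →ₐ[B] M) :
    ∃ γ : FractionRing E ⊗[B] A →ₐ[B] M, ∀ w : E ⊗[B] A,
      γ (Algebra.TensorProduct.map (IsScalarTower.toAlgHom B E (FractionRing E)) (AlgHom.id B A) w) =
        Algebra.TensorProduct.productMap f j w := by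
  let γ := Algebra.TensorProduct.productMap (IsFractionRing.liftAlgHom (K := FractionRing E) hf) j
  refine ⟨γ, fun w ↦ ?_⟩
  rw [← AlgHom.comp_apply]
  congr 1
  refine Algebra.TensorProduct.ext' fun x a ↦ ?_
  simp [γ]

/-- A prime over the generic point of `Spec E` comes from a prime of `FractionRing E ⊗ A`, so it
contains whatever becomes nilpotent there. -/
lemma mem_of_isNilpotent_fractionRing_tensor {B E A : Type*} [CommRing B] [CommRing E] [IsDomain E]
    [CommRing A] [Algebra B E] [Algebra B A] {Q : Ideal (E ⊗[B] A)} [Q.IsPrime]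
    (hQ : Q.comap (algebraMap E (E ⊗[B] A)) = ⊥) {w : E ⊗[B] A}
    (hw : IsNilpotent (Algebra.TensorProduct.map (IsScalarTower.toAlgHom B E (FractionRing E))
      (AlgHom.id B A) w)) : w ∈ Q := by
  let M := FractionRing ((E ⊗[B] A) ⧸ Q)
  let g : E ⊗[B] A →ₐ[B] M :=
    (IsScalarTower.toAlgHom B ((E ⊗[B] A) ⧸ Q) M).comp (Ideal.Quotient.mkₐ B Q)
  have hg : ∀ w, g w = 0 ↔ w ∈ Q := fun w ↦ by
    change algebraMap ((E ⊗[B] A) ⧸ Q) M (Ideal.Quotient.mk Q w) = 0 ↔ w ∈ Q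
    rw [map_eq_zero_iff _ (IsFractionRing.injective ((E ⊗[B] A) ⧸ Q) M),
      Ideal.Quotient.eq_zero_iff_mem]
  let f : E →ₐ[B] M := g.comp Algebra.TensorProduct.includeLeft
  let j : A →ₐ[B] M := g.comp Algebra.TensorProduct.includeRight
  have hf : Function.Injective f := by
    rw [injective_iff_map_eq_zero]
    intro x hx
    have : x ∈ Q.comap (algebraMap E (E ⊗[B] A)) := (hg _).mp hx
    rwa [hQ] at this
  obtain ⟨γ, hγ⟩ := exists_fractionRing_tensor_hom f hf j
  have h1 := (hw.map γ).eq_zero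
  rw [hγ] at h1
  rw [← hg, ← h1]
  have h2 : g = Algebra.TensorProduct.productMap f j := by
    refine Algebra.TensorProduct.ext' fun x a ↦ ?_
    rw [Algebra.TensorProduct.productMap_apply_tmul]
    change g (x ⊗ₜ a) = g (x ⊗ₜ 1) * g (1 ⊗ₜ a)
    rw [← map_mul, Algebra.TensorProduct.tmul_mul_tmul, mul_one, one_mul]
  exact congrArg (fun g : E ⊗[B] A →ₐ[B] M ↦ g w) h2

set_option maxHeartbeats 1000000 in
/-- Let `𝔔 q` be the fiber over the closed point `q` of a geometrically irreducible family of closed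
subvarieties, in which only finitely many members have the same image in `Spec R`. If a further
general point of the member `q` of dimension `r` raises the transcendence degree of the ambient points
by at most `r`, then the parameter is algebraic over the ambient points. -/
theorem rk_union_le_of_finite {k B A R Ω : Type u} [Field k] [IsAlgClosed k] [CommRing B] [IsDomain B]
    [CommRing A] [IsDomain A] [Algebra B A] [Algebra k B] [Algebra k A] [IsScalarTower k B A]
    [Algebra.FiniteType k B] [Algebra.FiniteType B A] [CommRing R] [Algebra k R]
    [Algebra.FiniteType k R] [Field Ω] [Algebra k Ω]
    (hF : ∀ (F : Type u) [Field F] [Algebra B F], Function.Injective (algebraMap B F) →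
      ∀ s t : F ⊗[B] A, s * t = 0 → IsNilpotent s ∨ IsNilpotent t) {r : ℕ}
    (hA : tr k A ≤ tr k B + r) (ρ : R →ₐ[k] A) {b₀ : B} (hb₀ : b₀ ≠ 0) (𝔔 : Ideal B → Ideal A)
    (h𝔔 : ∀ q : Ideal B, q.IsMaximal → b₀ ∉ q → (𝔔 q).IsPrime ∧
      (𝔔 q).comap (algebraMap B A) = q ∧ r ≤ tr k (R ⧸ (𝔔 q).comap ρ))
    (hfin : ∀ 𝔭 : Ideal R, {q : Ideal B | q.IsMaximal ∧ b₀ ∉ q ∧ (𝔔 q).comap ρ = 𝔭}.Finite)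
    (α : A →ₐ[k] Ω) (hα : Function.Injective (α.comp (IsScalarTower.toAlgHom k B A)))
    (D : Subalgebra k Ω) (hD : D.FG)
    (hE : rk k ((D : Set Ω) ∪ Set.range (α.comp (IsScalarTower.toAlgHom k B A))) + r ≤
      rk k ((D : Set Ω) ∪ Set.range α))
    (hS : rk k ((D : Set Ω) ∪ Set.range (α.comp ρ)) ≤ rk k (D : Set Ω) + r) :
    rk k ((D : Set Ω) ∪ Set.range (α.comp (IsScalarTower.toAlgHom k B A))) ≤ rk k (D : Set Ω) := by
  let β : B →ₐ[k] Ω := α.comp (IsScalarTower.toAlgHom k B A)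
  -- `D` stands for the ambient points chosen so far; `E` adjoins the parameter to them, and `S`
  -- adjoins the next ambient point.
  let E : Subalgebra k Ω := D ⊔ β.range
  let S : Subalgebra k Ω := D ⊔ (α.comp ρ).range
  have hβE : ∀ b, β b ∈ E := fun b ↦ (le_sup_right : β.range ≤ E) ⟨b, rfl⟩
  have hEtr : tr k E = rk k ((D : Set Ω) ∪ Set.range β) := by
    rw [← rk_subalgebra, rk_sup]; rfl
  have hStr : tr k S = rk k ((D : Set Ω) ∪ Set.range (α.comp ρ)) := by
    rw [← rk_subalgebra, rk_sup]; rfl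
  have hDtr : tr k D = rk k (D : Set Ω) := (rk_subalgebra D).symm
  have : Algebra.FiniteType k D := D.fg_iff_finiteType.mp hD
  have hFGrange : ∀ {C : Type u} [CommRing C] [Algebra k C] [Algebra.FiniteType k C] (f : C →ₐ[k] Ω),
      f.range.FG := fun f ↦ by
    rw [Subalgebra.fg_iff_finiteType]
    exact .of_surjective f.rangeRestrict f.rangeRestrict_surjective
  have : Algebra.FiniteType k E := E.fg_iff_finiteType.mp (hD.sup (hFGrange β))
  have : Algebra.FiniteType k S := S.fg_iff_finiteType.mp (hD.sup (hFGrange _))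
  by_contra hcon
  rw [not_le, ← hDtr] at hcon
  change tr k D < rk k ((D : Set Ω) ∪ Set.range β) at hcon
  rw [← hEtr] at hcon
  let βE : B →ₐ[k] E := β.codRestrict E hβE
  let _ : Algebra B E := βE.toRingHom.toAlgebra
  have : IsScalarTower k B E := IsScalarTower.of_algebraMap_eq fun c ↦ (βE.commutes c).symm
  have hβEinj : Function.Injective (algebraMap B E) := fun s t hst ↦
    hα (congrArg Subtype.val hst)
  let F := FractionRing E
  have hBF : Function.Injective (algebraMap B F) := by
    rw [IsScalarTower.algebraMap_eq B E F]
    exact (IsFractionRing.injective E F).comp hβEinj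
  let T := E ⊗[B] A
  have : Algebra.FiniteType E T := inferInstance
  have : Algebra.FiniteType k T := .trans (S := E) inferInstance inferInstance
  have : IsNoetherianRing T := Algebra.FiniteType.isNoetherianRing k T
  let _ : Algebra B Ω := β.toRingHom.toAlgebra
  have : IsScalarTower k B Ω := IsScalarTower.of_algebraMap_eq fun c ↦ (β.commutes c).symm
  let αB : A →ₐ[B] Ω := { α with commutes' := fun _ ↦ rfl }
  let vB : E →ₐ[B] Ω := { E.val with commutes' := fun _ ↦ rfl }
  let ω : T →ₐ[B] Ω := Algebra.TensorProduct.productMap vB αB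
  have hω : ∀ (x : E) (a : A), ω (x ⊗ₜ a) = x.1 * α a := fun x a ↦
    Algebra.TensorProduct.productMap_apply_tmul _ _ x a
  -- By `hE` the next point is generic in its member even over `E`. By geometric irreducibility the
  -- kernel of `ω` is therefore nil over the generic point of `Spec E`.
  have hJ : ∀ Q : Ideal T, Q.IsPrime → Q.comap (algebraMap E T) = ⊥ → RingHom.ker ω ≤ Q := by
    intro Q hQ hQE w hw
    obtain ⟨ω', hω'⟩ := exists_fractionRing_tensor_hom vB Subtype.val_injective αB
    have hFE : tr k F = tr k E := tr_fractionRing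
    refine mem_of_isNilpotent_fractionRing_tensor hQE (isNilpotent_of_rk_le (k := k) hBF (hF F hBF) hA (hFE ▸ tr_ne_top_of_finiteType)
      (ω'.restrictScalars k) (by
        rw [hFE, hEtr]
        refine hE.trans (rk_mono ?_)
        rintro _ (hx | ⟨a, rfl⟩)
        · refine ⟨_, (hω' ((⟨_, (le_sup_left : D ≤ E) hx⟩ : E) ⊗ₜ 1)).trans ?_⟩
          exact (hω _ _).trans (by simp)
        · refine ⟨_, (hω' (1 ⊗ₜ a)).trans ?_⟩
          exact (hω _ _).trans (by simp)) ((hω' w).trans hw))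
  obtain ⟨e, he, heJ⟩ := exists_forall_le_of_fg (IsNoetherian.noetherian (RingHom.ker ω)) hJ
  let _ : Algebra D S := (Subalgebra.inclusion (le_sup_left : D ≤ S)).toRingHom.toAlgebra
  let _ : Algebra D E := (Subalgebra.inclusion (le_sup_left : D ≤ E)).toRingHom.toAlgebra
  have : IsScalarTower k D S := IsScalarTower.of_algebraMap_eq fun _ ↦ rfl
  have : IsScalarTower k D E := IsScalarTower.of_algebraMap_eq fun _ ↦ rfl
  have hDS : Function.Injective (algebraMap D S) := Subalgebra.inclusion_injective _
  have hDE : Function.Injective (algebraMap D E) := Subalgebra.inclusion_injective _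
  have : Algebra.FiniteType D S := .of_restrictScalars_finiteType k D S
  have : IsNoetherianRing S := Algebra.FiniteType.isNoetherianRing k S
  -- Fibers of `Spec S` over general closed points of `Spec D` have dimension at most `dS ≤ r`.
  obtain ⟨bS, dS, xS, hNS⟩ := exists_isGenericNoether (B := D) (A := S) hDS
  have hdS : (dS : ℕ∞) ≤ r := by
    have h1 := hNS.tr_eq (k := k) hDS
    rw [hStr] at h1
    rw [← hDtr, h1] at hS
    exact (ENat.add_le_add_iff_left tr_ne_top_of_finiteType).mp hS
  -- If the parameter is not algebraic over `D`, infinitely many of its values occur over one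
  -- general closed point `t`.
  obtain ⟨c, hc, hinf⟩ := exists_forall_infinite (k := k) hDE hcon (e := e * βE b₀)
    (mul_ne_zero he ((map_ne_zero_iff _ hβEinj).mpr hb₀))
  obtain ⟨t, ht, hct⟩ := exists_isMaximal_notMem (k := k) (mul_ne_zero hc hNS.ne_zero)
  specialize hinf t ht fun h ↦ hct (t.mul_mem_right _ h)
  have hbt : bS ∉ t := fun h ↦ hct (t.mul_mem_left _ h)
  let ρS : R →ₐ[k] S := (α.comp ρ).codRestrict S fun x ↦ (le_sup_right : (α.comp ρ).range ≤ S) ⟨x, rfl⟩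
  -- The components of the fiber of `Spec S` over `t`, contracted to `R`.
  let Φ : Set (Ideal R) := (fun I : Ideal S ↦ I.comap ρS) '' (t.map (algebraMap D S)).minimalPrimes
  have hΦ : Φ.Finite := (Ideal.finite_minimalPrimes_of_isNoetherianRing S _).image _
  have hΦ' : (⋃ 𝔭 ∈ Φ, {q : Ideal B | q.IsMaximal ∧ b₀ ∉ q ∧ (𝔔 q).comap ρ = 𝔭}).Finite :=
    hΦ.biUnion fun 𝔭 _ ↦ hfin 𝔭
  have hevmax : ∀ (ev : E →ₐ[k] k), ((RingHom.ker ev).comap (algebraMap B E)).IsMaximal := by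
    intro ev
    change (RingHom.ker ((ev.comp βE : B →ₐ[k] k) : B →+* k)).IsMaximal
    exact RingHom.ker_isMaximal_of_surjective _ fun x ↦ ⟨algebraMap k B x, (ev.comp βE).commutes x⟩
  refine (hinf.image (f := fun z ↦ z.comap (algebraMap B E)) ?_) (hΦ'.subset ?_)
  -- Over a fixed `t`, a closed point of `Spec E` is determined by the parameter value, since `E` is
  -- generated by `D` and the image of `B`.
  · rintro z ⟨hz, hzt, -⟩ z' ⟨hz', hzt', -⟩ hzz'
    obtain ⟨ev, rfl⟩ := exists_algHom_ker_eq (k := k) z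
    obtain ⟨ev', rfl⟩ := exists_algHom_ker_eq (k := k) z'
    congr 1
    have h1 : ev.comp (Subalgebra.inclusion (le_sup_left : D ≤ E)) =
        ev'.comp (Subalgebra.inclusion (le_sup_left : D ≤ E)) :=
      algHom_eq_of_ker_le (hzt.trans hzt'.symm).le
    have h2 : ev.comp βE = ev'.comp βE := algHom_eq_of_ker_le (le_of_eq hzz')
    have h3 : (AlgHom.equalizer ev ev').map E.val = E := by
      refine le_antisymm ?_ (sup_le ?_ ?_)
      · rintro _ ⟨x, -, rfl⟩
        exact x.2
      · intro x hx
        exact ⟨⟨x, (le_sup_left : D ≤ E) hx⟩, congrArg (fun g : D →ₐ[k] k ↦ g ⟨x, hx⟩) h1, rfl⟩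
      · rintro _ ⟨x, rfl⟩
        exact ⟨βE x, congrArg (fun g : B →ₐ[k] k ↦ g x) h2, rfl⟩
    ext x
    obtain ⟨y, hy, hyx⟩ : (x : Ω) ∈ (AlgHom.equalizer ev ev').map E.val := by
      rw [h3]
      exact x.2
    obtain rfl : y = x := Subtype.ext hyx
    exact hy
  · rintro _ ⟨z, ⟨hz, hzt, hez⟩, rfl⟩
    obtain ⟨ev, rfl⟩ := exists_algHom_ker_eq (k := k) z
    have hq := hevmax ev
    let q := (RingHom.ker ev).comap (algebraMap B E)
    have hbq : b₀ ∉ q := fun h ↦ hez (Ideal.mul_mem_left _ _ h)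
    obtain ⟨hQ, hQq, hQr⟩ := h𝔔 q hq hbq
    refine Set.mem_biUnion (x := (𝔔 q).comap ρ) ?_ ⟨hq, hbq, rfl⟩
    let Q := 𝔔 q
    let f : E →ₐ[B] A ⧸ Q := { (algebraMap k (A ⧸ Q)).comp ev.toRingHom with
      commutes' := fun s ↦ by
        have h1 : s - algebraMap k B (ev (βE s)) ∈ q := by
          change ev (βE _) = 0
          rw [map_sub, map_sub, AlgHom.commutes, AlgHom.commutes]
          simp
        rw [← hQq, Ideal.mem_comap, map_sub, ← IsScalarTower.algebraMap_apply] at h1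
        exact (Ideal.Quotient.eq.mpr h1).symm }
    let τ : T →ₐ[B] A ⧸ Q := Algebra.TensorProduct.productMap f (Ideal.Quotient.mkₐ B Q)
    have hτ : ∀ x a, τ (x ⊗ₜ a) = algebraMap k (A ⧸ Q) (ev x) * Ideal.Quotient.mk Q a := fun x a ↦
      Algebra.TensorProduct.productMap_apply_tmul _ _ x a
    -- Away from `e = 0`, the relations in `ker ω` hold on the whole member at `q`, so the image of
    -- `ω` specializes to `A ⧸ Q`.
    have hle : RingHom.ker ω ≤ RingHom.ker τ := by
      refine heJ _ (RingHom.ker_isPrime _) fun h ↦ hez (Ideal.mul_mem_right _ _ ?_)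
      have h1 : τ (e ⊗ₜ 1) = 0 := h
      rw [hτ, map_one, mul_one, map_eq_zero_iff _ (algebraMap k (A ⧸ Q)).injective] at h1
      exact h1
    have hle' : ∀ w, ω.rangeRestrict w = 0 → τ w = 0 := fun w hw ↦ hle (congrArg Subtype.val hw)
    let χ : ω.range →+* A ⧸ Q := RingHom.liftOfSurjective ω.rangeRestrict.toRingHom
      ω.rangeRestrict_surjective ⟨τ.toRingHom, hle'⟩
    have hχ : ∀ w, χ (ω.rangeRestrict w) = τ w := fun w ↦
      RingHom.liftOfRightInverse_comp_apply _ _ _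
        ⟨τ.toRingHom, hle'⟩ w
    have hSω : S ≤ ω.range.restrictScalars k := by
      refine sup_le (fun x hx ↦ ⟨(⟨x, (le_sup_left : D ≤ E) hx⟩ : E) ⊗ₜ 1, ?_⟩) ?_
      · exact (hω _ _).trans (by simp)
      · rintro _ ⟨x, rfl⟩
        exact ⟨1 ⊗ₜ ρ x, (hω _ _).trans (by simp)⟩
    let χS : S →+* A ⧸ Q := χ.comp (Subalgebra.inclusion hSω).toRingHom
    have hχD : ∀ x : D, χS (algebraMap D S x) = algebraMap k (A ⧸ Q) (ev (algebraMap D E x)) := by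
      intro x
      have h1 := hχ ((algebraMap D E x) ⊗ₜ 1)
      rw [hτ, map_one, mul_one] at h1
      rw [← h1]
      refine congrArg χ (Subtype.ext ?_)
      exact ((hω _ _).trans (by rw [map_one, mul_one]; rfl)).symm
    have hχR : ∀ x : R, χS (ρS x) = Ideal.Quotient.mk Q (ρ x) := by
      intro x
      have h1 := hχ (1 ⊗ₜ ρ x)
      rw [hτ, map_one, map_one, one_mul] at h1
      rw [← h1]
      refine congrArg χ (Subtype.ext ?_)
      exact ((hω _ _).trans (by rw [OneMemClass.coe_one, one_mul]; rfl)).symm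
    let 𝔖 := RingHom.ker χS
    have h𝔖 : 𝔖.IsPrime := RingHom.ker_isPrime _
    have h𝔖t : 𝔖.comap (algebraMap D S) = t := by
      rw [← hzt]
      ext x
      change χS _ = 0 ↔ ev _ = 0
      rw [hχD, map_eq_zero_iff _ (algebraMap k (A ⧸ Q)).injective]
    have h𝔖R : 𝔖.comap ρS = Q.comap ρ := by
      ext x
      change χS _ = 0 ↔ ρ x ∈ Q
      rw [hχR, Ideal.Quotient.eq_zero_iff_mem]
    refine ⟨𝔖, ⟨⟨h𝔖, Ideal.map_le_iff_le_comap.mpr h𝔖t.ge⟩, ?_⟩, h𝔖R⟩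
    -- `𝔖` is minimal over `t`: its dimension is at least `r`, by the dimension of the image of the
    -- member, and a smaller prime would exceed the bound `dS`.
    rintro 𝔖' ⟨h𝔖', htle⟩ hle'
    by_contra hnle
    have h1 : tr k (S ⧸ 𝔖) + 1 ≤ tr k (S ⧸ 𝔖') := by
      refine tr_add_one_le_of_surjective (Ideal.Quotient.factorₐ k hle')
        (Ideal.Quotient.factor_surjective hle') fun hinj ↦ hnle fun x hx ↦ ?_
      refine Ideal.Quotient.eq_zero_iff_mem.mp (hinj ?_)
      rw [map_zero]
      exact Ideal.Quotient.eq_zero_iff_mem.mpr hx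
    have h𝔖't : 𝔖'.comap (algebraMap D S) = t :=
      (ht.eq_of_le (Ideal.comap_ne_top _ h𝔖'.ne_top) (Ideal.map_le_iff_le_comap.mp htle)).symm
    have h2 := hNS.tr_quotient_le (k := k) 𝔖' (fun h ↦ hbt (h𝔖't ▸ h))
    have := isAlgebraic_quotient (k := k) t
    rw [h𝔖't, tr_eq_zero_of_isAlgebraic (E := D ⧸ t), zero_add] at h2
    have h3 : r ≤ tr k (S ⧸ 𝔖) := by
      refine hQr.trans ?_
      change tr k (R ⧸ Q.comap ρ) ≤ _
      rw [← h𝔖R]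
      exact tr_le_of_injective (Ideal.quotientMapₐ 𝔖 ρS le_rfl) Ideal.quotientMap_injective
    have h4 : (r : ℕ∞) + 1 ≤ r := (add_le_add_left h3 1).trans (h1.trans (h2.trans hdS))
    norm_cast at h4
    omega

end

/-! ### Residue fields of points of complex schemes. -/

section ResidueFields

variable {Z T : Scheme.{0}}

/-- The residue field of a point of a `ℂ`-scheme, as a `ℂ`-algebra. -/
def Res (_ : Z ⟶ SpecC) (x : Z) : Type := Z.residueField x

instance (s : Z ⟶ SpecC) (x : Z) : Field (Res s x) := inferInstanceAs (Field (Z.residueField x))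

instance (s : Z ⟶ SpecC) (x : Z) : Algebra ℂ (Res s x) :=
  (Spec.preimage (Z.fromSpecResidueField x ≫ s)).hom.toAlgebra

lemma algebraMap_res (s : Z ⟶ SpecC) (x : Z) :
    Spec.map (CommRingCat.ofHom (algebraMap ℂ (Res s x))) = Z.fromSpecResidueField x ≫ s :=
  Spec.map_preimage (Z.fromSpecResidueField x ≫ s)

/-- The homomorphism of residue fields given by a morphism of `ℂ`-schemes. -/
def resMap (s : Z ⟶ SpecC) (t : T ⟶ SpecC) (f : Z ⟶ T) (h : f ≫ t = s) (z : Z) :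
    Res t (f z) →ₐ[ℂ] Res s z :=
  { (f.residueFieldMap z).hom with
    commutes' := fun c ↦ by
      have h1 : Spec.preimage (T.fromSpecResidueField (f z) ≫ t) ≫ f.residueFieldMap z =
          Spec.preimage (Z.fromSpecResidueField z ≫ s) := by
        apply Spec.map_injective
        rw [Spec.map_comp, Spec.map_preimage, Spec.map_preimage,
          Scheme.Hom.SpecMap_residueFieldMap_fromSpecResidueField_assoc, h]
      exact congrArg (fun g ↦ g.hom c) h1 }

lemma Spec_map_resMap (s : Z ⟶ SpecC) (t : T ⟶ SpecC) (f : Z ⟶ T) (h : f ≫ t = s) (z : Z) :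
    Spec.map (CommRingCat.ofHom (resMap s t f h z).toRingHom) ≫ T.fromSpecResidueField (f z) =
      Z.fromSpecResidueField z ≫ f :=
  Scheme.Hom.SpecMap_residueFieldMap_fromSpecResidueField f z

lemma tr_res_le (s : Z ⟶ SpecC) (t : T ⟶ SpecC) (f : Z ⟶ T) (h : f ≫ t = s) (z : Z) :
    tr ℂ (Res t (f z)) ≤ tr ℂ (Res s z) :=
  tr_le_of_injective (resMap s t f h z) (resMap s t f h z).toRingHom.injective

/-- The point of the spectrum of a field. -/
def fieldPt (K : Type) [Field K] : Spec (.of K) := IsLocalRing.closedPoint K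

/-- The prime ideal of a point of an affine scheme. -/
def ideal {R : CommRingCat.{0}} (p : Spec R) : Ideal R := PrimeSpectrum.asIdeal p

instance {R : CommRingCat.{0}} (p : Spec R) : (ideal p).IsPrime := PrimeSpectrum.isPrime p

lemma ideal_injective {R : CommRingCat.{0}} : Function.Injective (ideal (R := R)) :=
  fun _ _ h ↦ PrimeSpectrum.ext h

lemma ideal_map_fieldPt {R : CommRingCat.{0}} {K : Type} [Field K] (e : R ⟶ .of K) :
    ideal (Spec.map e (fieldPt K)) = RingHom.ker e.hom := by
  change Ideal.comap _ (IsLocalRing.maximalIdeal K) = _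
  rw [IsLocalRing.maximalIdeal_eq_bot]
  rfl

/-- A morphism from the spectrum of a field factors through the residue field of its image. -/
lemma exists_hom_of_field {K : Type} [Field K] (g : Spec (.of K) ⟶ Z) :
    ∃ (x : Z) (h : Z.residueField x ⟶ .of K), Spec.map h ≫ Z.fromSpecResidueField x = g ∧
      x = g (fieldPt K) :=
  ⟨_, _, Scheme.descResidueField_stalkClosedPointTo_fromSpecResidueField K Z g, rfl⟩

end ResidueFields

/-! ### Affine charts and evaluation at points. -/

section Charts

variable {Z : Scheme.{0}} (s : Z ⟶ SpecC) {R : CommRingCat.{0}} (ι : Spec R ⟶ Z)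

/-- The `ℂ`-algebra structure on the coordinate ring of an affine chart. -/
abbrev chartAlgebra : Algebra ℂ R := (Spec.preimage (ι ≫ s)).hom.toAlgebra

lemma chartAlgebra_algebraMap :
    let _ := chartAlgebra s ι
    Spec.map (CommRingCat.ofHom (algebraMap ℂ R)) = ι ≫ s :=
  Spec.map_preimage (ι ≫ s)

lemma chartAlgebra_finiteType [LocallyOfFiniteType s] [IsOpenImmersion ι] :
    let _ := chartAlgebra s ι
    Algebra.FiniteType ℂ R := by
  have h : LocallyOfFiniteType (Spec.map (Spec.preimage (ι ≫ s))) := by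
    rw [Spec.map_preimage]
    infer_instance
  exact (HasRingHomProperty.Spec_iff (P := @LocallyOfFiniteType)).mp h

variable [IsOpenImmersion ι]

lemma exists_eval {x : Z} (hx : x ∈ Set.range ι) :
    ∃ e : R ⟶ Z.residueField x, Spec.map e ≫ ι = Z.fromSpecResidueField x := by
  have h : Set.range (Z.fromSpecResidueField x) ⊆ Set.range ι := by
    rw [Scheme.range_fromSpecResidueField, Set.singleton_subset_iff]
    exact hx
  refine ⟨Spec.preimage (IsOpenImmersion.lift ι (Z.fromSpecResidueField x) h), ?_⟩
  rw [Spec.map_preimage]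
  exact IsOpenImmersion.lift_fac _ _ _

/-- Evaluation of functions at a point of an affine chart. -/
def eval {x : Z} (hx : x ∈ Set.range ι) :
    let _ := chartAlgebra s ι
    R →ₐ[ℂ] Res s x :=
  let _ := chartAlgebra s ι
  { (exists_eval ι hx).choose.hom with
    commutes' := fun c ↦ by
      have h1 : Spec.preimage (ι ≫ s) ≫ (exists_eval ι hx).choose =
          Spec.preimage (Z.fromSpecResidueField x ≫ s) := by
        apply Spec.map_injective
        rw [Spec.map_comp, Spec.map_preimage, Spec.map_preimage, ← Category.assoc,
          (exists_eval ι hx).choose_spec]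
      exact congrArg (fun g ↦ g.hom c) h1 }

lemma Spec_map_eval {x : Z} (hx : x ∈ Set.range ι) :
    let _ := chartAlgebra s ι
    Spec.map (CommRingCat.ofHom (eval s ι hx).toRingHom) ≫ ι = Z.fromSpecResidueField x :=
  (exists_eval ι hx).choose_spec

lemma ker_eval {x : Z} (hx : x ∈ Set.range ι) {p : Spec R} (hp : ι p = x) :
    let _ := chartAlgebra s ι
    RingHom.ker (eval s ι hx) = ideal p := by
  intro _
  have h1 : ι (Spec.map (CommRingCat.ofHom (eval s ι hx).toRingHom) (fieldPt (Res s x))) = x :=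
    (congrArg (fun g : Spec (.of (Res s x)) ⟶ Z ↦
      g (fieldPt (Res s x))) (Spec_map_eval s ι hx)).trans
      (Scheme.fromSpecResidueField_apply _ _)
  have h2 := ι.isOpenEmbedding.injective (h1.trans hp.symm)
  rw [← h2, ideal_map_fieldPt]
  rfl

/-- The residue field at `p` is the fraction field of `R ⧸ ideal p`. -/
lemma exists_eval_mul_eq {x : Z} (hx : x ∈ Set.range ι) (u : Res s x) :
    let _ := chartAlgebra s ι
    ∃ a b : R, eval s ι hx b ≠ 0 ∧ eval s ι hx b * u = eval s ι hx a := by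
  intro _
  obtain ⟨p, rfl⟩ := hx
  let e : R ⟶ .of (ideal p).ResidueField := CommRingCat.ofHom (algebraMap R (ideal p).ResidueField)
  obtain ⟨x, h, hh, hx⟩ := exists_hom_of_field (Spec.map e ≫ ι)
  have hxp : x = ι p := by
    rw [hx, Scheme.Hom.comp_apply]
    congr 1
    apply ideal_injective
    rw [ideal_map_fieldPt]
    exact Ideal.ker_algebraMap_residueField _
  subst hxp
  let v := eval s ι ⟨p, rfl⟩
  have hcomp : (exists_eval ι ⟨p, rfl⟩).choose ≫ h = e := by
    apply Spec.map_injective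
    rw [← cancel_mono ι, Spec.map_comp, Category.assoc, (exists_eval ι ⟨p, rfl⟩).choose_spec, hh]
  let g : Res s (ι p) →+* (ideal p).ResidueField := h.hom
  have hc : ∀ a : R, g (v a) = algebraMap R (ideal p).ResidueField a := fun a ↦
    congrArg (fun g ↦ g.hom a) hcomp
  clear_value g
  obtain ⟨a, b, hb, hab⟩ := IsFractionRing.div_surjective (A := R ⧸ ideal p) (g u)
  obtain ⟨a, rfl⟩ := Ideal.Quotient.mk_surjective a
  obtain ⟨b, rfl⟩ := Ideal.Quotient.mk_surjective b
  have hq : ∀ a : R, algebraMap (R ⧸ ideal p) (ideal p).ResidueField (Ideal.Quotient.mk _ a) =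
      g (v a) := fun a ↦ (hc a).symm
  have hb0 : g (v b) ≠ 0 := by
    rw [← hq]
    exact fun h0 ↦ nonZeroDivisors.ne_zero hb
      ((injective_iff_map_eq_zero _).mp (IsFractionRing.injective _ _) _ h0)
  refine ⟨a, b, fun h0 ↦ hb0 ?_, ?_⟩
  · exact (congrArg g h0).trans (map_zero g)
  · apply g.injective
    refine (map_mul g _ _).trans ?_
    rw [← hab, hq, hq]
    exact mul_div_cancel₀ _ hb0

lemma tr_res_eq (p : Spec R) :
    let _ := chartAlgebra s ι
    tr ℂ (Res s (ι p)) = tr ℂ (R ⧸ ideal p) := by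
  intro _
  have hker := ker_eval s ι ⟨p, rfl⟩ (rfl : ι p = ι p)
  let f : R ⧸ ideal p →ₐ[ℂ] Res s (ι p) := Ideal.Quotient.liftₐ _ (eval s ι ⟨p, rfl⟩)
    fun a ha ↦ RingHom.mem_ker.mp (hker ▸ ha)
  have hf : Function.Injective f := RingHom.lift_injective_of_ker_le_ideal _ _ hker.le
  refine tr_eq_of_isAlgebraic f hf fun u ↦ ?_
  obtain ⟨a, b, hb, hab⟩ := exists_eval_mul_eq s ι ⟨p, rfl⟩ u
  refine ⟨Ideal.Quotient.mk _ b, fun h0 ↦ hb ?_, Ideal.Quotient.mk _ a, hab.symm⟩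
  exact (congrArg f h0).trans (map_zero f)

end Charts

/-! ### Specialization and transcendence degree. -/

section Specialization

variable {Z : Scheme.{0}} (s : Z ⟶ SpecC)

lemma exists_chart {x : Z} {U : Set Z} (hU : IsOpen U) (hx : x ∈ U) :
    ∃ (R : CommRingCat.{0}) (ι : Spec R ⟶ Z), IsOpenImmersion ι ∧ x ∈ Set.range ι ∧ Set.range ι ⊆ U :=
  Scheme.exists_affine_mem_range_and_range_subset (U := ⟨U, hU⟩) hx

lemma specializes_iff_le {R : CommRingCat.{0}} (ι : Spec R ⟶ Z) [IsOpenImmersion ι] (p q : Spec R) :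
    ι p ⤳ ι q ↔ ideal p ≤ ideal q := by
  exact ι.isOpenEmbedding.isInducing.specializes_iff.trans
    (PrimeSpectrum.le_iff_specializes (p : PrimeSpectrum R) q).symm

lemma tr_res_ne_top [LocallyOfFiniteType s] (x : Z) : tr ℂ (Res s x) ≠ ⊤ := by
  obtain ⟨R, ι, _, ⟨p, rfl⟩, -⟩ := exists_chart isOpen_univ (Set.mem_univ x)
  let _ := chartAlgebra s ι
  have : Algebra.FiniteType ℂ R := chartAlgebra_finiteType s ι
  rw [tr_res_eq]
  exact tr_ne_top_of_finiteType

/-- In a chart around `y`, a proper specialization becomes a surjection of domains that is not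
injective. -/
lemma tr_res_add_one_le {x y : Z} (h : x ⤳ y) (hne : x ≠ y) :
    tr ℂ (Res s y) + 1 ≤ tr ℂ (Res s x) := by
  obtain ⟨R, ι, _, hy, -⟩ := exists_chart isOpen_univ (Set.mem_univ y)
  obtain ⟨q, rfl⟩ := hy
  obtain ⟨p, rfl⟩ := h.mem_open ι.isOpenEmbedding.isOpen_range ⟨q, rfl⟩
  let _ := chartAlgebra s ι
  rw [tr_res_eq, tr_res_eq]
  rw [specializes_iff_le] at h
  refine tr_add_one_le_of_surjective (Ideal.Quotient.factorₐ ℂ h)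
    (Ideal.Quotient.factor_surjective h) fun hinj ↦ hne ?_
  congr 1
  refine ideal_injective (le_antisymm h fun a ha ↦ ?_)
  refine Ideal.Quotient.eq_zero_iff_mem.mp (hinj ?_)
  rw [map_zero]
  exact Ideal.Quotient.eq_zero_iff_mem.mpr ha

lemma tr_res_le_of_specializes {x y : Z} (h : x ⤳ y) : tr ℂ (Res s y) ≤ tr ℂ (Res s x) := by
  by_cases hne : x = y
  · rw [hne]
  · exact le_self_add.trans (tr_res_add_one_le s h hne)

lemma eq_of_specializes_of_tr_le [LocallyOfFiniteType s] {x y : Z} (h : x ⤳ y)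
    (hle : tr ℂ (Res s x) ≤ tr ℂ (Res s y)) : x = y := by
  by_contra hne
  have h1 := (tr_res_add_one_le s h hne).trans hle
  exact absurd ((ENat.add_one_le_iff (tr_res_ne_top s y)).mp h1) (lt_irrefl _)

end Specialization

/-! ### Krull dimension and transcendence degree. -/

section Dimension

/-- Chains of primes lift along the integral extension by going up. -/
lemma ringKrullDim_le_of_isIntegral {A D : Type*} [CommRing A] [IsDomain A] [CommRing D]
    [IsDomain D] [Algebra A D] [Algebra.IsIntegral A D]
    (h : Function.Injective (algebraMap A D)) : ringKrullDim A ≤ ringKrullDim D := by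
  refine iSup_le fun l ↦ ?_
  let l' : LTSeries (PrimeSpectrum A) := l
  obtain ⟨Q, hQ, hQl⟩ := Ideal.exists_ideal_over_prime_of_isIntegral_of_isDomain
    (S := D) l'.head.asIdeal ((RingHom.injective_iff_ker_eq_bot _).mp h ▸ bot_le)
  have : Q.LiesOver l'.head.asIdeal := ⟨hQl.symm⟩
  obtain ⟨L, hL, -⟩ := Ideal.exists_ltSeries_of_hasGoingUp l' Q
  exact le_iSup_of_le L (by rw [hL])

lemma tr_le_ringKrullDim {k D : Type*} [Field k] [CommRing D] [IsDomain D] [Algebra k D]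
    [Algebra.FiniteType k D] : ((tr k D : ℕ∞) : WithBot ℕ∞) ≤ ringKrullDim D := by
  obtain ⟨m, g, hg, hgi⟩ := exists_integral_inj_algHom_of_fg k D
  have h1 : tr k D = m := by
    have h2 : tr k D = tr k (MvPolynomial (Fin m) k) := by
      rw [← rk_univ, ← rk_range g hg]
      refine rk_eq_of_isAlgebraic (Set.subset_univ _) fun t _ ↦ ?_
      have hr : Algebra.adjoin k (Set.range g) = g.range := by
        rw [show Set.range g = (g.range : Set D) from rfl, Algebra.adjoin_eq]
      rw [hr]
      obtain ⟨p, hp, h0⟩ := hgi t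
      refine IsIntegral.isAlgebraic ⟨p.map g.rangeRestrict.toRingHom, hp.map _, ?_⟩
      rw [Polynomial.eval₂_map]
      exact h0
    rw [h2, tr_mvPolynomial, tr_eq_zero_of_isAlgebraic, zero_add]
  let _ : Algebra (MvPolynomial (Fin m) k) D := g.toRingHom.toAlgebra
  have : Algebra.IsIntegral (MvPolynomial (Fin m) k) D := ⟨hgi⟩
  have h2 : ringKrullDim (MvPolynomial (Fin m) k) = m := by
    rw [MvPolynomial.ringKrullDim_of_isNoetherianRing, ringKrullDim_eq_zero_of_field]
    simp
  rw [h1]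
  refine h2.symm.le.trans ?_
  exact ringKrullDim_le_of_isIntegral hg

end Dimension

section Dimension

open TopologicalSpace

/-- An irreducible closed subset of the image is dominated by one of the finitely many irreducible
components of its preimage. -/
lemma quasiSober_range {Z T : Type*} [TopologicalSpace Z] [TopologicalSpace T]
    [NoetherianSpace Z] [QuasiSober Z] {f : Z → T} (hf : Continuous f) :
    QuasiSober (Set.range f) := by
  refine ⟨fun {C} hC hcl ↦ ?_⟩
  let g : Z → Set.range f := Set.rangeFactorization f
  have hg : Continuous g := hf.subtype_mk _
  obtain ⟨S, hS, hS1, hS2, hSU⟩ := NoetherianSpace.exists_finite_set_isClosed_irreducible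
    (hcl.preimage hg)
  have h1 : C ⊆ ⋃₀ ((fun K ↦ closure (g '' K)) '' S) := by
    intro c hc
    obtain ⟨z, rfl⟩ := Set.rangeFactorization_surjective c
    have hz : z ∈ g ⁻¹' C := hc
    rw [hSU] at hz
    obtain ⟨K, hK, hzK⟩ := hz
    exact ⟨_, ⟨K, hK, rfl⟩, subset_closure ⟨z, hzK, rfl⟩⟩
  obtain ⟨F, hF, hCF⟩ := (isIrreducible_iff_sUnion_isClosed.mp hC)
    (hS.image (fun K ↦ closure (g '' K))).toFinset (by simp) (by simpa using h1)
  rw [Set.Finite.mem_toFinset] at hF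
  obtain ⟨K, hK, rfl⟩ := hF
  refine ⟨g (hS2 K hK).genericPoint, ?_⟩
  have h2 : K ⊆ g ⁻¹' C := by
    rw [hSU]
    exact Set.subset_sUnion_of_mem hK
  have h3 : closure (g '' K) = closure {g (hS2 K hK).genericPoint} := by
    have h4 := (hS2 K hK).isGenericPoint_genericPoint_closure
    rw [(hS1 K hK).closure_eq] at h4
    exact (h4.image hg).symm
  refine subset_antisymm (h3 ▸ closure_minimal (Set.image_subset_iff.mpr h2) hcl) (h3 ▸ hCF)

lemma krullDim_fin_le (n : ℕ) : Order.krullDim (Fin (n + 1)) ≤ n := by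
  refine iSup_le fun l ↦ ?_
  have := LTSeries.length_lt_card l
  rw [Fintype.card_fin] at this
  exact_mod_cast Nat.lt_succ_iff.mp this

/-- Along a chain of irreducible closed subsets the degrees of the generic points increase strictly;
quasi-sobriety keeps these points in `S`. -/
lemma topologicalKrullDim_le {Z : Scheme.{0}} (s : Z ⟶ SpecC) (S : Set Z) [QuasiSober S] (n : ℕ)
    (h : ∀ z ∈ S, tr ℂ (Res s z) ≤ n) : topologicalKrullDim S ≤ n := by
  let g (C : IrreducibleCloseds S) : Z := (C.isIrreducible.genericPoint : S)
  have hg (C : IrreducibleCloseds S) : tr ℂ (Res s (g C)) ≤ n := h _ (Subtype.prop _)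
  let t (C : IrreducibleCloseds S) : Fin (n + 1) :=
    ⟨(tr ℂ (Res s (g C))).toNat, Nat.lt_succ_of_le (ENat.toNat_le_of_le_natCast (hg C))⟩
  refine (Order.krullDim_le_of_strictMono t fun C C' hlt ↦ ?_).trans (krullDim_fin_le n)
  have hcl (C : IrreducibleCloseds S) :
      closure {(C.isIrreducible.genericPoint : S)} = (C : Set S) := by
    rw [C.isIrreducible.genericPoint_closure_eq, C.isClosed.closure_eq]
  have h1 : g C' ⤳ g C := by
    refine Topology.IsInducing.subtypeVal.specializes_iff.mpr (specializes_iff_mem_closure.mpr ?_)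
    rw [hcl]
    exact hlt.le ((hcl C).le (subset_closure rfl))
  have h2 : g C' ≠ g C := by
    intro h
    refine hlt.ne (SetLike.coe_injective ?_)
    rw [← hcl, ← hcl C', Subtype.ext h]
  have h3 := tr_res_add_one_le s h1 h2
  lift tr ℂ (Res s (g C')) to ℕ using ne_top_of_le_ne_top (ENat.natCast_ne_top n) (hg C') with a ha
  lift tr ℂ (Res s (g C)) to ℕ using ne_top_of_le_ne_top (ENat.natCast_ne_top n) (hg C) with b hb
  simp only [t, Fin.mk_lt_mk, ← ha, ← hb, ENat.toNat_natCast]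
  exact_mod_cast h3

/-- An affine piece of the closure of `z` already has this dimension. Only a neighborhood of `z` in
its closure is asked to lie in `S`, so that the bound applies to images of morphisms. -/
lemma tr_res_le_topologicalKrullDim {Z : Scheme.{0}} (s : Z ⟶ SpecC) [LocallyOfFiniteType s]
    {z : Z} {U S : Set Z} (hU : IsOpen U) (hz : z ∈ U) (hS : U ∩ closure {z} ⊆ S) :
    ((tr ℂ (Res s z) : ℕ∞) : WithBot ℕ∞) ≤ topologicalKrullDim S := by
  obtain ⟨R, ι, _, ⟨p, rfl⟩, hι⟩ := exists_chart hU hz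
  let _ := chartAlgebra s ι
  have : Algebra.FiniteType ℂ R := chartAlgebra_finiteType s ι
  rw [tr_res_eq]
  have : Algebra.FiniteType ℂ (R ⧸ ideal p) := inferInstance
  refine tr_le_ringKrullDim.trans ?_
  rw [← PrimeSpectrum.topologicalKrullDim_eq_ringKrullDim]
  let e : PrimeSpectrum (R ⧸ ideal p) → PrimeSpectrum R :=
    PrimeSpectrum.comap (Ideal.Quotient.mk (ideal p))
  have he : Topology.IsInducing e :=
    (PrimeSpectrum.isClosedEmbedding_comap_of_surjective _ _ Ideal.Quotient.mk_surjective).isInducing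
  have hmem (q) : ι (e q) ∈ S := by
    refine hS ⟨hι ⟨_, rfl⟩, ?_⟩
    refine specializes_iff_mem_closure.mp ((specializes_iff_le ι p (e q)).mpr fun a ha ↦ ?_)
    change Ideal.Quotient.mk (ideal p) a ∈ q.asIdeal
    rw [Ideal.Quotient.eq_zero_iff_mem.mpr ha]
    exact zero_mem _
  have h1 : Topology.IsInducing fun q ↦ (⟨ι (e q), hmem q⟩ : S) := by
    refine Topology.IsInducing.of_comp (g := Subtype.val) ?_ continuous_subtype_val ?_
    · exact ((ι.isOpenEmbedding.isInducing.comp he).continuous).subtype_mk _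
    · exact ι.isOpenEmbedding.isInducing.comp he
  exact h1.topologicalKrullDim_le

end Dimension

/-! ### Finite type and noetherian conditions. -/

section FiniteType

attribute [local instance] MvPolynomial.gradedAlgebra

lemma surjective_algebraMap_zero (N : ℕ) : Function.Surjective
    (algebraMap ℂ (MvPolynomial.homogeneousSubmodule (Fin (N + 1)) ℂ 0)) := by
  rintro ⟨p, hp⟩
  rw [MvPolynomial.homogeneousSubmodule_zero] at hp
  obtain ⟨c, hc⟩ := Submodule.mem_one.mp hp
  exact ⟨c, Subtype.ext hc⟩

lemma finiteType_projSpace (N : ℕ) : LocallyOfFiniteType (ProjSpace.toSpecC N) ∧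
    QuasiCompact (ProjSpace.toSpecC N) := by
  have : Algebra.FiniteType (MvPolynomial.homogeneousSubmodule (Fin (N + 1)) ℂ 0)
      (MvPolynomial (Fin (N + 1)) ℂ) := by
    have : IsScalarTower ℂ (MvPolynomial.homogeneousSubmodule (Fin (N + 1)) ℂ 0)
      (MvPolynomial (Fin (N + 1)) ℂ) :=
      ⟨fun a b c ↦ smul_mul_assoc a (b : MvPolynomial (Fin (N + 1)) ℂ) c⟩
    exact Algebra.FiniteType.of_restrictScalars_finiteType ℂ _ _
  have h : LocallyOfFiniteType (Spec.map (CommRingCat.ofHom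
      (algebraMap ℂ (MvPolynomial.homogeneousSubmodule (Fin (N + 1)) ℂ 0)))) := by
    rw [HasRingHomProperty.Spec_iff (P := @LocallyOfFiniteType)]
    exact RingHom.FiniteType.of_surjective _ (surjective_algebraMap_zero N)
  constructor
  · have : LocallyOfFiniteType (Proj.toSpecZero (MvPolynomial.homogeneousSubmodule (Fin (N + 1)) ℂ)) :=
      inferInstance
    exact MorphismProperty.comp_mem @LocallyOfFiniteType _ _ this h
  · have : QuasiCompact (Proj.toSpecZero (MvPolynomial.homogeneousSubmodule (Fin (N + 1)) ℂ)) :=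
      inferInstance
    exact MorphismProperty.comp_mem @QuasiCompact _ _ this inferInstance

lemma isNoetherian {Z : Scheme.{0}} (s : Z ⟶ SpecC) [LocallyOfFiniteType s] [QuasiCompact s] :
    IsNoetherian Z := by
  have := LocallyOfFiniteType.isLocallyNoetherian s
  have : CompactSpace Z := QuasiCompact.compactSpace_of_compactSpace s
  exact { }

lemma finiteType_of_isImmersion {Y Z : Scheme.{0}} (f : Y ⟶ Z) [IsImmersion f] (s : Z ⟶ SpecC)
    [LocallyOfFiniteType s] [QuasiCompact s] :
    LocallyOfFiniteType (f ≫ s) ∧ QuasiCompact (f ≫ s) := by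
  have := isNoetherian s
  have := f.isEmbedding.isInducing.noetherianSpace
  exact ⟨inferInstance, inferInstance⟩

lemma IsProjectiveEmbedding.finiteType {Y : Scheme.{0}} {sY : Y ⟶ SpecC} {N : ℕ}
    {j : Y ⟶ ProjSpace N} (hj : IsProjectiveEmbedding sY j) :
    LocallyOfFiniteType sY ∧ QuasiCompact sY := by
  have := hj.isImmersion
  obtain ⟨_, _⟩ := finiteType_projSpace N
  rw [← hj.comp_eq]
  exact finiteType_of_isImmersion j _

/-! ### Fiber powers as iterated fiber products. -/

section FiberPower

variable {X S Z : Scheme.{0}} {f : X ⟶ S} {n : ℕ}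

/-- The projections of a fiber power. -/
abbrev fpπ (f : X ⟶ S) (n : ℕ) (k : Fin n) : fiberPower f n ⟶ X :=
  WidePullback.π (fun _ : Fin n ↦ f) k

/-- The projection of a fiber power to the base. -/
abbrev fpBase (f : X ⟶ S) (n : ℕ) : fiberPower f n ⟶ S :=
  WidePullback.base (fun _ : Fin n ↦ f)

/-- The morphism to a fiber power given by its components. -/
abbrev fpLift (b : Z ⟶ S) (g : Fin n → (Z ⟶ X)) (h : ∀ k, g k ≫ f = b) : Z ⟶ fiberPower f n :=
  WidePullback.lift b g h

lemma fpLift_π (b : Z ⟶ S) (g : Fin n → (Z ⟶ X)) (h : ∀ k, g k ≫ f = b) (k : Fin n) :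
    fpLift b g h ≫ fpπ f n k = g k :=
  WidePullback.lift_π _ _ _ _ _

lemma fpLift_base (b : Z ⟶ S) (g : Fin n → (Z ⟶ X)) (h : ∀ k, g k ≫ f = b) :
    fpLift b g h ≫ fpBase f n = b :=
  WidePullback.lift_base _ _ _ _

lemma fpπ_comp (k : Fin n) : fpπ f n k ≫ f = fpBase f n :=
  WidePullback.π_arrow (fun _ : Fin n ↦ f) k

lemma fp_hom_ext {g h : Z ⟶ fiberPower f n} (hb : g ≫ fpBase f n = h ≫ fpBase f n)
    (hk : ∀ k, g ≫ fpπ f n k = h ≫ fpπ f n k) : g = h :=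
  WidePullback.hom_ext _ _ _ hk hb

/-- The projection that omits the first factor. -/
abbrev fpTail (f : X ⟶ S) (n : ℕ) : fiberPower f (n + 1) ⟶ fiberPower f n :=
  fpLift (fpBase f (n + 1)) (fun k ↦ fpπ f (n + 1) k.succ) (fun k ↦ fpπ_comp k.succ)

/-- Presents the fiber power as an iterated fiber product, for induction on `n`. -/
lemma isPullback_fpTail (f : X ⟶ S) (n : ℕ) :
    IsPullback (fpTail f n) (fpπ f (n + 1) 0) (fpBase f n) f := by
  have hw : fpTail f n ≫ fpBase f n = fpπ f (n + 1) 0 ≫ f :=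
    (fpLift_base _ _ _).trans (fpπ_comp 0).symm
  let l (c : PullbackCone (fpBase f n) f) : c.pt ⟶ fiberPower f (n + 1) :=
    fpLift (c.snd ≫ f) (fun k ↦ Fin.cases c.snd (fun k ↦ c.fst ≫ fpπ f n k) k) (fun k ↦ by
      refine Fin.cases rfl (fun k ↦ ?_) k
      change (c.fst ≫ fpπ f n k) ≫ f = _
      rw [Category.assoc, fpπ_comp, c.condition])
  refine ⟨⟨hw⟩, ⟨PullbackCone.IsLimit.mk _ l ?_ ?_ ?_⟩⟩
  · intro c
    refine fp_hom_ext ?_ fun k ↦ ?_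
    · rw [Category.assoc, fpLift_base, fpLift_base, c.condition]
    · rw [Category.assoc, fpLift_π, fpLift_π]
      rfl
  · exact fun c ↦ fpLift_π _ _ _ _
  · intro c m h1 h2
    refine fp_hom_ext ?_ fun k ↦ ?_
    · rw [fpLift_base, ← h2, Category.assoc, fpπ_comp]
    · rw [fpLift_π]
      refine Fin.cases h2 (fun k ↦ ?_) k
      change _ = c.fst ≫ fpπ f n k
      rw [← h1, Category.assoc, fpLift_π]

end FiberPower

lemma finiteType_fpBase {X S : Scheme.{0}} (f : X ⟶ S) [LocallyOfFiniteType f] [QuasiCompact f]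
    (n : ℕ) : LocallyOfFiniteType (fpBase f n) ∧ QuasiCompact (fpBase f n) := by
  induction n with
  | zero =>
    have : IsIso (fpBase f 0) := by
      refine ⟨fpLift (𝟙 S) (fun k ↦ k.elim0) (fun k ↦ k.elim0), ?_, fpLift_base _ _ _⟩
      refine fp_hom_ext ?_ (fun k ↦ k.elim0)
      rw [Category.assoc, fpLift_base, Category.comp_id, Category.id_comp]
    exact ⟨inferInstance, inferInstance⟩
  | succ n ih =>
    obtain ⟨h1, h2⟩ := ih
    have h3 : LocallyOfFiniteType (fpπ f (n + 1) 0) :=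
      MorphismProperty.of_isPullback (isPullback_fpTail f n) h1
    have h4 : QuasiCompact (fpπ f (n + 1) 0) :=
      MorphismProperty.of_isPullback (isPullback_fpTail f n) h2
    rw [← fpπ_comp (f := f) (n := n + 1) 0]
    exact ⟨inferInstance, inferInstance⟩

end FiniteType

/-! ### Field-valued points. -/

section FieldPoints

variable {Z T : Scheme.{0}} (s : Z ⟶ SpecC) (t : T ⟶ SpecC)

/-- The inclusion of a point of a `ℂ`-scheme. -/
def res (x : Z) : Spec (.of (Res s x)) ⟶ Z := Z.fromSpecResidueField x

instance (x : Z) : Mono (res s x) := inferInstanceAs (Mono (Z.fromSpecResidueField x))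

lemma res_apply (x : Z) (p : Spec (.of (Res s x))) : res s x p = x :=
  Scheme.fromSpecResidueField_apply _ _

lemma res_comp (x : Z) :
    res s x ≫ s = Spec.map (CommRingCat.ofHom (algebraMap ℂ (Res s x))) :=
  (algebraMap_res s x).symm

lemma Spec_map_resMap_res (f : Z ⟶ T) (h : f ≫ t = s) (z : Z) :
    Spec.map (CommRingCat.ofHom (resMap s t f h z).toRingHom) ≫ res t (f z) = res s z ≫ f :=
  Spec_map_resMap s t f h z

lemma exists_res_factor {K : Type} [Field K] (g : Spec (.of K) ⟶ Z) :
    ∃ (x : Z) (h : Res s x →+* K), Spec.map (CommRingCat.ofHom h) ≫ res s x = g ∧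
      x = g (fieldPt K) := by
  obtain ⟨x, h, h1, h2⟩ := exists_hom_of_field g
  exact ⟨x, h.hom, h1, h2⟩

lemma eq_fieldPt {K : Type} [Field K] (p : Spec (.of K)) : p = fieldPt K :=
  Subsingleton.elim (α := PrimeSpectrum K) _ _

lemma ofHom_injective_of_spec {A B : Type} [CommRing A] [CommRing B] {f g : A →+* B}
    (h : Spec.map (CommRingCat.ofHom f) = Spec.map (CommRingCat.ofHom g)) : f = g :=
  congrArg CommRingCat.Hom.hom (Spec.map_injective h)

/-- Both morphisms have the same image point, so they factor through one residue field, where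
injectivity of `φ` applies. -/
lemma eq_of_field_comp_eq (s : Z ⟶ SpecC) {L K : Type} [Field L] [Field K] (φ : L →+* K)
    {a b : Spec (.of L) ⟶ Z}
    (h : Spec.map (CommRingCat.ofHom φ) ≫ a = Spec.map (CommRingCat.ofHom φ) ≫ b) : a = b := by
  obtain ⟨x, u, hu, hx⟩ := exists_res_factor s a
  obtain ⟨y, v, hv, hy⟩ := exists_res_factor s b
  have hxy : x = y := by
    have h1 := congrArg (fun g ↦ g (fieldPt K)) h
    simp only [Scheme.Hom.comp_apply] at h1
    rw [eq_fieldPt (Spec.map (CommRingCat.ofHom φ) (fieldPt K)), ← hx, ← hy] at h1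
    exact h1
  subst hxy
  rw [← hu, ← hv]
  have h2 : φ.comp u = φ.comp v := by
    apply ofHom_injective_of_spec
    rw [CommRingCat.ofHom_comp, CommRingCat.ofHom_comp, Spec.map_comp, Spec.map_comp,
      ← cancel_mono (res s x), Category.assoc, Category.assoc, hu, hv, h]
  congr 3
  ext c
  exact φ.injective (congrArg (fun g ↦ g c) h2)

/-- An intermediate field through which a point factors is the whole residue field. -/
lemma eq_top_of_factor (z : Z) (L : IntermediateField ℂ (Res s z)) (g : Spec (.of L) ⟶ Z)
    (h : Spec.map (CommRingCat.ofHom (algebraMap L (Res s z))) ≫ g = res s z) : L = ⊤ := by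
  obtain ⟨x, u, hu, hx⟩ := exists_res_factor s g
  have hxz : x = z := by
    have h1 := congrArg (fun g ↦ g (fieldPt (Res s z))) h
    simp only [Scheme.Hom.comp_apply] at h1
    rw [eq_fieldPt (Spec.map _ (fieldPt (Res s z))), ← hx, res_apply] at h1
    exact h1
  subst hxz
  have h2 : (algebraMap L (Res s x)).comp u = RingHom.id _ := by
    apply ofHom_injective_of_spec
    rw [CommRingCat.ofHom_comp, Spec.map_comp, ← cancel_mono (res s x), Category.assoc, hu, h,
      CommRingCat.ofHom_id, Spec.map_id, Category.id_comp]
  refine eq_top_iff.mpr fun c _ ↦ ?_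
  have h3 : (u c : Res s x) = c := congrArg (fun g ↦ g c) h2
  rw [← h3]
  exact (u c).2

lemma exists_factor (f : Z ⟶ T) (h : f ≫ t = s) (z : Z) (L : IntermediateField ℂ (Res s z))
    (hL : Set.range (resMap s t f h z) ⊆ L) : ∃ g : Spec (.of L) ⟶ T,
      Spec.map (CommRingCat.ofHom (algebraMap L (Res s z))) ≫ g = res s z ≫ f := by
  let u : Res t (f z) →+* L := (resMap s t f h z).toRingHom.codRestrict L
    (fun c ↦ hL ⟨c, rfl⟩)
  refine ⟨Spec.map (CommRingCat.ofHom u) ≫ res t (f z), ?_⟩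
  rw [← Category.assoc, ← Spec.map_comp, ← CommRingCat.ofHom_comp, ← Spec_map_resMap_res s t f h]
  rfl

lemma rk_eq_tr_of_adjoin_eq_top {K : Type*} [Field K] [Algebra ℂ K] {S : Set K}
    (h : IntermediateField.adjoin ℂ S = ⊤) : rk ℂ S = tr ℂ K := by
  rw [← rk_univ]
  refine (rk_eq_of_isAlgebraic (Set.subset_univ _) fun c _ ↦ ?_).symm
  have hc : c ∈ IntermediateField.adjoin ℂ S := h ▸ IntermediateField.mem_top
  obtain ⟨a, ha, b, hb, rfl⟩ := IntermediateField.mem_adjoin_iff_div.mp hc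
  have ha' : IsAlgebraic (Algebra.adjoin ℂ S) a :=
    isAlgebraic_algebraMap (⟨a, ha⟩ : Algebra.adjoin ℂ S)
  have hb' : IsAlgebraic (Algebra.adjoin ℂ S) b :=
    isAlgebraic_algebraMap (⟨b, hb⟩ : Algebra.adjoin ℂ S)
  rw [div_eq_mul_inv]
  exact ha'.mul hb'.inv

end FieldPoints

/-! ### Generation of residue fields by those of the projections. -/

section Generation

variable {X S : Scheme.{0}} {f : X ⟶ S} {n : ℕ}

/-- The residue field of a point of a fiber power is generated by those of its images. -/
lemma rk_fiberPower (sX : X ⟶ SpecC) (sS : S ⟶ SpecC) (hf : f ≫ sS = sX)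
    (z : fiberPower f n) (W : Set (Res (fpBase f n ≫ sS) z))
    (hb : Set.range (resMap (fpBase f n ≫ sS) sS (fpBase f n) rfl z) ⊆ W)
    (hk : ∀ k, Set.range (resMap (fpBase f n ≫ sS) sX (fpπ f n k)
      (by rw [← hf, ← Category.assoc, fpπ_comp]) z) ⊆ W) :
    rk ℂ W = tr ℂ (Res (fpBase f n ≫ sS) z) := by
  apply rk_eq_tr_of_adjoin_eq_top
  let L := IntermediateField.adjoin ℂ W
  have hW : W ⊆ L := IntermediateField.subset_adjoin _ _
  obtain ⟨b, hb⟩ := exists_factor _ sS (fpBase f n) rfl z L (hb.trans hW)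
  choose g hg using fun k ↦ exists_factor _ sX (fpπ f n k)
    (by rw [← hf, ← Category.assoc, fpπ_comp]) z L ((hk k).trans hW)
  -- The components defined over `L` assemble to a factorization of the point through `L`.
  refine eq_top_of_factor _ z L (fpLift b g fun k ↦ ?_) ?_
  · apply eq_of_field_comp_eq sS (algebraMap L (Res (fpBase f n ≫ sS) z))
    rw [← Category.assoc, hg, hb, Category.assoc, fpπ_comp]
  · refine fp_hom_ext ?_ fun k ↦ ?_
    · rw [Category.assoc, fpLift_base, hb]
    · rw [Category.assoc, fpLift_π, hg]

lemma surjective_resMap {Z T : Scheme.{0}} (s : Z ⟶ SpecC) (t : T ⟶ SpecC) (f : Z ⟶ T)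
    (h : f ≫ t = s) [IsImmersion f] (z : Z) : Function.Surjective (resMap s t f h z) := by
  change Function.Surjective (f.residueFieldMap z).hom
  have h1 : Function.Surjective (f.stalkMap z).hom := f.stalkMap_surjective z
  intro c
  obtain ⟨c, rfl⟩ := Z.residue_surjective z c
  obtain ⟨d, rfl⟩ := h1 c
  refine ⟨T.residue _ d, ?_⟩
  exact congrArg (fun g : T.presheaf.stalk (f z) ⟶ Z.residueField z ↦ g.hom d)
    (Scheme.residue_residueFieldMap f z)

variable {V Y : Scheme.{0}} {sV : V ⟶ SpecC} {sY : Y ⟶ SpecC}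

/-- The residue field of a point of the family is generated by those of its images in the base
and in the ambient variety. -/
lemma rk_family (i : X ⟶ pullback sV sY) [IsImmersion i] (x : X)
    (W : Set (Res (toBase i ≫ sV) x))
    (hb : Set.range (resMap (toBase i ≫ sV) sV (toBase i) rfl x) ⊆ W)
    (ha : Set.range (resMap (toBase i ≫ sV) sY (toAmbient i) (toBase_comp i).symm x) ⊆ W) :
    rk ℂ W = tr ℂ (Res (toBase i ≫ sV) x) := by
  apply rk_eq_tr_of_adjoin_eq_top
  let L := IntermediateField.adjoin ℂ W
  have hW : W ⊆ L := IntermediateField.subset_adjoin _ _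
  obtain ⟨b, hb⟩ := exists_factor _ sV (toBase i) rfl x L (hb.trans hW)
  obtain ⟨a, ha⟩ := exists_factor _ sY (toAmbient i) (toBase_comp i).symm x L (ha.trans hW)
  have hab : b ≫ sV = a ≫ sY := by
    apply eq_of_field_comp_eq (𝟙 SpecC) (algebraMap L (Res (toBase i ≫ sV) x))
    rw [← Category.assoc, hb, ← Category.assoc, ha, Category.assoc, Category.assoc, toBase_comp]
  let g : Spec (.of L) ⟶ pullback sV sY := pullback.lift b a hab
  have hg : Spec.map (CommRingCat.ofHom (algebraMap L (Res (toBase i ≫ sV) x))) ≫ g =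
      res (toBase i ≫ sV) x ≫ i := by
    refine pullback.hom_ext ?_ ?_
    · rw [Category.assoc, pullback.lift_fst, hb, Category.assoc]
      rfl
    · rw [Category.assoc, pullback.lift_snd, ha, Category.assoc]
      rfl
  let sP : pullback sV sY ⟶ SpecC := pullback.fst sV sY ≫ sV
  have hi : i ≫ sP = toBase i ≫ sV := (Category.assoc _ _ _).symm
  obtain ⟨p, u, hu, hp⟩ := exists_res_factor sP g
  have hpx : p = i x := by
    have h1 := congrArg (fun g ↦ g (fieldPt (Res (toBase i ≫ sV) x))) hg
    simp only [Scheme.Hom.comp_apply] at h1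
    rw [eq_fieldPt (Spec.map _ (fieldPt (Res (toBase i ≫ sV) x))), ← hp, res_apply] at h1
    exact h1
  subst hpx
  have h2 : (algebraMap L (Res (toBase i ≫ sV) x)).comp u =
      (resMap (toBase i ≫ sV) sP i hi x).toRingHom := by
    apply ofHom_injective_of_spec
    rw [CommRingCat.ofHom_comp, Spec.map_comp, ← cancel_mono (res sP (i x)), Category.assoc, hu,
      hg, Spec_map_resMap_res]
  refine eq_top_iff.mpr fun c _ ↦ ?_
  obtain ⟨d, rfl⟩ := surjective_resMap (toBase i ≫ sV) sP i hi x c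
  have h3 : (u d : Res (toBase i ≫ sV) x) = resMap (toBase i ≫ sV) sP i hi x d :=
    congrArg (fun g ↦ g d) h2
  rw [← h3]
  exact (u d).2

end Generation

/-! ### Coordinate rings of charts, and maps between them. -/

section Coord

variable {Z T : Scheme.{0}} (s : Z ⟶ SpecC) (t : T ⟶ SpecC) {R R' : CommRingCat.{0}}
  (ι : Spec R ⟶ Z) (κ : Spec R' ⟶ T)

/-- The coordinate ring of an affine chart, as a `ℂ`-algebra. -/
def Coord (_ : Z ⟶ SpecC) {R : CommRingCat.{0}} (_ : Spec R ⟶ Z) : Type := R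

instance : CommRing (Coord s ι) := inferInstanceAs (CommRing R)

instance : Algebra ℂ (Coord s ι) := chartAlgebra s ι

instance [LocallyOfFiniteType s] [IsOpenImmersion ι] : Algebra.FiniteType ℂ (Coord s ι) :=
  chartAlgebra_finiteType s ι

/-- The inclusion of an affine chart. -/
def chart : Spec (.of (Coord s ι)) ⟶ Z := ι

instance [IsOpenImmersion ι] : IsOpenImmersion (chart s ι) := inferInstanceAs (IsOpenImmersion ι)

lemma chart_comp :
    chart s ι ≫ s = Spec.map (CommRingCat.ofHom (algebraMap ℂ (Coord s ι))) :=
  (chartAlgebra_algebraMap s ι).symm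

/-- The point of an affine chart given by a prime ideal. -/
def pt (p : PrimeSpectrum (Coord s ι)) : Z := ι p

lemma pt_mem (p : PrimeSpectrum (Coord s ι)) : pt s ι p ∈ Set.range ι := ⟨p, rfl⟩

lemma exists_pt {x : Z} (hx : x ∈ Set.range ι) : ∃ p, pt s ι p = x := hx

lemma continuous_pt : Continuous (pt s ι) := ι.continuous

variable {s t}

lemma exists_hom_of_range_subset [IsOpenImmersion ι] {W : Scheme.{0}} (f : W ⟶ Z)
    (h : Set.range f ⊆ Set.range ι) : ∃ g : W ⟶ Spec (.of (Coord s ι)), g ≫ chart s ι = f :=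
  ⟨IsOpenImmersion.lift (chart s ι) f h, IsOpenImmersion.lift_fac _ _ _⟩

variable [IsOpenImmersion κ]

lemma exists_chartMap (f : Z ⟶ T) (h : f ≫ t = s) (hr : ∀ p, f (pt s ι p) ∈ Set.range κ) :
    ∃ φ : Coord t κ →ₐ[ℂ] Coord s ι,
      Spec.map (CommRingCat.ofHom φ.toRingHom) ≫ chart t κ = chart s ι ≫ f := by
  obtain ⟨g, hg⟩ := exists_hom_of_range_subset (s := t) κ (chart s ι ≫ f) (by
    rintro _ ⟨p, rfl⟩
    exact hr p)
  let φ : Coord t κ →+* Coord s ι := (Spec.preimage g).hom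
  have hφ : Spec.map (CommRingCat.ofHom φ) = g := Spec.map_preimage g
  have h1 : φ.comp (algebraMap ℂ (Coord t κ)) = algebraMap ℂ (Coord s ι) := by
    apply ofHom_injective_of_spec
    rw [CommRingCat.ofHom_comp, Spec.map_comp, hφ, ← chart_comp, ← chart_comp,
      ← Category.assoc, hg, Category.assoc, h]
  refine ⟨{ φ with commutes' := fun c ↦ congrArg (fun g ↦ g c) h1 }, ?_⟩
  exact (congrArg (fun g ↦ g ≫ chart t κ) hφ).trans hg

/-- The homomorphism of coordinate rings of affine charts given by a morphism. -/
def chartMap (f : Z ⟶ T) (h : f ≫ t = s) (hr : ∀ p, f (pt s ι p) ∈ Set.range κ) :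
    Coord t κ →ₐ[ℂ] Coord s ι :=
  (exists_chartMap ι κ f h hr).choose

lemma Spec_map_chartMap (f : Z ⟶ T) (h : f ≫ t = s) (hr : ∀ p, f (pt s ι p) ∈ Set.range κ) :
    Spec.map (CommRingCat.ofHom (chartMap ι κ f h hr).toRingHom) ≫ chart t κ = chart s ι ≫ f :=
  (exists_chartMap ι κ f h hr).choose_spec

lemma map_pt (f : Z ⟶ T) (h : f ≫ t = s) (hr : ∀ p, f (pt s ι p) ∈ Set.range κ)
    (p : PrimeSpectrum (Coord s ι)) :
    f (pt s ι p) = pt t κ (p.comap (chartMap ι κ f h hr).toRingHom) :=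
  (congrArg (fun g : Spec (.of (Coord s ι)) ⟶ T ↦ g p) (Spec_map_chartMap ι κ f h hr)).symm

variable (s t) [IsOpenImmersion ι]

lemma isOpenEmbedding_pt : Topology.IsOpenEmbedding (pt s ι) := ι.isOpenEmbedding

lemma pt_injective : Function.Injective (pt s ι) := ι.isOpenEmbedding.injective

lemma pt_specializes_iff {p q : PrimeSpectrum (Coord s ι)} :
    pt s ι p ⤳ pt s ι q ↔ p.asIdeal ≤ q.asIdeal :=
  specializes_iff_le ι p q

lemma tr_pt (p : PrimeSpectrum (Coord s ι)) :
    tr ℂ (Res s (pt s ι p)) = tr ℂ (Coord s ι ⧸ p.asIdeal) :=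
  tr_res_eq s ι p

variable {s t}

/-- Evaluation at a point, of the pullbacks of the functions on an affine chart of the target of a
morphism. -/
def evalMap (f : Z ⟶ T) (h : f ≫ t = s) {z : Z} (hz : f z ∈ Set.range κ) :
    Coord t κ →ₐ[ℂ] Res s z :=
  let e : Coord t κ →ₐ[ℂ] Res t (f z) := eval t κ hz
  (resMap s t f h z).comp e

lemma Spec_map_evalMap (f : Z ⟶ T) (h : f ≫ t = s) {z : Z} (hz : f z ∈ Set.range κ) :
    Spec.map (CommRingCat.ofHom (evalMap κ f h hz).toRingHom) ≫ chart t κ = res s z ≫ f := by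
  let e : Coord t κ →ₐ[ℂ] Res t (f z) := eval t κ hz
  have he : Spec.map (CommRingCat.ofHom e.toRingHom) ≫ chart t κ = res t (f z) :=
    Spec_map_eval t κ hz
  rw [← Spec_map_resMap_res s t f h, ← he, ← Category.assoc, ← Spec.map_comp]
  rfl

lemma ker_evalMap (f : Z ⟶ T) (h : f ≫ t = s) {z : Z} (hz : f z ∈ Set.range κ)
    {p : PrimeSpectrum (Coord t κ)} (hp : pt t κ p = f z) :
    RingHom.ker (evalMap κ f h hz) = p.asIdeal := by
  let e : Coord t κ →ₐ[ℂ] Res t (f z) := eval t κ hz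
  have h1 : RingHom.ker e = p.asIdeal := ker_eval t κ hz hp
  rw [← h1]
  ext a
  exact map_eq_zero_iff _ (resMap s t f h z).toRingHom.injective

lemma evalMap_comp_chartMap {W : Scheme.{0}} {w : W ⟶ SpecC} (g : W ⟶ Z) (hg : g ≫ s = w)
    (f : Z ⟶ T) (h : f ≫ t = s) (hr : ∀ p, f (pt s ι p) ∈ Set.range κ) {x : W}
    (hx : g x ∈ Set.range ι) (hx' : (g ≫ f) x ∈ Set.range κ) :
    (evalMap ι g hg hx).comp (chartMap ι κ f h hr) =
      evalMap κ (g ≫ f) (by rw [Category.assoc, h, hg]) hx' := by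
  apply AlgHom.coe_ringHom_injective
  apply ofHom_injective_of_spec
  rw [← cancel_mono (chart t κ)]
  refine Eq.trans ?_ (Spec_map_evalMap κ (g ≫ f) (by rw [Category.assoc, h, hg]) hx').symm
  rw [← Category.assoc, ← Spec_map_evalMap ι g hg hx, Category.assoc, ← Spec_map_chartMap ι κ f h hr,
    ← Category.assoc, ← Spec.map_comp]
  rfl

lemma isAlgebraic_evalMap (f : Z ⟶ T) (h : f ≫ t = s) {z : Z} (hz : f z ∈ Set.range κ)
    (c : Res t (f z)) {S : Set (Res s z)} (hS : Set.range (evalMap κ f h hz) ⊆ S) :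
    IsAlgebraic (Algebra.adjoin ℂ S) (resMap s t f h z c) := by
  let e : Coord t κ →ₐ[ℂ] Res t (f z) := eval t κ hz
  obtain ⟨a, b, hb, hab⟩ : ∃ a b : Coord t κ, e b ≠ 0 ∧ e b * c = e a := exists_eval_mul_eq t κ hz c
  let r := resMap s t f h z
  have hb' : r (e b) ≠ 0 := (map_ne_zero_iff _ r.toRingHom.injective).mpr hb
  have hm (a : Coord t κ) : r (e a) ∈ Algebra.adjoin ℂ S := Algebra.subset_adjoin (hS ⟨a, rfl⟩)
  have h1 : r c = r (e a) * (r (e b))⁻¹ := by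
    rw [eq_mul_inv_iff_mul_eq₀ hb', mul_comm, ← map_mul, hab]
  change IsAlgebraic (Algebra.adjoin ℂ S) (r c)
  rw [h1]
  exact (isAlgebraic_algebraMap (⟨_, hm a⟩ : Algebra.adjoin ℂ S)).mul
    (isAlgebraic_algebraMap (⟨_, hm b⟩ : Algebra.adjoin ℂ S)).inv

lemma range_evalMap_subset (f : Z ⟶ T) (h : f ≫ t = s) {z : Z} (hz : f z ∈ Set.range κ) :
    Set.range (evalMap κ f h hz) ⊆ Set.range (resMap s t f h z) := by
  rintro _ ⟨a, rfl⟩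
  exact ⟨_, rfl⟩

/-- Elements of the residue field are quotients of values of functions on the chart. For ranks,
residue fields may thus be replaced by finitely generated algebras. -/
lemma rk_union_range_evalMap (f : Z ⟶ T) (h : f ≫ t = s) {z : Z} (hz : f z ∈ Set.range κ)
    (S : Set (Res s z)) :
    rk ℂ (S ∪ Set.range (evalMap κ f h hz)) = rk ℂ (S ∪ Set.range (resMap s t f h z)) := by
  refine (rk_eq_of_isAlgebraic (Set.union_subset_union_right _ (range_evalMap_subset κ f h hz))
    ?_).symm
  rintro c (hc | ⟨c, rfl⟩)
  · exact isAlgebraic_algebraMap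
      (⟨c, Algebra.subset_adjoin (Or.inl hc)⟩ : Algebra.adjoin ℂ _)
  · exact isAlgebraic_evalMap κ f h hz c Set.subset_union_right

end Coord

/-! ### Closed points and generic points of schemes. -/

section ClosedPoints

variable {Z : Scheme.{0}} (s : Z ⟶ SpecC) [LocallyOfFiniteType s]

lemma topologicalKrullDim_univ (Z : Type*) [TopologicalSpace Z] :
    topologicalKrullDim (Set.univ : Set Z) = topologicalKrullDim Z :=
  IsHomeomorph.topologicalKrullDim_eq _ (Homeomorph.Set.univ Z).isHomeomorph

lemma isClosed_singleton_iff_tr_eq_zero {z : Z} : IsClosed {z} ↔ tr ℂ (Res s z) = 0 := by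
  constructor
  · intro h
    have h1 := tr_res_le_topologicalKrullDim s isOpen_univ (Set.mem_univ z)
      (S := {z}) (by rw [Set.univ_inter, h.closure_eq])
    exact le_zero_iff.mp (WithBot.coe_le_coe.mp
      (h1.trans (topologicalKrullDim_zero_of_discreteTopology _)))
  · intro h
    refine isClosed_of_closure_subset fun w hw ↦ ?_
    have h1 := specializes_iff_mem_closure.mpr hw
    exact (eq_of_specializes_of_tr_le s h1 (h ▸ zero_le)).symm

lemma isClosed_pt {R : CommRingCat.{0}} (ι : Spec R ⟶ Z) [IsOpenImmersion ι]
    (p : PrimeSpectrum (Coord s ι)) [p.asIdeal.IsMaximal] : IsClosed {pt s ι p} := by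
  rw [isClosed_singleton_iff_tr_eq_zero s, tr_pt]
  have := isAlgebraic_quotient (k := ℂ) p.asIdeal
  exact tr_eq_zero_of_isAlgebraic

lemma tr_genericPoint [IrreducibleSpace Z] {n : ℕ} (h : topologicalKrullDim Z = n) :
    tr ℂ (Res s (genericPoint Z)) = n := by
  apply le_antisymm
  · have h1 := tr_res_le_topologicalKrullDim s isOpen_univ (Set.mem_univ (genericPoint Z))
      (S := Set.univ) (Set.subset_univ _)
    rw [topologicalKrullDim_univ, h] at h1
    exact_mod_cast h1
  · have h0 := tr_res_ne_top s (genericPoint Z)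
    lift tr ℂ (Res s (genericPoint Z)) to ℕ using h0 with m hm
    have : QuasiSober (Set.univ : Set Z) := isClosed_univ.isClosedEmbedding_subtypeVal.quasiSober
    have h1 := topologicalKrullDim_le s Set.univ m fun z _ ↦
      hm ▸ tr_res_le_of_specializes s (genericPoint_specializes z)
    rw [topologicalKrullDim_univ, h] at h1
    exact_mod_cast h1

end ClosedPoints

/-! ### Fiber dimension and relative transcendence degree. -/

section Fibers

variable {Z T : Scheme.{0}} (s : Z ⟶ SpecC) (t : T ⟶ SpecC)

/-- Compatible charts at a point of the source of a morphism. -/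
lemma exists_chart_of_hom (f : Z ⟶ T) {R' : CommRingCat.{0}} (κ : Spec R' ⟶ T) [IsOpenImmersion κ]
    {z : Z} {U : Set Z} (hU : IsOpen U) (hzU : z ∈ U) (hz : f z ∈ Set.range κ) :
    ∃ (R : CommRingCat.{0}) (ι : Spec R ⟶ Z), IsOpenImmersion ι ∧ z ∈ Set.range ι ∧
      Set.range ι ⊆ U ∧ ∀ p, f (pt s ι p) ∈ Set.range κ := by
  obtain ⟨R, ι, h1, h2, h3⟩ := exists_chart
    (hU.inter (κ.isOpenEmbedding.isOpen_range.preimage f.continuous)) ⟨hzU, hz⟩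
  exact ⟨R, ι, h1, h2, h3.trans Set.inter_subset_left, fun p ↦ (h3 (pt_mem s ι p)).2⟩

/-- The dimension of the fibers bounds the relative transcendence degree. -/
lemma tr_le_tr_add [LocallyOfFiniteType s] [LocallyOfFiniteType t] (f : Z ⟶ T) (h : f ≫ t = s) {r : ℕ}
    (hr : ∀ v : T, IsClosed {v} → topologicalKrullDim ↥(f ⁻¹' {v}) = (r : WithBot ℕ∞)) (z : Z) :
    tr ℂ (Res s z) ≤ tr ℂ (Res t (f z)) + r := by
  obtain ⟨R', κ, _, hκ, -⟩ := exists_chart isOpen_univ (Set.mem_univ (f z))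
  obtain ⟨R, ι, _, hz, -, hι⟩ := exists_chart_of_hom s f κ isOpen_univ (Set.mem_univ z) hκ
  obtain ⟨p, rfl⟩ := exists_pt s ι hz
  let φ := chartMap ι κ f h hι
  let _ := φ.toRingHom.toAlgebra
  have : IsScalarTower ℂ (Coord t κ) (Coord s ι) :=
    IsScalarTower.of_algebraMap_eq' φ.comp_algebraMap.symm
  have : Algebra.FiniteType (Coord t κ) (Coord s ι) :=
    Algebra.FiniteType.of_restrictScalars_finiteType ℂ _ _
  -- The point specializes into a closed fiber, of dimension `r`, without loss of relative
  -- transcendence degree.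
  obtain ⟨m, Q, hm, hQ, hQm, hle⟩ :=
    exists_maximal_tr_le (k := ℂ) (B := Coord t κ) p.asIdeal
  rw [tr_pt, map_pt ι κ f h hι, tr_pt, add_comm]
  refine hle.trans (add_le_add_left ?_ _)
  have h1 : f (pt s ι ⟨Q, hQ⟩) = pt t κ ⟨m, hm.isPrime⟩ := by
    rw [map_pt ι κ f h hι]
    congr 1
    exact PrimeSpectrum.ext hQm
  have hcl : IsClosed {pt t κ ⟨m, hm.isPrime⟩} := by
    have : (⟨m, hm.isPrime⟩ : PrimeSpectrum (Coord t κ)).asIdeal.IsMaximal := hm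
    exact isClosed_pt t κ _
  have h2 := tr_res_le_topologicalKrullDim s isOpen_univ (Set.mem_univ (pt s ι ⟨Q, hQ⟩))
    (S := f ⁻¹' {pt t κ ⟨m, hm.isPrime⟩}) (by
      rw [Set.univ_inter]
      exact closure_minimal (by simpa using h1) (hcl.preimage f.continuous))
  rw [hr _ hcl, tr_pt] at h2
  exact_mod_cast h2

/-- A closed fiber contains a point of transcendence degree at least its dimension. -/
lemma exists_tr_ge (f : Z ⟶ T) {r : ℕ} {v : T} (hv : IsClosed {v})
    (hr : topologicalKrullDim ↥(f ⁻¹' {v}) = (r : WithBot ℕ∞)) :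
    ∃ z, f z = v ∧ (r : ℕ∞) ≤ tr ℂ (Res s z) := by
  have hcl : IsClosed (f ⁻¹' {v}) := hv.preimage f.continuous
  have : QuasiSober (f ⁻¹' {v}) := hcl.isClosedEmbedding_subtypeVal.quasiSober
  by_contra! hcon
  cases r with
  -- In dimension zero it only has to be seen that the fiber is nonempty; the empty space has
  -- dimension `⊥`.
  | zero =>
    have : IsEmpty (f ⁻¹' {v}) := ⟨fun z ↦ not_lt_zero (hcon z z.2)⟩
    rw [topologicalKrullDim, Order.krullDim_eq_bot_iff.mpr] at hr
    · simp at hr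
    · exact ⟨fun C ↦ (C.isIrreducible.nonempty.some : f ⁻¹' {v}) |> this.false⟩
  | succ r =>
    have h1 := topologicalKrullDim_le s (f ⁻¹' {v}) r fun z hz ↦ by
      have := hcon z hz
      rw [Nat.cast_succ] at this
      exact Order.le_of_lt_add_one this
    rw [hr] at h1
    exact absurd (by exact_mod_cast h1 : r + 1 ≤ r) (by omega)

end Fibers

/-! ### The geometrically irreducible generic fiber. -/

section

open TensorProduct

section GenericFiber

variable {X V : Scheme.{0}} {π : X ⟶ V}

lemma exists_generic_of_geometricallyIrreducible {η : V}
    (hgen : GeometricallyIrreducible (π.fiberToSpecResidueField η)) :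
    ∃ ξ : X, π ξ = η ∧ ∀ x, π x = η → ξ ⤳ x := by
  have : IrreducibleSpace (π.fiber η) :=
    GeometricallyIrreducible.irreducibleSpace_of_subsingleton (π.fiberToSpecResidueField η)
  have hmem (y : π.fiber η) : π (π.fiberι η y) = η := (π.range_fiberι η).le ⟨y, rfl⟩
  refine ⟨π.fiberι η (genericPoint (π.fiber η)), hmem _, fun x hx ↦ ?_⟩
  obtain ⟨y, rfl⟩ := (π.range_fiberι η).ge hx
  exact (genericPoint_specializes y).map (π.fiberι η).continuous

/-- `Spec (F ⊗ A)` is open in the base change of the generic fiber to `F`, an irreducible space in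
which two nonempty basic open sets meet. -/
lemma isNilpotent_or_of_geometricallyIrreducible (sV : V ⟶ SpecC) {η : V}
    (hgen : GeometricallyIrreducible (π.fiberToSpecResidueField η))
    {B A F : Type} [CommRing B] [CommRing A] [Field F] [Algebra B A] [Algebra B F]
    (a : Spec (.of A) ⟶ X) [IsOpenImmersion a] (b : Spec (.of B) ⟶ V) [Mono b]
    (hab : Spec.map (CommRingCat.ofHom (algebraMap B A)) ≫ b = a ≫ π)
    (hη : b (Spec.map (CommRingCat.ofHom (algebraMap B F)) (fieldPt F)) = η)
    (s t : F ⊗[B] A) (hst : IsNilpotent (s * t)) : IsNilpotent s ∨ IsNilpotent t := by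
  let g : Spec (.of F) ⟶ V := Spec.map (CommRingCat.ofHom (algebraMap B F)) ≫ b
  obtain ⟨x, h, hh, hx⟩ := exists_res_factor sV g
  have hxη : x = η := by
    rw [hx, ← hη]
    rfl
  subst hxη
  have hE : IrreducibleSpace ↥(pullback π g) := by
    let h' : Spec (.of F) ⟶ Spec (V.residueField x) := Spec.map (CommRingCat.ofHom h)
    have hh' : h' ≫ V.fromSpecResidueField x = g := hh
    have hfib : IsPullback (π.fiberι x) (π.fiberToSpecResidueField x) π
      (V.fromSpecResidueField x) := IsPullback.of_hasPullback _ _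
    let l : pullback π g ⟶ π.fiber x := hfib.lift (pullback.fst π g) (pullback.snd π g ≫ h')
      (by rw [Category.assoc, hh', pullback.condition])
    have hl : IsPullback (l ≫ π.fiberι x) (pullback.snd π g) π
        (h' ≫ V.fromSpecResidueField x) := by
      rw [hfib.lift_fst, hh']
      exact IsPullback.of_hasPullback _ _
    exact hgen.geometrically_irreducibleSpace _ _ _
      (IsPullback.of_right hl (hfib.lift_snd _ _ _) hfib)
  let P : CommRingCat := .of (F ⊗[B] A)
  let iF : Spec P ⟶ Spec (.of F) := Spec.map (CommRingCat.ofHom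
    (Algebra.TensorProduct.includeLeftRingHom : F →+* F ⊗[B] A))
  let iA : Spec P ⟶ Spec (.of A) := Spec.map (CommRingCat.ofHom
    (Algebra.TensorProduct.includeRight : A →ₐ[B] F ⊗[B] A).toRingHom)
  have hpb : IsPullback iA iF (Spec.map (CommRingCat.ofHom (algebraMap B A)))
      (Spec.map (CommRingCat.ofHom (algebraMap B F))) :=
    (isPullback_SpecMap_of_isPushout _ _ _ _ (CommRingCat.isPushout_tensorProduct B F A)).flip
  have hpb2 : IsPullback iA iF (a ≫ π) g := by
    rw [← hab]
    refine ⟨⟨by rw [← Category.assoc, hpb.w, Category.assoc]⟩, ⟨?_⟩⟩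
    -- Composition with the monomorphism `b` does not change the fiber product.
    exact PullbackCone.isLimitOfCompMono _ _ b _ hpb.isLimit
  let l : Spec P ⟶ pullback π g := pullback.lift (iA ≫ a) iF (by rw [Category.assoc, hpb2.w])
  have hl : IsPullback iA l a (pullback.fst π g) := by
    refine IsPullback.of_bot ?_ (pullback.lift_fst _ _ _).symm (IsPullback.of_hasPullback π g)
    rw [pullback.lift_snd]
    exact hpb2
  have hopen : IsOpenImmersion l := MorphismProperty.of_isPullback hl inferInstance
  by_contra! hcon
  let D (c : F ⊗[B] A) : Set (Spec P) := (PrimeSpectrum.basicOpen c : Set (PrimeSpectrum (F ⊗[B] A)))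
  have hD (c) : IsOpen (D c) := (PrimeSpectrum.basicOpen c).isOpen
  have hne (c) (hc : ¬ IsNilpotent c) : (l '' D c).Nonempty := by
    rw [Set.image_nonempty, Set.nonempty_iff_ne_empty]
    intro h0
    refine hc ((PrimeSpectrum.basicOpen_eq_bot_iff c).mp ?_)
    exact SetLike.coe_injective h0
  obtain ⟨_, ⟨p, hp, rfl⟩, q, hq, hpq⟩ := nonempty_preirreducible_inter
    (l.isOpenEmbedding.isOpenMap _ (hD s)) (l.isOpenEmbedding.isOpenMap _ (hD t))
    (hne s hcon.1) (hne t hcon.2)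
  obtain rfl := l.isOpenEmbedding.injective hpq
  have h1 : q ∈ D (s * t) := fun h ↦ (PrimeSpectrum.isPrime q |>.mem_or_mem h).elim hp hq
  have h2 : PrimeSpectrum.basicOpen (s * t) = ⊥ := (PrimeSpectrum.basicOpen_eq_bot_iff _).mpr hst
  have h3 : D (s * t) = ∅ := congrArg SetLike.coe h2
  rw [h3] at h1
  exact h1

end GenericFiber

section Quotient

/-- A prime of `F ⊗ A` lies over zero in `B`, so it contains the image of `I`, and the passage to `A
⧸ I` only kills nilpotents. It is needed because coordinate rings of the family need not be domains.
-/
lemma isNilpotent_or_quotient {B A F : Type*} [CommRing B] [CommRing A] [Field F] [Algebra B A]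
    [Algebra B F] (hinj : Function.Injective (algebraMap B F)) (I : Ideal A)
    (hI : ∀ Q : Ideal A, Q.IsPrime → Q.comap (algebraMap B A) = ⊥ → I ≤ Q)
    (hF : ∀ s t : F ⊗[B] A, IsNilpotent (s * t) → IsNilpotent s ∨ IsNilpotent t)
    (s t : F ⊗[B] (A ⧸ I)) (hst : s * t = 0) : IsNilpotent s ∨ IsNilpotent t := by
  let m : F ⊗[B] A →ₐ[B] F ⊗[B] (A ⧸ I) :=
    Algebra.TensorProduct.map (AlgHom.id B F) (Ideal.Quotient.mkₐ B I)
  have hm : Function.Surjective m := TensorProduct.map_surjective Function.surjective_id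
    (Ideal.Quotient.mkₐ_surjective B I)
  have hker : RingHom.ker m ≤ nilradical (F ⊗[B] A) := by
    have h1 : RingHom.ker m = (RingHom.ker (Ideal.Quotient.mkₐ B I)).map
        (Algebra.TensorProduct.includeRight : A →ₐ[B] F ⊗[B] A) :=
      Algebra.TensorProduct.lTensor_ker _ (Ideal.Quotient.mkₐ_surjective B I)
    have h2 : RingHom.ker (Ideal.Quotient.mkₐ B I) = I := Ideal.Quotient.mkₐ_ker B I
    rw [h1, h2, Ideal.map_le_iff_le_comap]
    intro c hc
    rw [Ideal.mem_comap, mem_nilradical, nilpotent_iff_mem_prime]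
    intro P hP
    have h2 := hI (P.comap (Algebra.TensorProduct.includeRight : A →ₐ[B] F ⊗[B] A)) inferInstance ?_
    · exact h2 hc
    · have h3 : P.comap (algebraMap F (F ⊗[B] A)) = ⊥ := Ideal.eq_bot_of_prime _
      have h4 : P.comap (algebraMap B (F ⊗[B] A)) = ⊥ := by
        rw [IsScalarTower.algebraMap_eq B F, ← Ideal.comap_comap, h3]
        exact (RingHom.injective_iff_ker_eq_bot _).mp hinj
      rw [← h4]
      ext c
      simp [Ideal.mem_comap, Algebra.TensorProduct.tmul_one_eq_one_tmul]
  obtain ⟨s, rfl⟩ := hm s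
  obtain ⟨t, rfl⟩ := hm t
  rw [← map_mul] at hst
  rcases hF s t (hker hst) with h | h
  · exact Or.inl (h.map m)
  · exact Or.inr (h.map m)

end Quotient

end

/-! ### Generic points of general closed fibers. -/

section

open TensorProduct

/-- The least prime ideals over general closed points, for an algebra whose generic fiber is
geometrically irreducible. -/
theorem exists_forall_exists_least_prime_ge {k : Type*} {B A : Type u} [Field k] [CommRing B]
    [IsDomain B] [CharZero B] [CommRing A] [Algebra B A] [Algebra k B] [Algebra k A]
    [IsScalarTower k B A] [Algebra.FiniteType k B] [Algebra.FiniteType B A]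
    (𝔭 : Ideal A) [𝔭.IsPrime] (h0 : 𝔭.comap (algebraMap B A) = ⊥)
    (hF : ∀ (F : Type u) [Field F] [Algebra B F], Function.Injective (algebraMap B F) →
      ∀ s t : F ⊗[B] (A ⧸ 𝔭), s * t = 0 → IsNilpotent s ∨ IsNilpotent t) :
    ∃ b : B, b ≠ 0 ∧ ∀ q : Ideal B, q.IsMaximal → b ∉ q → ∃ Q : Ideal A, Q.IsPrime ∧ 𝔭 ≤ Q ∧
      Q.comap (algebraMap B A) = q ∧
      (∀ Q' : Ideal A, Q'.IsPrime → 𝔭 ≤ Q' → q ≤ Q'.comap (algebraMap B A) → Q ≤ Q') ∧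
      tr k (A ⧸ Q) + tr k B ≤ tr k (B ⧸ q) + tr k (A ⧸ 𝔭) := by
  have hinj : Function.Injective (algebraMap B (A ⧸ 𝔭)) := by
    rw [RingHom.injective_iff_ker_eq_bot, ← h0]
    ext c
    exact Ideal.Quotient.eq_zero_iff_mem
  obtain ⟨b, hb, h⟩ := exists_forall_exists_least_prime (k := k) hinj hF one_ne_zero
  -- This second normalization bounds the dimension of the fiber at `q`.
  obtain ⟨c, d, x, hc⟩ := exists_isGenericNoether (B := B) (A := A ⧸ 𝔭) hinj
  refine ⟨b * c, mul_ne_zero hb hc.ne_zero, fun q hq hbc ↦ ?_⟩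
  obtain ⟨Q, hQ, hQq, -, hle⟩ := h q hq fun hm ↦ hbc (q.mul_mem_right _ hm)
  let m : A →ₐ[B] A ⧸ 𝔭 := Ideal.Quotient.mkₐ B 𝔭
  have hmc (J : Ideal (A ⧸ 𝔭)) : (J.comap m).comap (algebraMap B A) =
      J.comap (algebraMap B (A ⧸ 𝔭)) := rfl
  refine ⟨Q.comap m, inferInstance, fun a ha ↦ ?_, (hmc Q).trans hQq, fun Q' hQ' h𝔭 hqQ' ↦ ?_, ?_⟩
  · rw [Ideal.mem_comap]
    have : m a = 0 := Ideal.Quotient.eq_zero_iff_mem.mpr ha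
    rw [this]
    exact zero_mem _
  · have hker : RingHom.ker (Ideal.Quotient.mk 𝔭) ≤ Q' := by rwa [Ideal.mk_ker]
    have h1 : (Q'.map (Ideal.Quotient.mk 𝔭)).comap (Ideal.Quotient.mk 𝔭) = Q' := by
      rw [Ideal.comap_map_of_surjective' _ Ideal.Quotient.mk_surjective, sup_eq_left.mpr hker]
    have h2 : (Q'.map (Ideal.Quotient.mk 𝔭)).IsPrime :=
      Ideal.map_isPrime_of_surjective Ideal.Quotient.mk_surjective hker
    have h3 := hle (Q'.map (Ideal.Quotient.mk 𝔭)) h2 (by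
      rw [← hmc]
      change q ≤ Ideal.comap _ (Ideal.comap (Ideal.Quotient.mk 𝔭) _)
      rwa [h1])
    exact (Ideal.comap_mono h3).trans h1.le
  · have h1 := hc.tr_quotient_le (k := k) Q fun hm ↦ hbc (q.mul_mem_left _ (hQq ▸ hm))
    rw [hQq] at h1
    rw [hc.tr_eq (k := k) hinj]
    have h2 : tr k (A ⧸ Q.comap m) ≤ tr k ((A ⧸ 𝔭) ⧸ Q) :=
      tr_le_of_injective (Ideal.quotientMapₐ (I := Q.comap m) Q (m.restrictScalars k) le_rfl)
        Ideal.quotientMap_injective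
    calc _ ≤ tr k (B ⧸ q) + d + tr k B := by gcongr; exact h2.trans h1
      _ = _ := by rw [add_assoc, add_comm (d : ℕ∞)]

section GeneralFiber

variable {X V : Scheme.{0}} {sX : X ⟶ SpecC} {sV : V ⟶ SpecC} {π : X ⟶ V}
  {R : CommRingCat.{0}} (κ : Spec R ⟶ V) [IsOpenImmersion κ]

lemma isDomain_coord [IsIntegral V] (hκ : (Set.range κ).Nonempty) : IsDomain (Coord sV κ) := by
  have : Nonempty (Spec R) := Set.range_nonempty_iff_nonempty.mp hκ
  have := isIntegral_of_isOpenImmersion κ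
  exact (affine_isIntegral_iff R).mp this

lemma pt_bot [IsIntegral V] [IsDomain (Coord sV κ)] :
    pt sV κ ⟨⊥, Ideal.isPrime_bot⟩ = genericPoint V := by
  obtain ⟨p, hp⟩ := exists_pt sV κ ((genericPoint_specializes
    (pt sV κ ⟨⊥, Ideal.isPrime_bot⟩)).mem_open κ.isOpenEmbedding.isOpen_range (pt_mem sV κ _))
  have h := genericPoint_specializes (pt sV κ ⟨⊥, Ideal.isPrime_bot⟩)
  rw [← hp, pt_specializes_iff] at h
  rw [← hp]
  congr 1
  exact PrimeSpectrum.ext (le_bot_iff.mp h).symm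

variable [LocallyOfFiniteType sX] [LocallyOfFiniteType sV] [IsIntegral V]
  [IsDomain (Coord sV κ)] {ξ : X}

/-- In a general fiber, every point in a given chart is a specialization of a point in a given
neighborhood of the generic point. -/
lemma exists_forall_exists_specializes_of_mem_chart (hπ : π ≫ sV = sX)
    (hξ : π ξ = genericPoint V) (hgen : ∀ x, π x = genericPoint V → ξ ⤳ x) {R' : CommRingCat.{0}} (ι : Spec R' ⟶ X)
    [IsOpenImmersion ι] (hι : ∀ p, π (pt sX ι p) ∈ Set.range κ) {W : Set X} (hW : IsOpen W)
    (hξW : ξ ∈ W) :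
    ∃ b : Coord sV κ, b ≠ 0 ∧ ∀ q : PrimeSpectrum (Coord sV κ), q.asIdeal.IsMaximal →
      b ∉ q.asIdeal → ∀ x ∈ Set.range ι, π x = pt sV κ q →
      ∃ w ∈ W, w ⤳ x ∧ π w = pt sV κ q ∧ ξ ⤳ w := by
  let φ := chartMap ι κ π hπ hι
  let _ : Algebra (Coord sV κ) (Coord sX ι) := φ.toRingHom.toAlgebra
  have : IsScalarTower ℂ (Coord sV κ) (Coord sX ι) :=
    IsScalarTower.of_algebraMap_eq' φ.comp_algebraMap.symm
  have : Algebra.FiniteType (Coord sV κ) (Coord sX ι) :=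
    Algebra.FiniteType.of_restrictScalars_finiteType ℂ _ _
  have hmap (Q : PrimeSpectrum (Coord sX ι)) : π (pt sX ι Q) = pt sV κ (Q.comap (algebraMap _ _)) :=
    map_pt ι κ π hπ hι Q
  have hbot (Q : Ideal (Coord sX ι)) (hQ : Q.IsPrime) (h : Q.comap (algebraMap (Coord sV κ) _) = ⊥) :
      ξ ⤳ pt sX ι ⟨Q, hQ⟩ := by
    apply hgen
    rw [hmap, ← pt_bot (sV := sV) κ]
    congr 1
    exact PrimeSpectrum.ext h
  have hN : IsNoetherianRing (Coord sX ι) := Algebra.FiniteType.isNoetherianRing ℂ _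
  by_cases hξι : ξ ∈ Set.range ι
  · obtain ⟨p, rfl⟩ := exists_pt sX ι hξι
    have hp0 : p.asIdeal.comap (algebraMap (Coord sV κ) _) = ⊥ := by
      rw [hmap, ← pt_bot (sV := sV) κ] at hξ
      exact congrArg PrimeSpectrum.asIdeal (pt_injective sV κ hξ)
    obtain ⟨b₁, hb₁, h₁⟩ := exists_forall_le_of_fg (B := Coord sV κ) (I := p.asIdeal)
      (hN.noetherian _) fun Q hQ h ↦ (pt_specializes_iff sX ι).mp (hbot Q hQ h)
    obtain ⟨_, ⟨_, ⟨s, rfl⟩, rfl⟩, hsp, hsW⟩ := PrimeSpectrum.isBasis_basic_opens.exists_subset_of_mem_open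
      (show p ∈ pt sX ι ⁻¹' W from hξW) (hW.preimage (continuous_pt sX ι))
    have hinj : Function.Injective (algebraMap (Coord sV κ) (Coord sX ι ⧸ p.asIdeal)) := by
      rw [RingHom.injective_iff_ker_eq_bot, ← hp0]
      ext c
      exact Ideal.Quotient.eq_zero_iff_mem
    have hs : Ideal.Quotient.mk p.asIdeal s ≠ 0 := fun h ↦ hsp (Ideal.Quotient.eq_zero_iff_mem.mp h)
    obtain ⟨b₂, hb₂, h₂⟩ := exists_forall_exists_notMem (k := ℂ) hinj hs
    refine ⟨b₁ * b₂, mul_ne_zero hb₁ hb₂, fun q hq hb x hx hxq ↦ ?_⟩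
    obtain ⟨Q₂, rfl⟩ := exists_pt sX ι hx
    rw [hmap] at hxq
    have hQ₂q : Q₂.asIdeal.comap (algebraMap (Coord sV κ) _) = q.asIdeal :=
      congrArg PrimeSpectrum.asIdeal (pt_injective sV κ hxq)
    have hpQ₂ : p.asIdeal ≤ Q₂.asIdeal := h₁ _ Q₂.2 fun hm ↦
      hb (Ideal.mul_mem_right _ _ (hQ₂q ▸ hm))
    have hker : RingHom.ker (Ideal.Quotient.mk p.asIdeal) ≤ Q₂.asIdeal := by rwa [Ideal.mk_ker]
    have hcm : (Q₂.asIdeal.map (Ideal.Quotient.mk p.asIdeal)).comap (Ideal.Quotient.mk p.asIdeal) =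
        Q₂.asIdeal := by
      rw [Ideal.comap_map_of_surjective' _ Ideal.Quotient.mk_surjective, sup_eq_left.mpr hker]
    obtain ⟨Q, hQle, hQ, hqQ, hsQ⟩ := h₂ q.asIdeal hq (fun hm ↦ hb (Ideal.mul_mem_left _ _ hm))
      (Q₂.asIdeal.map (Ideal.Quotient.mk p.asIdeal))
      (Ideal.map_isPrime_of_surjective Ideal.Quotient.mk_surjective hker) (by
        rw [← hQ₂q]
        exact fun c hc ↦ Ideal.mem_map_of_mem _ hc)
    let Q' : PrimeSpectrum (Coord sX ι) :=
      ⟨Q.comap (Ideal.Quotient.mk p.asIdeal), Ideal.comap_isPrime _ _⟩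
    have hQ'le : Q'.asIdeal ≤ Q₂.asIdeal := (Ideal.comap_mono hQle).trans hcm.le
    refine ⟨pt sX ι Q', hsW hsQ, (pt_specializes_iff sX ι).mpr hQ'le, ?_,
      (pt_specializes_iff sX ι).mpr fun c hc ↦ ?_⟩
    · rw [hmap]
      congr 1
      exact PrimeSpectrum.ext (le_antisymm ((Ideal.comap_mono hQ'le).trans hQ₂q.le) hqQ)
    · change Ideal.Quotient.mk p.asIdeal c ∈ Q
      rw [Ideal.Quotient.eq_zero_iff_mem.mpr hc]
      exact zero_mem _
  -- If `ξ` is outside the chart, no point of the chart lies over the generic point, so general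
  -- fibers do not meet the chart.
  · obtain ⟨b, hb, h⟩ := exists_forall_le_of_fg (B := Coord sV κ) (I := (⊤ : Ideal (Coord sX ι)))
      (hN.noetherian _) fun Q hQ h ↦
        (hξι ((hbot Q hQ h).mem_open ι.isOpenEmbedding.isOpen_range (pt_mem sX ι _))).elim
    refine ⟨b, hb, fun q hq hbq x hx hxq ↦ ?_⟩
    obtain ⟨Q, rfl⟩ := exists_pt sX ι hx
    rw [hmap] at hxq
    have hQq : Q.asIdeal.comap (algebraMap (Coord sV κ) _) = q.asIdeal :=
      congrArg PrimeSpectrum.asIdeal (pt_injective sV κ hxq)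
    exact absurd (top_le_iff.mp (h _ Q.2 fun hm ↦ hbq (hQq ▸ hm))) Q.2.ne_top

/-- The statement for one chart of `X`, extended by compactness to the preimage of the chart `κ`. -/
lemma exists_forall_exists_specializes (hπ : π ≫ sV = sX) (hξ : π ξ = genericPoint V)
    (hgen : ∀ x, π x = genericPoint V → ξ ⤳ x) [TopologicalSpace.NoetherianSpace X] {W : Set X}
    (hW : IsOpen W) (hξW : ξ ∈ W) :
    ∃ b : Coord sV κ, b ≠ 0 ∧ ∀ q : PrimeSpectrum (Coord sV κ), q.asIdeal.IsMaximal →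
      b ∉ q.asIdeal → ∀ x, π x = pt sV κ q →
      ∃ w ∈ W, w ⤳ x ∧ π w = pt sV κ q ∧ ξ ⤳ w := by
  have hcpt : IsCompact (π ⁻¹' Set.range κ) := TopologicalSpace.NoetherianSpace.isCompact _
  have key : ∃ b : Coord sV κ, b ≠ 0 ∧ ∀ q : PrimeSpectrum (Coord sV κ), q.asIdeal.IsMaximal →
      b ∉ q.asIdeal → ∀ x ∈ π ⁻¹' Set.range κ, π x = pt sV κ q →
      ∃ w ∈ W, w ⤳ x ∧ π w = pt sV κ q ∧ ξ ⤳ w := by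
    refine hcpt.induction_on ⟨1, one_ne_zero, by simp⟩ ?_ ?_ ?_
    · rintro S T hST ⟨b, hb, h⟩
      exact ⟨b, hb, fun q hq hbq x hx ↦ h q hq hbq x (hST hx)⟩
    · rintro S T ⟨b, hb, h⟩ ⟨c, hc, h'⟩
      refine ⟨b * c, mul_ne_zero hb hc, fun q hq hbq x hx ↦ ?_⟩
      rcases hx with hx | hx
      · exact h q hq (fun hm ↦ hbq (Ideal.mul_mem_right _ _ hm)) x hx
      · exact h' q hq (fun hm ↦ hbq (Ideal.mul_mem_left _ _ hm)) x hx
    · intro x hx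
      obtain ⟨R', ι, _, hxι, -, hι⟩ := exists_chart_of_hom sX π κ isOpen_univ (Set.mem_univ x) hx
      exact ⟨Set.range ι, mem_nhdsWithin_of_mem_nhds (ι.isOpenEmbedding.isOpen_range.mem_nhds hxι),
        exists_forall_exists_specializes_of_mem_chart κ hπ hξ hgen ι hι hW hξW⟩
  obtain ⟨b, hb, h⟩ := key
  refine ⟨b, hb, fun q hq hbq x hx ↦ h q hq hbq x ?_ hx⟩
  rw [Set.mem_preimage, hx]
  exact pt_mem sV κ q

end GeneralFiber

end

section

open TensorProduct

section GeneralFiber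

variable {X V : Scheme.{0}} {sX : X ⟶ SpecC} {sV : V ⟶ SpecC} {π : X ⟶ V}
  {R R' : CommRingCat.{0}} (κ : Spec R ⟶ V) [IsOpenImmersion κ]
  (ι : Spec R' ⟶ X) [IsOpenImmersion ι]
  [IsIntegral V] [IsDomain (Coord sV κ)]

/-- All primes of the chart over the generic point of `V` contain `p`, so geometric irreducibility
passes to the quotient by `p`. -/
lemma isNilpotent_or_of_chart
    (hgen : GeometricallyIrreducible (π.fiberToSpecResidueField (genericPoint V)))
    {p : PrimeSpectrum (Coord sX ι)} (hp : ∀ x, π x = genericPoint V → pt sX ι p ⤳ x)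
    [Algebra (Coord sV κ) (Coord sX ι)]
    (hι : Spec.map (CommRingCat.ofHom (algebraMap (Coord sV κ) (Coord sX ι))) ≫ chart sV κ =
      chart sX ι ≫ π) (F : Type) [Field F] [Algebra (Coord sV κ) F]
    (hinj : Function.Injective (algebraMap (Coord sV κ) F))
    (s t : F ⊗[Coord sV κ] (Coord sX ι ⧸ p.asIdeal)) (hst : s * t = 0) :
    IsNilpotent s ∨ IsNilpotent t := by
  refine isNilpotent_or_quotient hinj p.asIdeal (fun Q hQ h ↦ ?_)
    (isNilpotent_or_of_geometricallyIrreducible sV hgen (chart sX ι) (chart sV κ) hι ?_) s t hst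
  · refine (pt_specializes_iff sX ι (q := ⟨Q, hQ⟩)).mp (hp _ ?_)
    rw [← pt_bot (sV := sV) κ]
    refine (congrArg (fun g : Spec (.of (Coord sX ι)) ⟶ V ↦ g (⟨Q, hQ⟩ : PrimeSpectrum _)) hι).symm.trans ?_
    exact congrArg (pt sV κ) (PrimeSpectrum.ext h)
  · rw [← pt_bot (sV := sV) κ]
    refine congrArg (pt sV κ) (ideal_injective (R := .of (Coord sV κ)) ?_)
    rw [ideal_map_fieldPt]
    exact (RingHom.injective_iff_ker_eq_bot _).mp hinj

variable [LocallyOfFiniteType sX] [LocallyOfFiniteType sV]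

/-- In a chart, the generic points of the general fibers. -/
theorem exists_forall_exists_generic (hπ : π ≫ sV = sX)
    (hgen : GeometricallyIrreducible (π.fiberToSpecResidueField (genericPoint V)))
    [TopologicalSpace.NoetherianSpace X] (hι : ∀ p, π (pt sX ι p) ∈ Set.range κ)
    {p : PrimeSpectrum (Coord sX ι)} (hpη : π (pt sX ι p) = genericPoint V)
    (hp : ∀ x, π x = genericPoint V → pt sX ι p ⤳ x) :
    ∃ b : Coord sV κ, b ≠ 0 ∧ ∀ q : PrimeSpectrum (Coord sV κ), q.asIdeal.IsMaximal →
      b ∉ q.asIdeal → ∃ Q : PrimeSpectrum (Coord sX ι), p.asIdeal ≤ Q.asIdeal ∧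
        Q.comap (chartMap ι κ π hπ hι).toRingHom = q ∧
        (∀ x, π x = pt sV κ q → pt sX ι Q ⤳ x) ∧
        tr ℂ (Res sX (pt sX ι Q)) + tr ℂ (Res sV (genericPoint V)) ≤
          tr ℂ (Res sX (pt sX ι p)) := by
  let φ := chartMap ι κ π hπ hι
  let _ : Algebra (Coord sV κ) (Coord sX ι) := φ.toRingHom.toAlgebra
  have : IsScalarTower ℂ (Coord sV κ) (Coord sX ι) :=
    IsScalarTower.of_algebraMap_eq' φ.comp_algebraMap.symm
  have : Algebra.FiniteType (Coord sV κ) (Coord sX ι) :=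
    Algebra.FiniteType.of_restrictScalars_finiteType ℂ _ _
  have : CharZero (Coord sV κ) :=
    charZero_of_injective_algebraMap (algebraMap ℂ (Coord sV κ)).injective
  have hmap (Q : PrimeSpectrum (Coord sX ι)) : π (pt sX ι Q) = pt sV κ (Q.comap (algebraMap _ _)) :=
    map_pt ι κ π hπ hι Q
  have hp0 : p.asIdeal.comap (algebraMap (Coord sV κ) _) = ⊥ := by
    rw [hmap, ← pt_bot (sV := sV) κ] at hpη
    exact congrArg PrimeSpectrum.asIdeal (pt_injective sV κ hpη)
  obtain ⟨b, hb, h⟩ := exists_forall_exists_least_prime_ge (k := ℂ) p.asIdeal hp0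
    fun F _ _ hinj ↦ isNilpotent_or_of_chart κ ι hgen hp (Spec_map_chartMap ι κ π hπ hι) F hinj
  obtain ⟨c, hc, h'⟩ := exists_forall_exists_specializes κ hπ hpη hp ι.isOpenEmbedding.isOpen_range
    (pt_mem sX ι p)
  refine ⟨b * c, mul_ne_zero hb hc, fun q hq hbc ↦ ?_⟩
  obtain ⟨Q, hQ, hpQ, hQq, hle, htr⟩ := h q.asIdeal hq fun hm ↦ hbc (Ideal.mul_mem_right _ _ hm)
  refine ⟨⟨Q, hQ⟩, hpQ, PrimeSpectrum.ext hQq, fun x hx ↦ ?_, ?_⟩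
  · obtain ⟨w, hw, hwx, hwq, hpw⟩ := h' q hq (fun hm ↦ hbc (Ideal.mul_mem_left _ _ hm)) x hx
    obtain ⟨Q', rfl⟩ := exists_pt sX ι hw
    rw [hmap] at hwq
    refine Specializes.trans ((pt_specializes_iff sX ι).mpr ?_) hwx
    exact hle _ Q'.2 ((pt_specializes_iff sX ι).mp hpw)
      (congrArg PrimeSpectrum.asIdeal (pt_injective sV κ hwq)).ge
  · have h0 : tr ℂ (Coord sV κ ⧸ q.asIdeal) = 0 := by
      have := isAlgebraic_quotient (k := ℂ) q.asIdeal
      exact tr_eq_zero_of_isAlgebraic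
    have h1 : tr ℂ (Coord sV κ ⧸ (⊥ : Ideal (Coord sV κ))) = tr ℂ (Coord sV κ) :=
      tr_eq_of_algEquiv (AlgEquiv.quotientBot ℂ _)
    rw [← pt_bot (sV := sV) κ, tr_pt, tr_pt, tr_pt, h1]
    rwa [h0, zero_add] at htr

/-- The fiber dimension is the relative transcendence degree of the generic point of the generic
fiber. -/
lemma add_le_tr_generic (hπ : π ≫ sV = sX)
    (hgen : GeometricallyIrreducible (π.fiberToSpecResidueField (genericPoint V)))
    [TopologicalSpace.NoetherianSpace X] {r : ℕ}
    (hr : ∀ v : V, IsClosed {v} → topologicalKrullDim ↥(π ⁻¹' {v}) = (r : WithBot ℕ∞))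
    {ξ : X} (hξη : π ξ = genericPoint V)
    (hξ : ∀ x, π x = genericPoint V → ξ ⤳ x) :
    r + tr ℂ (Res sV (genericPoint V)) ≤ tr ℂ (Res sX ξ) := by
  obtain ⟨R, κ, _, hκ, -⟩ := exists_chart isOpen_univ (Set.mem_univ (genericPoint V))
  have : IsDomain (Coord sV κ) := isDomain_coord κ ⟨_, hκ⟩
  obtain ⟨R', ι, _, hι, -, hικ⟩ := exists_chart_of_hom sX π κ isOpen_univ (Set.mem_univ ξ)
    (by rwa [hξη])
  obtain ⟨p, rfl⟩ := exists_pt sX ι hι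
  obtain ⟨b, hb, h⟩ := exists_forall_exists_generic κ ι hπ hgen hικ hξη hξ
  obtain ⟨m, hm, hbm⟩ := exists_isMaximal_notMem (k := ℂ) hb
  obtain ⟨Q, -, -, hQ, hle⟩ := h ⟨m, hm.isPrime⟩ hm hbm
  have : (⟨m, hm.isPrime⟩ : PrimeSpectrum (Coord sV κ)).asIdeal.IsMaximal := hm
  have hcl := isClosed_pt sV κ ⟨m, hm.isPrime⟩
  obtain ⟨x, hx, hrx⟩ := exists_tr_ge sX π hcl (hr _ hcl)
  refine le_trans ?_ hle
  gcongr
  exact hrx.trans (tr_res_le_of_specializes sX (hQ x hx))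

end GeneralFiber

/-! ### Members of the family and their Chow points. -/

section Family

variable {V Y X : Scheme.{0}} {sV : V ⟶ SpecC} {sY : Y ⟶ SpecC} (i : X ⟶ pullback sV sY)

/-- Over a closed point of `V` the first summand vanishes, so points of a member keep their
transcendence degree in `Y`. -/
lemma tr_family_le [IsImmersion i] (x : X) : tr ℂ (Res (toBase i ≫ sV) x) ≤
    tr ℂ (Res sV (toBase i x)) + tr ℂ (Res sY (toAmbient i x)) := by
  rw [← rk_family i x _ Set.subset_union_left Set.subset_union_right]
  refine (rk_union_le _ _).trans (add_le_add ?_ ?_)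
  · exact rk_range_le_tr _
  · exact rk_range_le_tr _

open Classical in
/-- If a fiber has a generic point, its Chow point is determined by the image of that point. -/
lemma exists_chowMap_eq {N : ℕ} (j : Y ⟶ ProjSpace N) {v : V} (hv : IsClosed {v}) {x : X}
    (hx : toBase i x = v) (hgen : ∀ x', toBase i x' = v → x ⤳ x') :
    ∃ hv' : v ∈ IrreducibleLocus i, chowMap i j ⟨v, hv'⟩ =
      Function.locallyFinsuppWithin.single (j (toAmbient i x)) 1 := by
  have h1 : closure {x} = toBase i ⁻¹' {v} := by
    refine subset_antisymm (closure_minimal (by simpa using hx) (hv.preimage (toBase i).continuous)) ?_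
    exact fun x' hx' ↦ specializes_iff_mem_closure.mp (hgen x' hx')
  have hv' : v ∈ IrreducibleLocus i := ⟨hv, h1 ▸ isIrreducible_singleton.closure⟩
  refine ⟨hv', ?_⟩
  have h2 : (isIrreducible_image_member i j hv').genericPoint = j (toAmbient i x) := by
    refine (isIrreducible_image_member i j hv').isGenericPoint_genericPoint_closure.eq ?_
    have h3 : IsGenericPoint x (toBase i ⁻¹' {v}) := h1
    have h4 := h3.image (j.continuous.comp (toAmbient i).continuous)
    rwa [Set.image_comp] at h4
  unfold chowMap
  rw [h2]

set_option maxHeartbeats 400000 in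
open Classical in
/-- If the tuples of points in the members of a maximally varying family move less than expected, then
they do not determine the parameter. -/
theorem rk_union_le_of_isMaximallyVarying [IsImmersion i] [LocallyOfFiniteType sV]
    [LocallyOfFiniteType sY] [LocallyOfFiniteType (toBase i ≫ sV)] [IsIntegral V]
    [TopologicalSpace.NoetherianSpace X]
    (hgen : GeometricallyIrreducible ((toBase i).fiberToSpecResidueField (genericPoint V)))
    {N : ℕ} (j : Y ⟶ ProjSpace N) (hmax : IsMaximallyVarying i j) {r : ℕ}
    (hr : ∀ v : V, IsClosed {v} →
      topologicalKrullDim ↥(toBase i ⁻¹' {v}) = (r : WithBot ℕ∞))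
    {ξ : X} (hξη : toBase i ξ = genericPoint V)
    (hξ : ∀ x, toBase i x = genericPoint V → ξ ⤳ x)
    {Z : Scheme.{0}} {s : Z ⟶ SpecC} (f : Z ⟶ X) (hfX : f ≫ toBase i ≫ sV = s)
    (hfV : (f ≫ toBase i) ≫ sV = s) (hfY : (f ≫ toAmbient i) ≫ sY = s) {z : Z} (hz : f z = ξ)
    (D : Subalgebra ℂ (Res s z)) (hD : D.FG)
    (hE : rk ℂ ((D : Set (Res s z)) ∪ Set.range (resMap s sV (f ≫ toBase i) hfV z)) + r ≤
      rk ℂ ((D : Set (Res s z)) ∪ Set.range (resMap s (toBase i ≫ sV) f hfX z)))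
    (hS : rk ℂ ((D : Set (Res s z)) ∪ Set.range (resMap s sY (f ≫ toAmbient i) hfY z)) ≤
      rk ℂ (D : Set (Res s z)) + r) :
    rk ℂ ((D : Set (Res s z)) ∪ Set.range (resMap s sV (f ≫ toBase i) hfV z)) ≤
      rk ℂ (D : Set (Res s z)) := by
  let sX := toBase i ≫ sV
  have hπ : toBase i ≫ sV = sX := rfl
  have ha : toAmbient i ≫ sY = sX := (toBase_comp i).symm
  obtain ⟨R, κ, _, hκ, -⟩ := exists_chart isOpen_univ (Set.mem_univ (genericPoint V))
  obtain ⟨R'', μ, _, hμ, -⟩ := exists_chart isOpen_univ (Set.mem_univ (toAmbient i ξ))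
  have : IsDomain (Coord sV κ) := isDomain_coord κ ⟨_, hκ⟩
  obtain ⟨R', ι, _, hι, hιU, hικ⟩ := exists_chart_of_hom sX (toBase i) κ
    (μ.isOpenEmbedding.isOpen_range.preimage (toAmbient i).continuous) hμ (by rwa [hξη])
  have hιμ (p : PrimeSpectrum (Coord sX ι)) : toAmbient i (pt sX ι p) ∈ Set.range μ :=
    hιU (pt_mem sX ι p)
  obtain ⟨p, rfl⟩ := exists_pt sX ι hι
  obtain ⟨b, hb, h⟩ := exists_forall_exists_generic κ ι hπ hgen hικ hξη hξ
  let φ := chartMap ι κ (toBase i) hπ hικ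
  let ψ := chartMap ι μ (toAmbient i) ha hιμ
  let _ : Algebra (Coord sV κ) (Coord sX ι) := φ.toRingHom.toAlgebra
  have : IsScalarTower ℂ (Coord sV κ) (Coord sX ι) :=
    IsScalarTower.of_algebraMap_eq' φ.comp_algebraMap.symm
  have : Algebra.FiniteType (Coord sV κ) (Coord sX ι) :=
    Algebra.FiniteType.of_restrictScalars_finiteType ℂ _ _
  have : IsScalarTower ℂ (Coord sV κ) (Coord sX ι ⧸ p.asIdeal) := inferInstance
  have : Algebra.FiniteType (Coord sV κ) (Coord sX ι ⧸ p.asIdeal) := inferInstance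
  have hzX : f z ∈ Set.range ι := hz ▸ hι
  have hzV : (f ≫ toBase i) z ∈ Set.range κ := by
    rw [Scheme.Hom.comp_apply, hz]
    exact hικ p
  have hzY : (f ≫ toAmbient i) z ∈ Set.range μ := by
    rw [Scheme.Hom.comp_apply, hz]
    exact hιμ p
  let e := evalMap ι f hfX hzX
  have he : RingHom.ker e = p.asIdeal := ker_evalMap ι f hfX hzX hz.symm
  let α : (Coord sX ι ⧸ p.asIdeal) →ₐ[ℂ] Res s z :=
    Ideal.Quotient.liftₐ p.asIdeal e fun c hc ↦ RingHom.mem_ker.mp (he ▸ hc)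
  have hαV : α.comp (IsScalarTower.toAlgHom ℂ (Coord sV κ) (Coord sX ι ⧸ p.asIdeal)) =
      evalMap κ (f ≫ toBase i) hfV hzV :=
    evalMap_comp_chartMap ι κ f hfX (toBase i) hπ hικ hzX hzV
  let ρ : Coord sY μ →ₐ[ℂ] (Coord sX ι ⧸ p.asIdeal) := (Ideal.Quotient.mkₐ ℂ p.asIdeal).comp ψ
  have hαY : α.comp ρ = evalMap μ (f ≫ toAmbient i) hfY hzY :=
    evalMap_comp_chartMap ι μ f hfX (toAmbient i) ha hιμ hzX hzY
  have hαX : Set.range α = Set.range e := by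
    ext c
    constructor
    · rintro ⟨d, rfl⟩
      obtain ⟨d, rfl⟩ := Ideal.Quotient.mk_surjective d
      exact ⟨d, rfl⟩
    · rintro ⟨d, rfl⟩
      exact ⟨Ideal.Quotient.mk _ d, rfl⟩
  have hmk (Q : PrimeSpectrum (Coord sX ι)) (hQ : p.asIdeal ≤ Q.asIdeal) :
      (Q.asIdeal.map (Ideal.Quotient.mk p.asIdeal)).comap (Ideal.Quotient.mk p.asIdeal) =
        Q.asIdeal := by
    rw [Ideal.comap_map_of_surjective' _ Ideal.Quotient.mk_surjective, Ideal.mk_ker,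
      sup_eq_left.mpr hQ]
  have : Nonempty (PrimeSpectrum (Coord sX ι)) := ⟨p⟩
  choose! 𝔮 h𝔮 using h
  -- Only maximal ideals matter; the value `⊥` at ideals that are not prime is arbitrary.
  let 𝔔 (q : Ideal (Coord sV κ)) : Ideal (Coord sX ι ⧸ p.asIdeal) :=
    if hq : q.IsPrime then (𝔮 ⟨q, hq⟩).asIdeal.map (Ideal.Quotient.mk p.asIdeal) else ⊥
  have h𝔔 (q : Ideal (Coord sV κ)) (hq : q.IsPrime) :
      𝔔 q = (𝔮 ⟨q, hq⟩).asIdeal.map (Ideal.Quotient.mk p.asIdeal) := dif_pos hq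
  have hρ (q : PrimeSpectrum (Coord sV κ)) (hq : q.asIdeal.IsMaximal) (hbq : b ∉ q.asIdeal) :
      (𝔔 q.asIdeal).comap ρ = ((𝔮 q).comap ψ.toRingHom).asIdeal := by
    rw [h𝔔 _ q.2]
    ext c
    have h1 : ψ c ∈ ((𝔮 q).asIdeal.map (Ideal.Quotient.mk p.asIdeal)).comap
        (Ideal.Quotient.mk p.asIdeal) ↔ ψ c ∈ (𝔮 q).asIdeal := by rw [hmk _ (h𝔮 q hq hbq).1]
    exact h1
  have hbase (q : PrimeSpectrum (Coord sV κ)) (hq : q.asIdeal.IsMaximal) (hbq : b ∉ q.asIdeal) :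
      toBase i (pt sX ι (𝔮 q)) = pt sV κ q := by
    rw [map_pt ι κ (toBase i) hπ hικ, (h𝔮 q hq hbq).2.1]
  have hamb (q : PrimeSpectrum (Coord sV κ)) :
      toAmbient i (pt sX ι (𝔮 q)) = pt sY μ ((𝔮 q).comap ψ.toRingHom) :=
    map_pt ι μ (toAmbient i) ha hιμ _
  have hcl (q : PrimeSpectrum (Coord sV κ)) (hq : q.asIdeal.IsMaximal) : IsClosed {pt sV κ q} :=
    isClosed_pt sV κ q
  have htrB : tr ℂ (Coord sV κ) = tr ℂ (Res sV (genericPoint V)) := by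
    rw [← pt_bot (sV := sV) κ, tr_pt]
    exact (tr_eq_of_algEquiv (AlgEquiv.quotientBot ℂ _)).symm
  rw [← rk_union_range_evalMap κ (f ≫ toBase i) hfV hzV] at hE ⊢
  rw [← rk_union_range_evalMap ι f hfX hzX] at hE
  rw [← rk_union_range_evalMap μ (f ≫ toAmbient i) hfY hzY] at hS
  rw [← hαV] at hE ⊢
  rw [← hαY] at hS
  have hF := fun (F : Type) [Field F] [Algebra (Coord sV κ) F] hinj ↦
    isNilpotent_or_of_chart κ ι hgen hξ (Spec_map_chartMap ι κ (toBase i) hπ hικ) F hinj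
  have hA : tr ℂ (Coord sX ι ⧸ p.asIdeal) ≤ tr ℂ (Coord sV κ) + r := by
    rw [htrB, ← tr_pt sX ι, ← hξη]
    exact tr_le_tr_add sX sV (toBase i) hπ hr _
  have h𝔔' : ∀ q : Ideal (Coord sV κ), q.IsMaximal → b ∉ q → (𝔔 q).IsPrime ∧
      (𝔔 q).comap (algebraMap (Coord sV κ) (Coord sX ι ⧸ p.asIdeal)) = q ∧
      r ≤ tr ℂ (Coord sY μ ⧸ (𝔔 q).comap ρ) := by
    refine fun q hq hbq ↦ ⟨?_, ?_, ?_⟩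
    · rw [h𝔔 q hq.isPrime]
      exact Ideal.map_isPrime_of_surjective Ideal.Quotient.mk_surjective (by
        rw [Ideal.mk_ker]
        exact (h𝔮 _ hq hbq).1)
    · rw [h𝔔 q hq.isPrime]
      refine Eq.trans ?_ (congrArg PrimeSpectrum.asIdeal (h𝔮 ⟨q, hq.isPrime⟩ hq hbq).2.1)
      exact congrArg (Ideal.comap φ.toRingHom) (hmk _ (h𝔮 ⟨q, hq.isPrime⟩ hq hbq).1)
    · rw [hρ ⟨q, hq.isPrime⟩ hq hbq, ← tr_pt sY μ, ← hamb]
      obtain ⟨x, hx, hrx⟩ := exists_tr_ge sX (toBase i) (hcl ⟨q, hq.isPrime⟩ hq)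
        (hr _ (hcl ⟨q, hq.isPrime⟩ hq))
      have h1 := tr_family_le i (pt sX ι (𝔮 ⟨q, hq.isPrime⟩))
      rw [hbase ⟨q, hq.isPrime⟩ hq hbq,
        (isClosed_singleton_iff_tr_eq_zero sV).mp (hcl ⟨q, hq.isPrime⟩ hq), zero_add] at h1
      exact (hrx.trans (tr_res_le_of_specializes sX
        ((h𝔮 ⟨q, hq.isPrime⟩ hq hbq).2.2.1 x hx))).trans h1
  have hfin : ∀ 𝔭 : Ideal (Coord sY μ),
      {q : Ideal (Coord sV κ) | q.IsMaximal ∧ b ∉ q ∧ (𝔔 q).comap ρ = 𝔭}.Finite := by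
    intro 𝔭
    by_cases h𝔭 : 𝔭.IsPrime
    -- Members whose generic points have the same image in `Y` have the same cycle, so the fiber of
    -- `chowMap` over `c` bounds their number.
    · let c : AlgebraicCycle (ProjSpace N) ℕ :=
        Function.locallyFinsuppWithin.single (j (pt sY μ ⟨𝔭, h𝔭⟩)) 1
      have hfin := ((hmax c).image Subtype.val).preimage (pt_injective sV κ).injOn
      refine (hfin.image PrimeSpectrum.asIdeal).subset ?_
      rintro q ⟨hq, hbq, hq𝔭⟩
      refine ⟨⟨q, hq.isPrime⟩, ?_, rfl⟩
      obtain ⟨hv, hc⟩ := exists_chowMap_eq i j (hcl ⟨q, hq.isPrime⟩ hq)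
        (hbase ⟨q, hq.isPrime⟩ hq hbq) (h𝔮 ⟨q, hq.isPrime⟩ hq hbq).2.2.1
      refine ⟨⟨_, hv⟩, ?_, rfl⟩
      rw [Set.mem_preimage, Set.mem_singleton_iff, hc, hamb]
      have h1 : (𝔮 ⟨q, hq.isPrime⟩).comap ψ.toRingHom = ⟨𝔭, h𝔭⟩ :=
        PrimeSpectrum.ext ((hρ ⟨q, hq.isPrime⟩ hq hbq).symm.trans hq𝔭)
      rw [h1]
    -- Contractions of primes are prime, so no other ideal occurs.
    · convert Set.finite_empty
      refine Set.eq_empty_of_forall_notMem ?_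
      rintro q ⟨hq, hbq, hq𝔭⟩
      refine h𝔭 ?_
      rw [← hq𝔭, hρ ⟨q, hq.isPrime⟩ hq hbq]
      exact PrimeSpectrum.isPrime _
  have hinj : Function.Injective
      (α.comp (IsScalarTower.toAlgHom ℂ (Coord sV κ) (Coord sX ι ⧸ p.asIdeal))) := by
    rw [hαV]
    refine (RingHom.injective_iff_ker_eq_bot (evalMap κ (f ≫ toBase i) hfV hzV).toRingHom).mpr ?_
    refine (ker_evalMap κ (f ≫ toBase i) hfV hzV (p := ⟨⊥, Ideal.isPrime_bot⟩) ?_)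
    rw [pt_bot, Scheme.Hom.comp_apply, hz, hξη]
  rw [← hαX] at hE
  clear_value α ρ 𝔔
  exact rk_union_le_of_finite hF hA ρ hb 𝔔 h𝔔' hfin α hinj D hD hE hS

end Family

end

/-! ### Rank inequalities for tuples of points. -/

section Rank

variable {k Ω : Type*} [Field k] [Field Ω] [Algebra k Ω] {n : ℕ} {B : Set Ω} {K Y : Fin n → Set Ω}
  {r : ℕ}

/-- Submodularity for `W` and `K`, which both contain `B`. -/
lemma rk_union_le_add {W K : Set Ω} (hW : B ⊆ W) (hK : B ⊆ K) (hB : rk k B ≠ ⊤)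
    (hr : rk k K ≤ rk k B + r) : rk k (W ∪ K) ≤ rk k W + r := by
  have h1 := rk_submod (k := k) W K
  have h2 : rk k B ≤ rk k (W ∩ K) := rk_mono (Set.subset_inter hW hK)
  rw [← ENat.add_le_add_iff_left hB]
  calc rk k B + rk k (W ∪ K) ≤ rk k (W ∩ K) + rk k (W ∪ K) := by gcongr
    _ ≤ rk k W + rk k K := h1
    _ ≤ rk k W + (rk k B + r) := by gcongr
    _ = rk k B + (rk k W + r) := by ring

lemma rk_biUnion_le (hBK : ∀ i, B ⊆ K i) (hB : rk k B ≠ ⊤) (hr : ∀ i, rk k (K i) ≤ rk k B + r)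
    {W : Set Ω} (hW : B ⊆ W) (T : Finset (Fin n)) :
    rk k (W ∪ ⋃ i ∈ T, K i) ≤ rk k W + (T.card * r : ℕ) := by
  classical
  induction T using Finset.induction_on with
  | empty => simp
  | insert i T hi ih =>
    rw [Finset.set_biUnion_insert, Set.union_comm (K i), ← Set.union_assoc,
      Finset.card_insert_of_notMem hi]
    refine (rk_union_le_add (hW.trans Set.subset_union_left) (hBK i) hB (hr i)).trans ?_
    calc _ ≤ rk k W + (T.card * r : ℕ) + r := by gcongr
      _ = _ := by push_cast; ring

/-- In the presence of `B` each `Y i` can be replaced by `K i`, one index at a time. -/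
lemma rk_biUnion_eq (hBK : ∀ i, B ⊆ K i) (hYK : ∀ i, Y i ⊆ K i)
    (h : ∀ i, rk k (K i) = rk k (B ∪ Y i)) (hfin : ∀ i, rk k (K i) ≠ ⊤) (T : Finset (Fin n))
    (U : Set Ω) : rk k (B ∪ (⋃ i ∈ T, Y i) ∪ U) = rk k (B ∪ (⋃ i ∈ T, K i) ∪ U) := by
  classical
  induction T using Finset.induction_on generalizing U with
  | empty => simp
  | insert i T hi ih =>
    rw [Finset.set_biUnion_insert, Finset.set_biUnion_insert]
    have h1 := rk_union_eq_of_rk_eq (U := (⋃ i ∈ T, Y i) ∪ U)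
      (Set.union_subset (hBK i) (hYK i)) (h i) (h i ▸ hfin i)
    have h2 : B ∪ (Y i ∪ ⋃ i ∈ T, Y i) ∪ U = B ∪ Y i ∪ ((⋃ i ∈ T, Y i) ∪ U) := by
      simp only [Set.union_assoc]
    have h3 : K i ∪ ((⋃ i ∈ T, Y i) ∪ U) = B ∪ (⋃ i ∈ T, Y i) ∪ (K i ∪ U) := by
      rw [← Set.union_eq_self_of_subset_left (hBK i)]
      simp only [Set.union_assoc, Set.union_left_comm, Set.union_comm]
      simp only [← Set.union_assoc, Set.union_self]
    rw [h2, ← h1, h3, ih]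
    congr 1
    simp only [Set.union_assoc, Set.union_left_comm, Set.union_comm]

/-- Each `K i` adds at most `r` to the rank of `B`, and the total `n * (r + 1)` leaves no slack in
any of these inequalities. -/
lemma rk_biUnion_of_max (hBK : ∀ i, B ⊆ K i) (hB : rk k B ≠ ⊤) (hr : ∀ i, rk k (K i) ≤ rk k B + r)
    (hBn : rk k B ≤ n) (hmax : ((n * (r + 1) : ℕ) : ℕ∞) ≤ rk k (B ∪ ⋃ i ∈ Finset.univ, K i))
    (T : Finset (Fin n)) : rk k (B ∪ ⋃ i ∈ T, K i) = (n + T.card * r : ℕ) := by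
  classical
  apply le_antisymm
  · refine (rk_biUnion_le hBK hB hr subset_rfl T).trans ?_
    push_cast
    gcongr
  · have h1 := rk_biUnion_le hBK hB hr (W := B ∪ ⋃ i ∈ T, K i) Set.subset_union_left Tᶜ
    have h2 : (B ∪ ⋃ i ∈ T, K i) ∪ ⋃ i ∈ Tᶜ, K i = B ∪ ⋃ i ∈ Finset.univ, K i := by
      rw [Set.union_assoc, ← Finset.set_biUnion_union, Finset.union_compl]
    rw [h2] at h1
    have h3 := hmax.trans h1
    have hfin : rk k (B ∪ ⋃ i ∈ T, K i) ≠ ⊤ := by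
      refine ne_top_of_le_ne_top ?_ (rk_biUnion_le hBK hB hr subset_rfl T)
      exact WithTop.add_ne_top.mpr ⟨hB, ENat.natCast_ne_top _⟩
    lift rk k (B ∪ ⋃ i ∈ T, K i) to ℕ using hfin with a
    rw [Finset.card_compl, Fintype.card_fin] at h3
    have h4 : T.card ≤ n := by simpa using Finset.card_le_univ T
    norm_cast at h3 ⊢
    obtain ⟨c, hc⟩ := Nat.exists_eq_add_of_le h4
    have h5 : n - T.card = c := by lia
    have h6 : n * (r + 1) = n + T.card * r + c * r := by
      calc n * (r + 1) = n * r + n := by ring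
        _ = (T.card + c) * r + n := by rw [← hc]
        _ = _ := by ring
    rw [h5, h6] at h3
    lia

/-- If adjoining the sets `Y i` one by one either raises the rank by more than `r` or captures `B`,
then the union of the `Y i` has full rank. -/
lemma le_rk_biUnion (hBK : ∀ i, B ⊆ K i) (hYK : ∀ i, Y i ⊆ K i) (hB : rk k B ≠ ⊤)
    (hr : ∀ i, rk k (K i) ≤ rk k B + r)
    (h : ∀ i, rk k (K i) = rk k (B ∪ Y i))
    (hBn : rk k B ≤ n) (hmax : ((n * (r + 1) : ℕ) : ℕ∞) ≤ rk k (B ∪ ⋃ i ∈ Finset.univ, K i))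
    (hdrop : ∀ (T : Finset (Fin n)) (j : Fin n),
      rk k ((⋃ i ∈ T, Y i) ∪ B) + r ≤ rk k ((⋃ i ∈ T, Y i) ∪ K j) →
      rk k ((⋃ i ∈ T, Y i) ∪ Y j) ≤ rk k (⋃ i ∈ T, Y i) + r →
      rk k ((⋃ i ∈ T, Y i) ∪ B) ≤ rk k (⋃ i ∈ T, Y i)) (T : Finset (Fin n)) :
    ((T.card * (r + 1) : ℕ) : ℕ∞) ≤ rk k (⋃ i ∈ T, Y i) := by
  classical
  have hfin (i) : rk k (K i) ≠ ⊤ :=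
    ne_top_of_le_ne_top (WithTop.add_ne_top.mpr ⟨hB, ENat.natCast_ne_top _⟩) (hr i)
  have hU := rk_biUnion_of_max hBK hB hr hBn hmax
  have hE (T : Finset (Fin n)) : rk k ((⋃ i ∈ T, Y i) ∪ B) = (n + T.card * r : ℕ) := by
    have h1 := rk_biUnion_eq hBK hYK h hfin T ∅
    rw [Set.union_empty, Set.union_empty, hU] at h1
    rw [Set.union_comm, h1]
  induction T using Finset.induction_on with
  | empty => simp
  | insert j T hj ih =>
    have h1 : ⋃ i ∈ insert j T, Y i = (⋃ i ∈ T, Y i) ∪ Y j := by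
      rw [Finset.set_biUnion_insert, Set.union_comm]
    have hcard : T.card + 1 ≤ n := by
      rw [← Finset.card_insert_of_notMem hj]
      simpa using Finset.card_le_univ (insert j T)
    have hTfin : rk k (⋃ i ∈ T, Y i) ≠ ⊤ :=
      ne_top_of_le_ne_top (hE T ▸ ENat.natCast_ne_top _) (rk_mono Set.subset_union_left)
    rw [h1, Finset.card_insert_of_notMem hj]
    -- Either `Y j` adds at most `r`, and then `B` is captured already, or it adds at least `r + 1`.
    by_cases hle : rk k ((⋃ i ∈ T, Y i) ∪ Y j) ≤ rk k (⋃ i ∈ T, Y i) + r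
    · have h2 : rk k ((⋃ i ∈ T, Y i) ∪ B) + r ≤ rk k ((⋃ i ∈ T, Y i) ∪ K j) := by
        have h3 : rk k (B ∪ (⋃ i ∈ T, Y i) ∪ K j) = rk k ((⋃ i ∈ T, Y i) ∪ K j) := by
          congr 1
          rw [Set.union_comm B, Set.union_assoc, Set.union_eq_self_of_subset_left (hBK j)]
        rw [← h3, rk_biUnion_eq hBK hYK h hfin, hE T, Set.union_assoc, Set.union_comm _ (K j),
          ← Finset.set_biUnion_insert, hU, Finset.card_insert_of_notMem hj]
        norm_cast
        nlinarith
      have h4 : rk k ((⋃ i ∈ T, Y i) ∪ B) = rk k (⋃ i ∈ T, Y i) :=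
        le_antisymm (hdrop T j h2 hle) (rk_mono Set.subset_union_left)
      have h5 := rk_union_eq_of_rk_eq (U := Y j) Set.subset_union_left h4 hTfin
      have h6 : (⋃ i ∈ T, Y i) ∪ B ∪ Y j = (⋃ i ∈ insert j T, Y i) ∪ B := by
        rw [h1, Set.union_assoc, Set.union_assoc, Set.union_comm B]
      -- With `B` captured, the rank is `n + (T.card + 1) * r`, which suffices because `T.card + 1 ≤
      -- n`.
      rw [← h5, h6, hE, Finset.card_insert_of_notMem hj]
      norm_cast
      nlinarith
    · have h2 := Order.add_one_le_of_lt (not_le.mp hle)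
      refine le_trans ?_ h2
      push_cast at ih ⊢
      calc _ = ((T.card : ℕ∞) * (r + 1)) + r + 1 := by ring
        _ ≤ _ := by gcongr

end Rank

/-! ### Residue fields under composition of morphisms. -/

section Points

variable {Z T S : Scheme.{0}} {s : Z ⟶ SpecC} {t : T ⟶ SpecC} {u : S ⟶ SpecC}

lemma resMap_comp (f : Z ⟶ T) (g : T ⟶ S) (hf : f ≫ t = s) (hg : g ≫ u = t)
    (hfg : (f ≫ g) ≫ u = s) (z : Z) (c : Res u (g (f z))) :
    resMap s u (f ≫ g) hfg z c = resMap s t f hf z (resMap t u g hg (f z) c) :=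
  congrArg (fun h : S.residueField (g (f z)) ⟶ Z.residueField z ↦ h.hom c)
    (Scheme.residueFieldMap_comp f g z)

lemma range_resMap_comp_subset (f : Z ⟶ T) (g : T ⟶ S) (hf : f ≫ t = s) (hg : g ≫ u = t)
    (hfg : (f ≫ g) ≫ u = s) (z : Z) :
    Set.range (resMap s u (f ≫ g) hfg z) ⊆ Set.range (resMap s t f hf z) := by
  rintro _ ⟨c, rfl⟩
  exact ⟨_, (resMap_comp f g hf hg hfg z c).symm⟩

lemma range_resMap_congr {f g : Z ⟶ T} (h : f = g) (hf : f ≫ t = s) (hg : g ≫ t = s) (z : Z) :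
    Set.range (resMap s t f hf z) = Set.range (resMap s t g hg z) := by
  subst h
  rfl

lemma rk_range_resMap (f : Z ⟶ T) (hf : f ≫ t = s) (z : Z) :
    rk ℂ (Set.range (resMap s t f hf z)) = tr ℂ (Res t (f z)) :=
  rk_range _ (resMap s t f hf z).toRingHom.injective

/-- The residue fields of finitely many points can be replaced by a finitely generated algebra. -/
lemma exists_fg_rk_eq [LocallyOfFiniteType t] {n : ℕ} (f : Fin n → (Z ⟶ T))
    (hf : ∀ k, f k ≫ t = s) (z : Z) (A : Finset (Fin n)) :
    ∃ D : Subalgebra ℂ (Res s z), D.FG ∧ ∀ U : Set (Res s z),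
      rk ℂ ((D : Set (Res s z)) ∪ U) = rk ℂ ((⋃ k ∈ A, Set.range (resMap s t (f k) (hf k) z)) ∪ U) := by
  classical
  induction A using Finset.induction_on with
  | empty =>
    refine ⟨⊥, Subalgebra.fg_bot, fun U ↦ ?_⟩
    simp only [Finset.notMem_empty, Set.iUnion_of_empty, Set.iUnion_empty, Set.empty_union]
    refine rk_eq_of_isAlgebraic Set.subset_union_right ?_
    rintro x (hx | hx)
    · obtain ⟨c, rfl⟩ := Algebra.mem_bot.mp hx
      exact isAlgebraic_algebraMap (R := Algebra.adjoin ℂ U) ⟨_, Subalgebra.algebraMap_mem _ c⟩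
    · exact isAlgebraic_algebraMap (R := Algebra.adjoin ℂ U) ⟨x, Algebra.subset_adjoin hx⟩
  | insert k A hk ih =>
    obtain ⟨D, hD, h⟩ := ih
    obtain ⟨R, κ, _, hκ, -⟩ := exists_chart isOpen_univ (Set.mem_univ (f k z))
    let e := evalMap κ (f k) (hf k) hκ
    have he : e.range.FG := by
      rw [Subalgebra.fg_iff_finiteType]
      exact .of_surjective e.rangeRestrict e.rangeRestrict_surjective
    refine ⟨D ⊔ e.range, hD.sup he, fun U ↦ ?_⟩
    have h1 : rk ℂ (((D ⊔ e.range : Subalgebra ℂ (Res s z)) : Set (Res s z)) ∪ U) =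
        rk ℂ ((D : Set (Res s z)) ∪ Set.range e ∪ U) := by
      refine rk_eq_of_isAlgebraic (Set.union_subset_union_left _
        (Set.union_subset (le_sup_left (a := D)) (le_sup_right (b := e.range)))) ?_
      intro x hx
      have hx' : x ∈ Algebra.adjoin ℂ ((D : Set (Res s z)) ∪ Set.range e ∪ U) := by
        rcases hx with hx | hx
        · have h2 : D ⊔ e.range ≤ Algebra.adjoin ℂ ((D : Set (Res s z)) ∪ Set.range e ∪ U) :=
            sup_le (fun d hd ↦ Algebra.subset_adjoin (.inl (.inl hd)))
              (fun d hd ↦ Algebra.subset_adjoin (.inl (.inr hd)))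
          exact h2 hx
        · exact Algebra.subset_adjoin (.inr hx)
      exact isAlgebraic_algebraMap (R := Algebra.adjoin ℂ ((D : Set (Res s z)) ∪ Set.range e ∪ U))
        ⟨x, hx'⟩
    rw [h1, Finset.set_biUnion_insert, Set.union_right_comm, rk_union_range_evalMap, Set.union_assoc,
      h]
    congr 1
    ext x
    simp only [Set.mem_union]
    tauto

end Points

/-! ### A point of maximal transcendence degree in the fiber power. -/

lemma exists_algHom_of_isTranscendenceBasis {ι F K M : Type*} [Field F] [Field K] [Field M]
    [IsAlgClosed M] [Algebra F K] [Algebra F M] {x : ι → K} (hx : IsTranscendenceBasis F x)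
    {y : ι → M} (hy : AlgebraicIndependent F y) : ∃ φ : K →ₐ[F] M, ∀ i, φ (x i) = y i := by
  let _ : Algebra (MvPolynomial ι F) K := (MvPolynomial.aeval (R := F) x).toRingHom.toAlgebra
  let _ : Algebra (MvPolynomial ι F) M := (MvPolynomial.aeval y).toRingHom.toAlgebra
  have h1 : IsScalarTower F (MvPolynomial ι F) K :=
    .of_algebraMap_eq' (MvPolynomial.aeval (R := F) x).comp_algebraMap.symm
  have h2 : IsScalarTower F (MvPolynomial ι F) M :=
    .of_algebraMap_eq' (MvPolynomial.aeval y).comp_algebraMap.symm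
  have : FaithfulSMul (MvPolynomial ι F) K := (faithfulSMul_iff_algebraMap_injective _ _).mpr hx.1
  have : FaithfulSMul (MvPolynomial ι F) M := (faithfulSMul_iff_algebraMap_injective _ _).mpr hy
  have : Algebra.IsAlgebraic (MvPolynomial ι F) K := by
    have h3 := hx.isAlgebraic
    refine ⟨fun t ↦ ?_⟩
    refine (isAlgebraic_ringHom_iff_of_comp_eq hx.1.aevalEquiv (RingHom.id K)
      Function.injective_id ?_).mp (h3.1 t)
    ext <;> simp [RingHom.algebraMap_toAlgebra]
  -- `K` is algebraic over the polynomial ring on the basis, so the map extends to the algebraically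
  -- closed field `M`.
  let φ : K →ₐ[MvPolynomial ι F] M := IsAlgClosed.lift
  refine ⟨φ.restrictScalars F, fun i ↦ ?_⟩
  have h4 := φ.commutes (MvPolynomial.X i)
  simpa [RingHom.algebraMap_toAlgebra] using h4

/-- Take `n` independent copies of a transcendence basis of `K` over `F` as variables; the `k`-th
embedding sends the basis to the `k`-th copy. -/
lemma exists_embeddings {F K : Type} [Field F] [Field K] [Algebra ℂ F] [Algebra ℂ K] [Algebra F K]
    [IsScalarTower ℂ F K] {r : ℕ} (hF : tr ℂ F ≠ ⊤) (hr : r + tr ℂ F ≤ tr ℂ K) (n : ℕ) :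
    ∃ (Ω : Type) (_ : Field Ω) (_ : Algebra ℂ Ω) (_ : Algebra F Ω) (_ : IsScalarTower ℂ F Ω)
      (φ : Fin n → (K →ₐ[F] Ω)),
      tr ℂ F + (n * r : ℕ) ≤ rk ℂ (Set.range (algebraMap F Ω) ∪ ⋃ k, Set.range (φ k)) := by
  obtain ⟨b, hb⟩ := exists_isTranscendenceBasis F K
  let P := MvPolynomial (Fin n × b) F
  let Ω := AlgebraicClosure (FractionRing P)
  let e : P →ₐ[F] Ω := IsScalarTower.toAlgHom F P Ω
  have he : Function.Injective e := by
    change Function.Injective (algebraMap P Ω)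
    rw [IsScalarTower.algebraMap_eq P (FractionRing P) Ω]
    exact (algebraMap (FractionRing P) Ω).injective.comp (IsFractionRing.injective P _)
  have hx (k : Fin n) : AlgebraicIndependent F fun i : b ↦ e (MvPolynomial.X (k, i)) := by
    have h1 : AlgebraicIndependent F (fun i : b ↦ (MvPolynomial.X (k, i) : P)) :=
      (MvPolynomial.algebraicIndependent_X (Fin n × b) F).comp _ (Prod.mk_right_injective k)
    exact h1.map' (f := e) he
  choose ψ hψ using fun k ↦ exists_algHom_of_isTranscendenceBasis hb (hx k)
  refine ⟨Ω, inferInstance, inferInstance, inferInstance, inferInstance, ψ, ?_⟩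
  rw [← rk_adjoin]
  have h1 : Set.range (e.restrictScalars ℂ) ⊆
      Algebra.adjoin ℂ (Set.range (algebraMap F Ω) ∪ ⋃ k, Set.range (ψ k)) := by
    rintro _ ⟨p, rfl⟩
    change e p ∈ _
    induction p using MvPolynomial.induction_on with
    | C a =>
      refine Algebra.subset_adjoin (.inl ⟨a, ?_⟩)
      exact (e.commutes a).symm
    | add p q hp hq =>
      rw [map_add]
      exact add_mem hp hq
    | mul_X p i hp =>
      rw [map_mul]
      exact mul_mem hp (Algebra.subset_adjoin (.inr (Set.mem_iUnion.mpr ⟨i.1, i.2, hψ i.1 i.2⟩)))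
  refine le_trans ?_ (rk_mono h1)
  rw [rk_range (e.restrictScalars ℂ) he]
  have h2 : tr ℂ P = tr ℂ F + n * Cardinal.toENat (Cardinal.mk b) := by
    rw [tr, ← trdeg_add_eq ℂ F (A := P), MvPolynomial.trdeg_of_isDomain]
    simp [tr]
  have h3 : tr ℂ K = tr ℂ F + Cardinal.toENat (Cardinal.mk b) := by
    rw [tr, ← trdeg_add_eq ℂ F (A := K), hb.cardinalMk_eq_trdeg]
    simp [tr]
  rw [h3, add_comm, ENat.add_le_add_iff_left hF] at hr
  rw [h2]
  push_cast
  gcongr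

variable {Z : Scheme.{0}}

lemma range_eq_of_res {s : Z ⟶ SpecC} {K : Type} [Field K] {x y : Z} (a : Res s x →+* K)
    (b : Res s y →+* K)
    (h : Spec.map (CommRingCat.ofHom a) ≫ res s x = Spec.map (CommRingCat.ofHom b) ≫ res s y) :
    x = y ∧ Set.range a = Set.range b := by
  have h1 := congrArg (fun g ↦ g (fieldPt K)) h
  simp only [Scheme.Hom.comp_apply, res_apply] at h1
  subst h1
  refine ⟨rfl, ?_⟩
  rw [cancel_mono] at h
  rw [ofHom_injective_of_spec h]

/-- Independent embeddings of the residue field of `ξ` over that of `f ξ` form a field-valued point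
of the fiber power. The residue field of its image contains all the embedded fields. -/
lemma exists_le_tr_fiberPower {X S : Scheme.{0}} {f : X ⟶ S} (sX : X ⟶ SpecC) (sS : S ⟶ SpecC)
    (hf : f ≫ sS = sX) {ξ : X} {r : ℕ} (hfin : tr ℂ (Res sS (f ξ)) ≠ ⊤)
    (hr : r + tr ℂ (Res sS (f ξ)) ≤ tr ℂ (Res sX ξ)) (n : ℕ) : ∃ z : fiberPower f n,
      tr ℂ (Res sS (f ξ)) + (n * r : ℕ) ≤ tr ℂ (Res (fpBase f n ≫ sS) z) := by
  let φ := resMap sX sS f hf ξ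
  let _ : Algebra (Res sS (f ξ)) (Res sX ξ) := φ.toRingHom.toAlgebra
  have : IsScalarTower ℂ (Res sS (f ξ)) (Res sX ξ) := .of_algebraMap_eq' φ.comp_algebraMap.symm
  obtain ⟨Ω, _, _, _, _, ψ, h⟩ := exists_embeddings hfin hr n
  let a (k : Fin n) : Spec (.of Ω) ⟶ X := Spec.map (CommRingCat.ofHom (ψ k).toRingHom) ≫ res sX ξ
  let b : Spec (.of Ω) ⟶ S :=
    Spec.map (CommRingCat.ofHom (algebraMap (Res sS (f ξ)) Ω)) ≫ res sS (f ξ)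
  have hab (k : Fin n) : a k ≫ f = b := by
    change (_ ≫ _) ≫ _ = _ ≫ _
    rw [Category.assoc, ← Spec_map_resMap_res sX sS f hf, ← Category.assoc, ← Spec.map_comp,
      ← CommRingCat.ofHom_comp]
    congr 3
    exact (ψ k).comp_algebraMap
  let s := fpBase f n ≫ sS
  obtain ⟨z, u, hu, -⟩ := exists_res_factor s (fpLift b a hab)
  have hu1 : u.comp (algebraMap ℂ (Res s z)) = algebraMap ℂ Ω := by
    apply ofHom_injective_of_spec
    rw [CommRingCat.ofHom_comp, Spec.map_comp, ← res_comp, ← Category.assoc, hu,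
      ← Category.assoc, fpLift_base]
    change (_ ≫ _) ≫ _ = _
    rw [Category.assoc, res_comp, ← Spec.map_comp, ← CommRingCat.ofHom_comp,
      ← IsScalarTower.algebraMap_eq]
  let u' : Res s z →ₐ[ℂ] Ω := { u with commutes' := fun c ↦ congrArg (fun g ↦ g c) hu1 }
  refine ⟨z, h.trans (le_trans (rk_mono ?_) (rk_range_le_tr u'))⟩
  refine Set.union_subset ?_ (Set.iUnion_subset fun k ↦ ?_)
  · have h1 := (range_eq_of_res (s := sS) (algebraMap (Res sS (f ξ)) Ω)
      (u.comp (resMap s sS (fpBase f n) rfl z).toRingHom) ?_).2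
    · rw [h1]
      rintro _ ⟨c, rfl⟩
      exact ⟨_, rfl⟩
    · rw [CommRingCat.ofHom_comp, Spec.map_comp, Category.assoc, Spec_map_resMap_res,
        ← Category.assoc, hu, fpLift_base]
  · have h1 := (range_eq_of_res (s := sX) (ψ k).toRingHom
      (u.comp (resMap s sX (fpπ f n k) (by rw [← hf, ← Category.assoc, fpπ_comp]) z).toRingHom) ?_).2
    · refine h1.subset.trans ?_
      rintro _ ⟨c, rfl⟩
      exact ⟨_, rfl⟩
    · rw [CommRingCat.ofHom_comp, Spec.map_comp, Category.assoc, Spec_map_resMap_res,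
        ← Category.assoc, hu, fpLift_π]

/-! ### Upper bound for the fiber power. -/

section UpperBound

variable {X S : Scheme.{0}} {f : X ⟶ S} {n : ℕ} (sX : X ⟶ SpecC) (sS : S ⟶ SpecC)

lemma fpπ_comp_structure (hf : f ≫ sS = sX) (k : Fin n) :
    fpπ f n k ≫ sX = fpBase f n ≫ sS := by
  rw [← hf, ← Category.assoc, fpπ_comp]

lemma apply_fpπ (z : fiberPower f n) (k : Fin n) : f (fpπ f n k z) = fpBase f n z := by
  rw [← Scheme.Hom.comp_apply, fpπ_comp]

lemma range_fpBase_subset (hf : f ≫ sS = sX) (z : fiberPower f n) (k : Fin n) :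
    Set.range (resMap (fpBase f n ≫ sS) sS (fpBase f n) rfl z) ⊆
      Set.range (resMap (fpBase f n ≫ sS) sX (fpπ f n k) (fpπ_comp_structure sX sS hf k) z) := by
  rw [range_resMap_congr (fpπ_comp k).symm rfl (by rw [fpπ_comp])]
  exact range_resMap_comp_subset _ _ _ hf _ _

lemma rk_range_fpπ_le (hf : f ≫ sS = sX) {r : ℕ}
    (hr : ∀ x, tr ℂ (Res sX x) ≤ tr ℂ (Res sS (f x)) + r) (z : fiberPower f n) (k : Fin n) :
    rk ℂ (Set.range (resMap (fpBase f n ≫ sS) sX (fpπ f n k) (fpπ_comp_structure sX sS hf k) z)) ≤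
      rk ℂ (Set.range (resMap (fpBase f n ≫ sS) sS (fpBase f n) rfl z)) + r := by
  rw [rk_range_resMap, rk_range_resMap]
  refine (hr _).trans ?_
  rw [apply_fpπ]

lemma rk_union_fpπ (hf : f ≫ sS = sX) (z : fiberPower f n) :
    rk ℂ (Set.range (resMap (fpBase f n ≫ sS) sS (fpBase f n) rfl z) ∪ ⋃ k ∈ Finset.univ,
      Set.range (resMap (fpBase f n ≫ sS) sX (fpπ f n k) (fpπ_comp_structure sX sS hf k) z)) =
      tr ℂ (Res (fpBase f n ≫ sS) z) :=
  rk_fiberPower sX sS hf z _ Set.subset_union_left fun k ↦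
    fun _ hc ↦ .inr (Set.mem_iUnion₂.mpr ⟨k, Finset.mem_univ k, hc⟩)

lemma rk_range_fpBase_ne_top [LocallyOfFiniteType sS] (z : fiberPower f n) :
    rk ℂ (Set.range (resMap (fpBase f n ≫ sS) sS (fpBase f n) rfl z)) ≠ ⊤ := by
  rw [rk_range_resMap]
  exact tr_res_ne_top _ _

lemma tr_fiberPower_le [LocallyOfFiniteType sS] (hf : f ≫ sS = sX) {r : ℕ}
    (hr : ∀ x, tr ℂ (Res sX x) ≤ tr ℂ (Res sS (f x)) + r) (z : fiberPower f n) :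
    tr ℂ (Res (fpBase f n ≫ sS) z) ≤ tr ℂ (Res sS (fpBase f n z)) + (n * r : ℕ) := by
  rw [← rk_union_fpπ sX sS hf, ← rk_range_resMap (fpBase f n) (rfl : _ = fpBase f n ≫ sS) z]
  refine (rk_biUnion_le (range_fpBase_subset sX sS hf z) (rk_range_fpBase_ne_top sS z)
    (rk_range_fpπ_le sX sS hf hr z) subset_rfl Finset.univ).trans ?_
  rw [Finset.card_univ, Fintype.card_fin]

end UpperBound

/-! ### Transcendence degree of the image in the power of `Y`. -/

section Family

variable {V Y X : Scheme.{0}} {sV : V ⟶ SpecC} {sY : Y ⟶ SpecC} (i : X ⟶ pullback sV sY) (n : ℕ)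

lemma rho_comp_fpπ (k : Fin n) :
    rho i n ≫ fpπ sY n k = fpπ (toBase i) n k ≫ toAmbient i :=
  fpLift_π _ _ _ k

lemma rho_comp_fpBase : rho i n ≫ fpBase sY n = fpBase (toBase i) n ≫ sV :=
  fpLift_base _ _ _

lemma fpπ_toAmbient_comp (k : Fin n) :
    (fpπ (toBase i) n k ≫ toAmbient i) ≫ sY = fpBase (toBase i) n ≫ sV := by
  rw [Category.assoc, ← toBase_comp, ← Category.assoc, fpπ_comp]

lemma range_toAmbient_subset_range_rho (z : fiberPower (toBase i) n) (k : Fin n) :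
    Set.range (resMap (fpBase (toBase i) n ≫ sV) sY (fpπ (toBase i) n k ≫ toAmbient i)
      (fpπ_toAmbient_comp i n k) z) ⊆
      Set.range (resMap _ (fpBase sY n) (rho i n) (rho_comp_fpBase i n) z) := by
  rw [range_resMap_congr (rho_comp_fpπ i n k).symm _
    (by rw [rho_comp_fpπ, fpπ_toAmbient_comp])]
  exact range_resMap_comp_subset _ _ _ (fpπ_comp k) _ _

lemma rk_range_fpπ_eq [IsImmersion i] (z : fiberPower (toBase i) n) (k : Fin n) :
    rk ℂ (Set.range (resMap (fpBase (toBase i) n ≫ sV) (toBase i ≫ sV) (fpπ (toBase i) n k)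
      (fpπ_comp_structure (toBase i ≫ sV) sV rfl k) z)) =
    rk ℂ (Set.range (resMap (fpBase (toBase i) n ≫ sV) sV (fpBase (toBase i) n) rfl z) ∪
      Set.range (resMap (fpBase (toBase i) n ≫ sV) sY (fpπ (toBase i) n k ≫ toAmbient i)
        (fpπ_toAmbient_comp i n k) z)) := by
  let x := fpπ (toBase i) n k z
  let φ := resMap (fpBase (toBase i) n ≫ sV) (toBase i ≫ sV) (fpπ (toBase i) n k)
      (fpπ_comp_structure (toBase i ≫ sV) sV rfl k) z
  rw [rk_range_resMap, ← rk_family i x _ Set.subset_union_left Set.subset_union_right,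
    ← rk_image φ φ.toRingHom.injective, Set.image_union,
    range_resMap_congr (fpπ_comp k).symm rfl (by rw [fpπ_comp])]
  congr 2
  · rw [← Set.range_comp]
    congr 1
    exact funext fun c ↦ (resMap_comp _ _ _ _ _ _ c).symm
  · rw [← Set.range_comp]
    congr 1
    exact funext fun c ↦ (resMap_comp _ _ _ _ _ _ c).symm

/-- A point of maximal transcendence degree of the fiber power has generic components. -/
lemma fpπ_eq_of_le_tr [IsIntegral V] [LocallyOfFiniteType sV]
    [LocallyOfFiniteType (toBase i ≫ sV)] {r : ℕ}
    (hr : ∀ x, tr ℂ (Res (toBase i ≫ sV) x) ≤ tr ℂ (Res sV (toBase i x)) + r)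
    (hη : tr ℂ (Res sV (genericPoint V)) = n) {ξ : X} (hξη : toBase i ξ = genericPoint V)
    (hξ : ∀ x, toBase i x = genericPoint V → ξ ⤳ x) {z : fiberPower (toBase i) n}
    (hz : ((n * (r + 1) : ℕ) : ℕ∞) ≤ tr ℂ (Res (fpBase (toBase i) n ≫ sV) z)) (k : Fin n) :
    fpπ (toBase i) n k z = ξ := by
  -- The fibers account for at most `n * r`, so the base point has degree at least `n` and is
  -- generic.
  have h0 : n ≤ tr ℂ (Res sV (fpBase (toBase i) n z)) := by
    have h1 := hz.trans (tr_fiberPower_le _ sV rfl hr z)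
    rw [mul_add, mul_one, add_comm, Nat.cast_add] at h1
    exact (ENat.add_le_add_iff_right (ENat.natCast_ne_top _)).mp h1
  have h1 : genericPoint V = fpBase (toBase i) n z :=
    eq_of_specializes_of_tr_le sV (genericPoint_specializes _) (hη ▸ h0)
  refine (eq_of_specializes_of_tr_le (toBase i ≫ sV) (hξ _ ((apply_fpπ z k).trans h1.symm)) ?_).symm
  -- Applied to one index, this gives the component the degree `n + r`, which bounds that of `ξ`.
  have h2 := rk_biUnion_of_max (range_fpBase_subset (toBase i ≫ sV) sV rfl z)
    (rk_range_fpBase_ne_top sV z) (rk_range_fpπ_le _ sV rfl hr z) (n := n)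
    (by rw [rk_range_resMap, ← h1, hη]) (by rwa [rk_union_fpπ (toBase i ≫ sV) sV rfl]) {k}
  rw [Finset.set_biUnion_singleton,
    Set.union_eq_self_of_subset_left (range_fpBase_subset (toBase i ≫ sV) sV rfl z k),
    rk_range_resMap] at h2
  rw [h2]
  refine (hr ξ).trans ?_
  rw [hξη, hη]
  simp

/-- The residue field of the image point contains that of every component in `Y`. These have full
rank by `le_rk_biUnion`, whose last condition is supplied by maximal variation. -/
theorem le_tr_rho [IsImmersion i] [LocallyOfFiniteType sV]
    [LocallyOfFiniteType sY] [LocallyOfFiniteType (toBase i ≫ sV)] [IsIntegral V]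
    [TopologicalSpace.NoetherianSpace X]
    (hgen : GeometricallyIrreducible ((toBase i).fiberToSpecResidueField (genericPoint V)))
    {N : ℕ} (j : Y ⟶ ProjSpace N) (hmax : IsMaximallyVarying i j) {r : ℕ}
    (hr : ∀ v : V, IsClosed {v} →
      topologicalKrullDim ↥(toBase i ⁻¹' {v}) = (r : WithBot ℕ∞))
    (hr' : ∀ x, tr ℂ (Res (toBase i ≫ sV) x) ≤ tr ℂ (Res sV (toBase i x)) + r)
    (hη : tr ℂ (Res sV (genericPoint V)) = n)
    {ξ : X} (hξη : toBase i ξ = genericPoint V)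
    (hξ : ∀ x, toBase i x = genericPoint V → ξ ⤳ x) {z : fiberPower (toBase i) n}
    (hz : ((n * (r + 1) : ℕ) : ℕ∞) ≤ tr ℂ (Res (fpBase (toBase i) n ≫ sV) z)) :
    ((n * (r + 1) : ℕ) : ℕ∞) ≤ tr ℂ (Res (fpBase sY n) (rho i n z)) := by
  have hx := fpπ_eq_of_le_tr i n hr' hη hξη hξ hz
  have h1 := le_rk_biUnion (k := ℂ) (n := n) (r := r)
    (B := Set.range (resMap (fpBase (toBase i) n ≫ sV) sV (fpBase (toBase i) n) rfl z))
    (K := fun k ↦ Set.range (resMap (fpBase (toBase i) n ≫ sV) (toBase i ≫ sV)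
      (fpπ (toBase i) n k) (fpπ_comp_structure (toBase i ≫ sV) sV rfl k) z))
    (Y := fun k ↦ Set.range (resMap (fpBase (toBase i) n ≫ sV) sY
      (fpπ (toBase i) n k ≫ toAmbient i) (fpπ_toAmbient_comp i n k) z))
    (range_fpBase_subset (toBase i ≫ sV) sV rfl z)
    (fun k ↦ range_resMap_comp_subset _ _ _ (toBase_comp i).symm _ _)
    (rk_range_fpBase_ne_top sV z)
    (rk_range_fpπ_le _ sV rfl hr' z)
    (rk_range_fpπ_eq i n z) ?_ ?_ ?_ Finset.univ
  · rw [Finset.card_univ, Fintype.card_fin] at h1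
    refine h1.trans ?_
    rw [← rk_range_resMap (rho i n) (rho_comp_fpBase i n) z]
    exact rk_mono (Set.iUnion₂_subset fun k _ ↦ range_toAmbient_subset_range_rho i n z k)
  · rw [rk_range_resMap]
    refine (tr_res_le_of_specializes sV (genericPoint_specializes _)).trans hη.le
  · rwa [rk_union_fpπ (toBase i ≫ sV) sV rfl]
  · intro T k hE hS
    -- The key step requires a finitely generated algebra in place of the residue fields of the
    -- points in `T`.
    obtain ⟨D, hD, h⟩ := exists_fg_rk_eq (fun k ↦ fpπ (toBase i) n k ≫ toAmbient i)
      (fpπ_toAmbient_comp i n) z T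
    have h0 := h ∅
    rw [Set.union_empty, Set.union_empty] at h0
    rw [← h, ← h] at hE
    rw [← h, ← h0] at hS
    rw [← h, ← h0]
    have hB := range_resMap_congr (fpπ_comp (f := toBase i) k).symm
      (rfl : fpBase (toBase i) n ≫ sV = _) (by rw [fpπ_comp]) z
    rw [hB] at hE ⊢
    exact rk_union_le_of_isMaximallyVarying i hgen j hmax hr hξη hξ (fpπ (toBase i) n k) _ _ _
      (hx k) D hD hE hS

end Family

/-! ### Images of morphisms and generic finiteness. -/

/-- The image of an irreducible closed set under a morphism of finite type of affine schemes contains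
a nonempty open subset of its closure. -/
lemma exists_notMem_forall_exists_comap_eq {B A : Type*} [CommRing B] [CommRing A] [Algebra B A]
    [Algebra.FiniteType B A] (Q : Ideal A) [Q.IsPrime] :
    ∃ b : B, b ∉ Q.comap (algebraMap B A) ∧ ∀ q : Ideal B, q.IsPrime →
      Q.comap (algebraMap B A) ≤ q → b ∉ q →
      ∃ Q' : Ideal A, Q'.IsPrime ∧ Q'.comap (algebraMap B A) = q := by
  let p := Q.comap (algebraMap B A)
  have : p.IsPrime := inferInstance
  let _ : Algebra (B ⧸ p) (A ⧸ Q) := (Ideal.quotientMap Q (algebraMap B A) le_rfl).toAlgebra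
  have hinj : Function.Injective (algebraMap (B ⧸ p) (A ⧸ Q)) := Ideal.quotientMap_injective
  have : IsScalarTower B (B ⧸ p) (A ⧸ Q) := .of_algebraMap_eq' rfl
  have : Algebra.FiniteType (B ⧸ p) (A ⧸ Q) :=
    Algebra.FiniteType.of_restrictScalars_finiteType B _ _
  obtain ⟨c, d, x, h⟩ := exists_isGenericNoether hinj
  obtain ⟨b, rfl⟩ := Ideal.Quotient.mk_surjective c
  refine ⟨b, fun hb ↦ h.ne_zero (Ideal.Quotient.eq_zero_iff_mem.mpr hb), fun q hq hpq hbq ↦ ?_⟩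
  have hq' : (q.map (Ideal.Quotient.mk p)).IsPrime :=
    Ideal.map_isPrime_of_surjective Ideal.Quotient.mk_surjective (by rwa [Ideal.mk_ker])
  have hc : (q.map (Ideal.Quotient.mk p)).comap (Ideal.Quotient.mk p) = q := by
    rw [Ideal.comap_map_of_surjective _ Ideal.Quotient.mk_surjective, ← RingHom.ker_eq_comap_bot,
      Ideal.mk_ker, sup_eq_left.mpr hpq]
  have hb' : Ideal.Quotient.mk p b ∉ q.map (Ideal.Quotient.mk p) := fun h1 ↦ hbq (by
    rw [← hc]
    exact h1)
  obtain ⟨Q', hQ', h1⟩ := h.exists_prime _ hb'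
  refine ⟨Q'.comap (Ideal.Quotient.mk Q), inferInstance, ?_⟩
  rw [← hc, ← IsGenericNoether.comap_algebraMap_eq h1, Ideal.comap_comap, Ideal.comap_comap]
  rfl

section GenericallyFinite

variable {Z T : Scheme.{0}} {s : Z ⟶ SpecC} {t : T ⟶ SpecC}

/-- Supplies the neighborhood that the lower bound for the dimension of the image requires. -/
lemma exists_isOpen_inter_closure_subset_range [LocallyOfFiniteType s] (f : Z ⟶ T)
    (h : f ≫ t = s) (z : Z) : ∃ U : Set T, IsOpen U ∧ f z ∈ U ∧ U ∩ closure {f z} ⊆ Set.range f := by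
  obtain ⟨R', κ, _, hκ, -⟩ := exists_chart isOpen_univ (Set.mem_univ (f z))
  obtain ⟨R, ι, _, hz, -, hι⟩ := exists_chart_of_hom s f κ isOpen_univ (Set.mem_univ z) hκ
  obtain ⟨p, rfl⟩ := exists_pt s ι hz
  let φ := chartMap ι κ f h hι
  let _ := φ.toRingHom.toAlgebra
  have : IsScalarTower ℂ (Coord t κ) (Coord s ι) :=
    IsScalarTower.of_algebraMap_eq' φ.comp_algebraMap.symm
  have : Algebra.FiniteType (Coord t κ) (Coord s ι) :=
    Algebra.FiniteType.of_restrictScalars_finiteType ℂ _ _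
  obtain ⟨b, hb, hq⟩ := exists_notMem_forall_exists_comap_eq (B := Coord t κ) p.asIdeal
  refine ⟨pt t κ '' PrimeSpectrum.basicOpen b, ?_, ?_, ?_⟩
  · exact (isOpenEmbedding_pt t κ).isOpenMap _ (PrimeSpectrum.basicOpen b).isOpen
  · rw [map_pt ι κ f h hι]
    exact ⟨_, hb, rfl⟩
  · rintro _ ⟨⟨q, hbq, rfl⟩, hcl⟩
    rw [← specializes_iff_mem_closure, map_pt ι κ f h hι, pt_specializes_iff] at hcl
    obtain ⟨Q, hQ, hQq⟩ := hq q.asIdeal q.isPrime hcl hbq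
    refine ⟨pt s ι ⟨Q, hQ⟩, ?_⟩
    rw [map_pt ι κ f h hι]
    congr 1
    exact PrimeSpectrum.ext hQq

variable {n : ℕ}

lemma topologicalKrullDim_eq [LocallyOfFiniteType s] (hle : ∀ z, tr ℂ (Res s z) ≤ n) {z : Z}
    (hz : n ≤ tr ℂ (Res s z)) : topologicalKrullDim Z = n := by
  rw [← topologicalKrullDim_univ]
  apply le_antisymm
  · have : QuasiSober (Set.univ : Set Z) :=
      isClosed_univ.isClosedEmbedding_subtypeVal.quasiSober
    exact topologicalKrullDim_le s _ n fun z _ ↦ hle z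
  · refine le_trans ?_ (tr_res_le_topologicalKrullDim s isOpen_univ (Set.mem_univ z)
      (Set.subset_univ _))
    exact_mod_cast hz

lemma topologicalKrullDim_range_eq [LocallyOfFiniteType s] [LocallyOfFiniteType t]
    [TopologicalSpace.NoetherianSpace Z] (f : Z ⟶ T) (h : f ≫ t = s)
    (hle : ∀ z, tr ℂ (Res s z) ≤ n) {z : Z} (hz : n ≤ tr ℂ (Res t (f z))) :
    topologicalKrullDim (Set.range f) = n := by
  apply le_antisymm
  · have := quasiSober_range f.continuous
    refine topologicalKrullDim_le t _ n ?_
    rintro _ ⟨z, rfl⟩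
    exact (tr_res_le s t f h z).trans (hle z)
  · obtain ⟨U, hU, hzU, hsub⟩ := exists_isOpen_inter_closure_subset_range f h z
    refine le_trans ?_ (tr_res_le_topologicalKrullDim t hU hzU hsub)
    exact_mod_cast hz

/-- Points of maximal transcendence degree whose images have the same property are isolated in their
fibers. -/
lemma quasiFiniteAt_of_le_tr [LocallyOfFiniteType s] [TopologicalSpace.NoetherianSpace Z]
    (f : Z ⟶ T) [LocallyOfFiniteType f] (h : f ≫ t = s) (hle : ∀ z, tr ℂ (Res s z) ≤ n) {z : Z}
    (hz : n ≤ tr ℂ (Res t (f z))) : f.QuasiFiniteAt z := by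
  let F := f ⁻¹' {f z}
  have htr (x : F) : n ≤ tr ℂ (Res s (x : Z)) := by
    refine hz.trans ?_
    have h1 : f x = f z := x.2
    rw [← h1]
    exact tr_res_le s t f h x
  -- All points of the fiber have maximal degree, so none specializes properly to another. A
  -- noetherian quasi-sober space with this property is finite and discrete.
  have hsp {x y : F} (hxy : x ⤳ y) : x = y := by
    apply Subtype.ext
    exact eq_of_specializes_of_tr_le s (hxy.map continuous_subtype_val) ((hle x).trans (htr y))
  have : QuasiSober F := (f.fiberHomeo (f z)).symm.isClosedEmbedding.quasiSober
  have hcl (C : Set F) (hC : IsIrreducible C) : ∃ x, closure C = {x} := by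
    refine ⟨hC.genericPoint, ?_⟩
    rw [← hC.genericPoint_closure_eq]
    refine subset_antisymm (fun y hy ↦ (hsp (specializes_iff_mem_closure.mpr hy)).symm) ?_
    exact subset_closure
  have : T1Space F := ⟨fun x ↦ by
    obtain ⟨y, hy⟩ := hcl {x} isIrreducible_singleton
    have h1 : x = y := by
      rw [← Set.mem_singleton_iff, ← hy]
      exact subset_closure rfl
    rw [h1, ← hy]
    exact isClosed_closure⟩
  have hfin : Finite F := by
    have h1 := TopologicalSpace.NoetherianSpace.finite_irreducibleComponents (α := F)
    have h2 : Function.Injective (irreducibleComponent : F → Set F) := by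
      intro x y hxy
      obtain ⟨g, hg⟩ := hcl _ (isIrreducible_irreducibleComponent (x := x))
      rw [isClosed_irreducibleComponent.closure_eq] at hg
      have hx : x ∈ irreducibleComponent x := mem_irreducibleComponent
      have hy : y ∈ irreducibleComponent x := hxy ▸ mem_irreducibleComponent
      rw [hg] at hx hy
      exact hx.trans hy.symm
    exact @Finite.of_injective F _ h1.to_subtype
      (fun x ↦ (⟨_, irreducibleComponent_mem_irreducibleComponents x⟩ : irreducibleComponents F))
      fun x y hxy ↦ h2 (congrArg Subtype.val hxy)
  rw [Scheme.Hom.quasiFiniteAt_iff_isOpen_singleton_asFiber, ← (f.fiberHomeo (f z)).isOpen_image]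
  exact isOpen_discrete _

/-- The fiber is discrete, and it is compact because `Z` is noetherian. -/
lemma finite_preimage_of_forall_quasiFiniteAt [TopologicalSpace.NoetherianSpace Z] (f : Z ⟶ T)
    [LocallyOfFiniteType f] {y : T} (h : ∀ z, f z = y → f.QuasiFiniteAt z) :
    (f ⁻¹' {y}).Finite := by
  have : DiscreteTopology (f ⁻¹' {y}) := by
    refine discreteTopology_iff_isOpen_singleton.mpr ?_
    rintro ⟨z, rfl⟩
    have h1 := Scheme.Hom.quasiFiniteAt_iff_isOpen_singleton_asFiber.mp (h z rfl)
    rw [← (f.fiberHomeo (f z)).isOpen_image] at h1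
    convert h1
    simp [Scheme.Hom.asFiber]
  have : CompactSpace (f ⁻¹' {y}) := inferInstance
  exact finite_of_compact_of_discrete

theorem isGenericallyFinite_of_tr [LocallyOfFiniteType s]
    [TopologicalSpace.NoetherianSpace Z] (f : Z ⟶ T) [LocallyOfFiniteType f] (h : f ≫ t = s)
    (hle : ∀ z, tr ℂ (Res s z) ≤ n) (hn : n ≠ 0)
    (hf : ∀ z, n ≤ tr ℂ (Res s z) → n ≤ tr ℂ (Res t (f z))) {z : Z}
    (hz : n ≤ tr ℂ (Res s z)) : IsGenericallyFinite f := by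
  -- The closed set where `f` is not quasi-finite; `W` is the complement of the closure of its
  -- image.
  let C := {z | f.QuasiFiniteAt z}ᶜ
  obtain ⟨S, hS, hS1, hS2, hSU⟩ :=
    TopologicalSpace.NoetherianSpace.exists_finite_set_isClosed_irreducible
      (f.isOpen_quasiFiniteAt.isClosed_compl)
  have hC : ∀ y ∈ closure (f '' C), ∃ c ∈ C, f c ⤳ y := by
    intro y hy
    change y ∈ closure (f '' {z | f.QuasiFiniteAt z}ᶜ) at hy
    rw [hSU, Set.sUnion_eq_biUnion, Set.image_iUnion₂, hS.closure_biUnion] at hy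
    obtain ⟨K, hK, hy⟩ := Set.mem_iUnion₂.mp hy
    have h1 := (hS2 K hK).isGenericPoint_genericPoint_closure
    rw [(hS1 K hK).closure_eq] at h1
    refine ⟨(hS2 K hK).genericPoint, ?_, ?_⟩
    · change _ ∈ {z | f.QuasiFiniteAt z}ᶜ
      rw [hSU]
      exact ⟨K, hK, h1.mem⟩
    · rw [specializes_iff_mem_closure, (h1.image f.continuous).def]
      exact hy
  refine ⟨⟨(closure (f '' C))ᶜ, isClosed_closure.isOpen_compl⟩, ?_, fun y hy ↦ ?_⟩
  · rw [topologicalKrullDim_eq hle hz]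
    change topologicalKrullDim ↥(f ⁻¹' (closure (f '' C))ᶜ)ᶜ < _
    rw [Set.preimage_compl, compl_compl]
    have hcl : IsClosed (f ⁻¹' closure (f '' C)) := isClosed_closure.preimage f.continuous
    have : QuasiSober ↥(f ⁻¹' closure (f '' C)) := hcl.isClosedEmbedding_subtypeVal.quasiSober
    -- As `n` is positive, it suffices to bound the degrees by `n - 1`.
    obtain ⟨m, rfl⟩ := Nat.exists_eq_succ_of_ne_zero hn
    refine (topologicalKrullDim_le s _ m fun x hx ↦ ?_).trans_lt (by exact_mod_cast Nat.lt_succ_self m)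
    by_contra! hlt
    have h1 : ((m + 1 : ℕ) : ℕ∞) ≤ tr ℂ (Res s x) := by
      push_cast
      exact Order.add_one_le_of_lt hlt
    -- The image of a point `x` of maximal degree has degree at least `n`. Some `c ∈ C` has an image
    -- that specializes to it, hence of degree at least `n`, and so `f` is quasi-finite at `c`.
    obtain ⟨c, hc, hcx⟩ := hC _ hx
    exact hc (quasiFiniteAt_of_le_tr f h hle ((hf x h1).trans (tr_res_le_of_specializes t hcx)))
  · refine finite_preimage_of_forall_quasiFiniteAt f fun z hz ↦ ?_
    by_contra hcon
    exact hy (subset_closure ⟨z, hcon, hz⟩)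

end GenericallyFinite

end MaxVarying

end

theorem proposition2p1
    {Y V X : Scheme.{0}} {sY : Y ⟶ MaxVarying.SpecC} {sV : V ⟶ MaxVarying.SpecC}
    -- `Y` is an irreducible quasi-projective complex variety with a projective embedding `j`
    [AlgebraicGeometry.IsIntegral Y] {N : ℕ} (j : Y ⟶ MaxVarying.ProjSpace N)
    (hj : MaxVarying.IsProjectiveEmbedding sY j)
    -- `V` is an irreducible quasi-projective complex variety of dimension `ℓ ≥ 1`
    [AlgebraicGeometry.IsIntegral V] (hV : MaxVarying.IsQuasiProjective sV)
    (ℓ : ℕ) (hℓ : 1 ≤ ℓ) (hVdim : topologicalKrullDim V = (ℓ : WithBot ℕ∞))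
    -- the family `X ⊆ V × Y` over `V`, with fibers of dimension `r`
    (i : X ⟶ pullback sV sY) [IsImmersion i] (r : ℕ)
    (hr : ∀ v : V, IsClosed {v} →
      topologicalKrullDim ↥(MaxVarying.toBase i ⁻¹' {v}) = (r : WithBot ℕ∞))
    -- the generic fiber is geometrically irreducible
    (hgen : GeometricallyIrreducible
      ((MaxVarying.toBase i).fiberToSpecResidueField (genericPoint V)))
    (hmax : MaxVarying.IsMaximallyVarying i j) :
    MaxVarying.IsGenericallyFinite (MaxVarying.rho i ℓ) ∧
    topologicalKrullDim ↥(Set.range (MaxVarying.rho i ℓ)) =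
      topologicalKrullDim (MaxVarying.fiberPower (MaxVarying.toBase i) ℓ) ∧
    topologicalKrullDim (MaxVarying.fiberPower (MaxVarying.toBase i) ℓ) =
      ((ℓ * (r + 1) : ℕ) : WithBot ℕ∞) := by
  obtain ⟨N', jV, hjV⟩ := hV
  obtain ⟨_, _⟩ := hjV.finiteType
  obtain ⟨_, _⟩ := hj.finiteType
  have hX := MaxVarying.finiteType_of_isImmersion i (pullback.fst sV sY ≫ sV)
  rw [← Category.assoc] at hX
  obtain ⟨hX1, hX2⟩ : LocallyOfFiniteType (MaxVarying.toBase i ≫ sV) ∧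
    QuasiCompact (MaxVarying.toBase i ≫ sV) := hX
  have := MaxVarying.isNoetherian (MaxVarying.toBase i ≫ sV)
  have : LocallyOfFiniteType (MaxVarying.toBase i) :=
    locallyOfFiniteType_of_comp _ sV
  have : QuasiCompact (MaxVarying.toBase i) := inferInstance
  obtain ⟨_, _⟩ := MaxVarying.finiteType_fpBase (MaxVarying.toBase i) ℓ
  obtain ⟨_, _⟩ := MaxVarying.finiteType_fpBase sY ℓ
  have := MaxVarying.isNoetherian (MaxVarying.fpBase (MaxVarying.toBase i) ℓ ≫ sV)
  have hρ := MaxVarying.rho_comp_fpBase i ℓ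
  have : LocallyOfFiniteType (MaxVarying.rho i ℓ) := by
    have : LocallyOfFiniteType (MaxVarying.rho i ℓ ≫ MaxVarying.fpBase sY ℓ) := hρ ▸ inferInstance
    exact locallyOfFiniteType_of_comp _ (MaxVarying.fpBase sY ℓ)
  have hη : MaxVarying.tr ℂ (MaxVarying.Res sV (genericPoint V)) = ℓ :=
    MaxVarying.tr_genericPoint sV hVdim
  have hr' : ∀ x, MaxVarying.tr ℂ (MaxVarying.Res (MaxVarying.toBase i ≫ sV) x) ≤
      MaxVarying.tr ℂ (MaxVarying.Res sV (MaxVarying.toBase i x)) + r :=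
    MaxVarying.tr_le_tr_add _ sV (MaxVarying.toBase i) rfl hr
  obtain ⟨ξ, hξη, hξ⟩ := MaxVarying.exists_generic_of_geometricallyIrreducible hgen
  have hξtr := MaxVarying.add_le_tr_generic (π := MaxVarying.toBase i) (sX := MaxVarying.toBase i ≫ sV) rfl hgen hr hξη hξ
  have hle (z : MaxVarying.fiberPower (MaxVarying.toBase i) ℓ) : MaxVarying.tr ℂ
      (MaxVarying.Res (MaxVarying.fpBase (MaxVarying.toBase i) ℓ ≫ sV) z) ≤ (ℓ * (r + 1) : ℕ) := by
    refine (MaxVarying.tr_fiberPower_le (MaxVarying.toBase i ≫ sV) sV rfl hr' z).trans ?_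
    rw [mul_add, mul_one, add_comm, Nat.cast_add]
    gcongr
    exact (MaxVarying.tr_res_le_of_specializes sV (genericPoint_specializes _)).trans hη.le
  obtain ⟨z, hz⟩ := MaxVarying.exists_le_tr_fiberPower (MaxVarying.toBase i ≫ sV) sV rfl (ξ := ξ)
    (r := r) (MaxVarying.tr_res_ne_top sV _) (by rwa [hξη]) ℓ
  have hz' : ((ℓ * (r + 1) : ℕ) : ℕ∞) ≤ MaxVarying.tr ℂ
      (MaxVarying.Res (MaxVarying.fpBase (MaxVarying.toBase i) ℓ ≫ sV) z) := by
    refine le_trans (le_of_eq ?_) hz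
    rw [hξη, hη]
    push_cast
    ring
  -- Maximal degree survives in the image; this is where maximal variation enters.
  have hfull (z) (hz : ((ℓ * (r + 1) : ℕ) : ℕ∞) ≤ MaxVarying.tr ℂ
      (MaxVarying.Res (MaxVarying.fpBase (MaxVarying.toBase i) ℓ ≫ sV) z)) :=
    MaxVarying.le_tr_rho i ℓ hgen j hmax hr hr' hη hξη hξ hz
  have hdim := MaxVarying.topologicalKrullDim_eq hle hz'
  refine ⟨?_, ?_, hdim⟩
  · exact MaxVarying.isGenericallyFinite_of_tr (MaxVarying.rho i ℓ) hρ hle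
      (Nat.mul_ne_zero (by lia) (by lia)) hfull hz'
  · rw [hdim]
    exact MaxVarying.topologicalKrullDim_range_eq (MaxVarying.rho i ℓ) hρ hle (hfull z hz')
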